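/- Conventions. A space $Y$ is $k$-connected if every map $S^{i}\to Y$ with $-1\le i\le k$ extends over $D^{i+1}$ (so $(-1)$-connected means non-empty, and there is no condition for $k\le -2$). For a simplicial complex $X$ and a simplex $\sigma$ of $X$, the link $\mathrm{Lk}(\sigma)$ consists of the simplices $\tau$ disjoint from $\sigma$ such that $\sigma\cup\tau$ is a simplex of $X$. Write $wCM(X)\ge n$ if $X$ is weakly Cohen–Macaulay of dimension $n$: $|X|$ is $(n-1)$-connected, and the link of each $p$-simplex of $X$ is $(n-p-2)$-connected, for all $p \geq 0$. A simplicial map is simplexwise injective if its restriction to each simplex is injective. A PL triangulation of $P\subset I^n=[0,1]^n$ is a finite simplicial complex $K$ with a piecewise linear homeomorphism $|K|\to P$. Theorem. Let $n \geq 0$, let $X$ be a simplicial complex with $wCM(X)\ge n$, and let $f:\partial I^n\to |X|$ be a map which is simplicial with respect to some PL triangulation $|L|\approx\partial I^n$. Then there are a PL triangulation $|K|\approx I^n$ extending the given one (that is, $L$ is a subcomplex of $K$ and the homeomorphism $|K|\to I^n$ restricts to $|L|\to \partial I^n$) and an extension of $f$ to a map $g: I^n\to|X|$, simplicial with respect to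 $K$, such that (i) $g(\mathrm{Lk}(v))\subset \mathrm{Lk}(g(v))$ for each interior vertex $v$ of $K$, i.e. each vertex $v\in I^n\setminus\partial I^n$; and (ii) if $f$ is simplexwise injective (on $L$), then $g$ is simplexwise injective (on $K$). -/

import Mathlib

/-- `p` is a point of the geometric realization of `K`, written in barycentric coordinates: the
coordinates are non-negative, add up to `1`, and the vertices with non-zero coordinate span a
simplex of `K`. -/
def IsRealizationPoint {V : Type*} (K : PreAbstractSimplicialComplex V) (p : V →₀ ℝ) : Prop :=
  p.support ∈ K.faces ∧ (∀ v, 0 ≤ p v) ∧ (p.sum fun _ a => a) = 1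

/-- The geometric realization `|K|` of a simplicial complex. -/
def Realization {V : Type*} (K : PreAbstractSimplicialComplex V) : Type _ :=
  {p : V →₀ ℝ // IsRealizationPoint K p}

/-- The weak topology on `|K|`: a set is open iff its intersection with every closed simplex
`{p | p.support ⊆ s}` is open in that simplex, which carries the usual topology (the one induced
by the barycentric coordinates). -/
instance {V : Type*} (K : PreAbstractSimplicialComplex V) : TopologicalSpace (Realization K) :=
  ⨆ s : K.faces, TopologicalSpace.coinduced
    (Subtype.val : {p : Realization K // p.1.support ⊆ s.1} → Realization K)
    (TopologicalSpace.induced (fun p => (p.1.1 : V → ℝ)) inferInstance)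

/-- The point of `|K|` given by a vertex of `K`. -/
noncomputable def Realization.vertex {V : Type*} (K : PreAbstractSimplicialComplex V) (v : V)
    (hv : {v} ∈ K.faces) : Realization K :=
  ⟨Finsupp.single v 1, by
    classical
    refine ⟨?_, ?_, ?_⟩
    · have h : (Finsupp.single v (1 : ℝ)).support = {v} := by
        ext w
        simp [eq_comm]
      rwa [h]
    · intro w
      rw [Finsupp.single_apply]
      split_ifs <;> norm_num
    · simp⟩

open Classical in
/-- A simplicial map: a map of vertices that sends simplices to simplices. -/
structure SimplicialMap {V W : Type*} (K : PreAbstractSimplicialComplex V)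
    (L : PreAbstractSimplicialComplex W) where
  toFun : V → W
  image_mem : ∀ s ∈ K.faces, s.image toFun ∈ L.faces

/-- The map of realizations `|K| → |L|` induced by a simplicial map, affine on each simplex. -/
noncomputable def SimplicialMap.realize {V W : Type*} {K : PreAbstractSimplicialComplex V}
    {L : PreAbstractSimplicialComplex W} (φ : SimplicialMap K L) (p : Realization K) :
    Realization L :=
  ⟨Finsupp.mapDomain φ.toFun p.1, by
    classical
    obtain ⟨p, hp, h0, h1⟩ := p
    have hsum : ((Finsupp.mapDomain φ.toFun p).sum fun _ a => a) = 1 := by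
      rw [Finsupp.sum_mapDomain_index (fun _ => rfl) (fun _ _ _ => rfl)]
      exact h1
    refine ⟨?_, ?_, hsum⟩
    · have himg := φ.image_mem _ hp
      refine (L.isRelLowerSet_faces himg).2 ?_ ?_
      · intro w hw
        have := Finsupp.mapDomain_support hw
        simp only [Finset.mem_image] at this ⊢
        exact this
      · rw [Finset.nonempty_iff_ne_empty]
        intro he
        have hz : Finsupp.mapDomain φ.toFun p = 0 := Finsupp.support_eq_empty.1 he
        rw [hz] at hsum
        simp at hsum
    · intro w
      simp only [Finsupp.mapDomain, Finsupp.sum, Finsupp.finsetSum_apply]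
      refine Finset.sum_nonneg fun v _ => ?_
      rw [Finsupp.single_apply]
      split_ifs
      · exact h0 v
      · exact le_rfl⟩

/-- A simplicial map is simplexwise injective if it is injective on (the vertices of) every
simplex. -/
def SimplicialMap.SimplexwiseInjective {V W : Type*} {K : PreAbstractSimplicialComplex V}
    {L : PreAbstractSimplicialComplex W} (φ : SimplicialMap K L) : Prop :=
  ∀ s ∈ K.faces, Set.InjOn φ.toFun (s : Set V)

open Classical in
/-- The link of `s` in `K`: all simplices `t` disjoint from `s` for which `s ∪ t` is again a
simplex of `K`. -/
def link {V : Type*} (K : PreAbstractSimplicialComplex V) (s : Finset V) :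
    PreAbstractSimplicialComplex V where
  faces := {t | t.Nonempty ∧ Disjoint s t ∧ s ∪ t ∈ K.faces}
  isRelLowerSet_faces := by
    rintro t ⟨hne, hd, hu⟩
    refine ⟨hne, fun u hut hu' => ⟨hu', ?_, ?_⟩⟩
    · exact hd.mono_right hut
    · exact (K.isRelLowerSet_faces hu).2 (Finset.union_subset_union_right hut)
        (hu'.mono Finset.subset_union_right)

open Classical in
/-- `φ(Lk(v)) ⊆ Lk(φ(v))`: every simplex of the link of `v` is mapped to a simplex of the link
of `φ(v)`. -/
def SimplicialMap.MapsLinkToLink {V W : Type*} {K : PreAbstractSimplicialComplex V}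
    {L : PreAbstractSimplicialComplex W} (φ : SimplicialMap K L) (v : V) : Prop :=
  ∀ t ∈ (link K {v}).faces, t.image φ.toFun ∈ (link L {φ.toFun v}).faces

/-- A space `Y` is `k`-connected if every map `∂I^m → Y` with `m ≤ k + 1` extends over `I^m`; here
`(I^m, ∂I^m)` is the pair (disc, sphere) `(D^m, S^(m-1))`. For `m = 0` the condition says that `Y`
is non-empty, so `(-1)`-connected means non-empty, and it is void for `k ≤ -2`. -/
def IsKConnected (k : ℤ) (Y : Type*) [TopologicalSpace Y] : Prop :=
  ∀ m : ℕ, (m : ℤ) ≤ k + 1 → ∀ f : C(Cube.boundary (Fin m), Y),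
    ∃ F : C(Fin m → unitInterval, Y), ∀ x : Cube.boundary (Fin m), F x.1 = f x

/-- `wCM(X) ≥ n`: the complex `X` is weakly Cohen–Macaulay of dimension `n`, that is, it is
`(n-1)`-connected and the link of every `p`-simplex is `(n-p-2)`-connected. -/
def IsWeaklyCohenMacaulay {V : Type*} (X : PreAbstractSimplicialComplex V) (n : ℤ) : Prop :=
  IsKConnected (n - 1) (Realization X) ∧
    ∀ (p : ℕ), ∀ s ∈ X.faces, s.card = p + 1 →
      IsKConnected (n - p - 2) (Realization (link X s))

/-- A map `F` from `|K|` to `ℝⁿ` is piecewise linear if there is a finite subdivision `S` of `K`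
(a geometric simplicial complex in the space of barycentric coordinates with underlying set `|K|`,
each of whose simplices lies in a simplex of `K`) such that `F` is affine on each simplex
of `S`. -/
def IsPiecewiseLinear {V : Type*} {n : ℕ} (K : PreAbstractSimplicialComplex V)
    (F : Realization K → Fin n → ℝ) : Prop :=
  ∃ S : Geometry.SimplicialComplex ℝ (V →₀ ℝ),
    S.faces.Finite ∧
    S.space = {p | IsRealizationPoint K p} ∧
    (∀ s ∈ S.faces, ∃ t ∈ K.faces, ∀ p ∈ convexHull ℝ (s : Set (V →₀ ℝ)), p.support ⊆ t) ∧
    ∀ s ∈ S.faces, ∃ A : (V →₀ ℝ) →ᵃ[ℝ] (Fin n → ℝ),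
      ∀ p : Realization K, p.1 ∈ convexHull ℝ (s : Set (V →₀ ℝ)) → F p = A p.1

/-- A PL triangulation, with finite vertex set `V`, of a (compact) subset `P` of the cube `I^n`: a
simplicial complex `K` with vertex set `V`, and a homeomorphism `|K| ≃ P` which is piecewise
linear (its inverse is then piecewise linear as well). -/
structure PLTriangulation {n : ℕ} (P : Set (Fin n → unitInterval)) (V : Type*) where
  finite : Finite V
  complex : AbstractSimplicialComplex V
  homeo : Realization complex.toPreAbstractSimplicialComplex ≃ₜ P
  isPiecewiseLinear : IsPiecewiseLinear complex.toPreAbstractSimplicialComplex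
    (fun p i => ((homeo p).1 i : ℝ))

/-- The underlying complex, for which `V` is the set of all vertices. -/
abbrev PLTriangulation.toComplex {n : ℕ} {P : Set (Fin n → unitInterval)} {V : Type*}
    (T : PLTriangulation P V) : PreAbstractSimplicialComplex V :=
  T.complex.toPreAbstractSimplicialComplex

/-- The point of `P` at which the vertex `v` of the triangulation is placed. -/
noncomputable def PLTriangulation.vertexPoint {n : ℕ} {P : Set (Fin n → unitInterval)}
    {V : Type*} (T : PLTriangulation P V) (v : V) : P :=
  T.homeo (Realization.vertex T.toComplex v (T.complex.singleton_mem v))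

/-- The triangulation `T'` of `Q` extends the triangulation `T` of `P ⊆ Q`: the complex of `T` is
a subcomplex of that of `T'` (by an injective simplicial map `ι`), and the homeomorphism of `T'`
restricts to that of `T`. -/
def PLTriangulation.Extends {n : ℕ} {P Q : Set (Fin n → unitInterval)} {V V' : Type*}
    (T' : PLTriangulation Q V') (T : PLTriangulation P V) : Prop :=
  ∃ ι : SimplicialMap T.toComplex T'.toComplex, Function.Injective ι.toFun ∧
    ∀ p, (T'.homeo (ι.realize p)).1 = (T.homeo p).1

/-- The map `f : P → |X|` is simplicial with respect to the triangulation `T` of `P`, and `φ` is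
the corresponding map of complexes (which is determined by `f`). -/
def PLTriangulation.IsSimplicialVia {n : ℕ} {P : Set (Fin n → unitInterval)} {V W : Type*}
    (T : PLTriangulation P V) {X : PreAbstractSimplicialComplex W} (f : P → Realization X)
    (φ : SimplicialMap T.toComplex X) : Prop :=
  ∀ p, f (T.homeo p) = φ.realize p

/-! The cube is a cone on its boundary. The map $f$ is extended over a subdivision $K$ of the cone
on $L$, relative to $L$, in such a way that every edge of $K$ whose ends have the same image lies in
$L$. This gives (i) and (ii). If $v$ is interior and a vertex $w$ of its link has the same image,
then the edge $vw$ lies in $L$, so $v$ is on the boundary, a contradiction. If $f$ is simplexwise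
injective, then no edge of $L$ is collapsed, hence no edge at all.

Some extension exists because $X$ is $(n-1)$-connected and simplicial approximation works relative
to $L$ (`fill_of_isKConnected`). Call a simplex outside $L$ bad if each of its vertices shares its
image with another of its vertices (`Doubled`); a collapsed edge outside $L$ is bad. Let $\sigma$ be
a bad simplex of maximal dimension. By maximality $g$ maps $\mathrm{Lk}(\sigma)$ to
$\mathrm{Lk}(g(\sigma))$. Since $\sigma$ has at least twice as many vertices as $g(\sigma)$, the
link of $g(\sigma)$ is connected enough for an induction on dimension: the map on
$\mathrm{Lk}(\sigma)$ extends over a subdivision $M$ of the cone on $\mathrm{Lk}(\sigma)$ without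
new bad simplices. Replacing the star of $\sigma$ by $\partial\sigma * M$ removes $\sigma$ and
creates nothing bad (`exists_badSet_ssubset`, `goodFill`).

All subdivisions are iterated stellar subdivisions, so that this part is pure combinatorics of
finite sets. A stellar subdivision of the cone is realized in the cube by sending new vertices to
barycenters (`Stell.exists_position`) and coning off the given homeomorphism at the center
(`bijOn_coneMap`). Piecewise linearity is encoded as linearity on the closed cells of an arrangement
of hyperplanes. This form is stable under coning and linear substitution; `exists_adhLinear` leads
to it, and the derived subdivision of the arrangement (`exists_derived_subdivision`) leads back. It
also yields $\dim L<n$ (`card_le_of_injective`). -/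

namespace StellarFill

open Finset

/-! ### Finite complexes, cones, links and stellar subdivisions. -/

section Combinatorics

variable {U : Type*} [DecidableEq U]

/-- A finite simplicial complex, given by the set of its simplices, the empty one included. -/
structure IsComplex (K : Finset (Finset U)) : Prop where
  empty_mem : ∅ ∈ K
  down_closed : ∀ s ∈ K, ∀ t ⊆ s, t ∈ K

/-- The vertices of a complex. -/
def vset (K : Finset (Finset U)) : Finset U := K.biUnion id

lemma mem_vset {K : Finset (Finset U)} {v : U} : v ∈ vset K ↔ ∃ s ∈ K, v ∈ s := by
  simp [vset]

lemma subset_vset {K : Finset (Finset U)} {s : Finset U} (hs : s ∈ K) : s ⊆ vset K :=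
  fun _ hv => mem_vset.2 ⟨s, hs, hv⟩

lemma IsComplex.singleton_mem {K : Finset (Finset U)} (hK : IsComplex K) {v : U}
    (hv : v ∈ vset K) : {v} ∈ K := by
  obtain ⟨s, hs, hvs⟩ := mem_vset.1 hv
  exact hK.down_closed s hs _ (by simpa using hvs)

/-- The cone on `L` with apex `a`. -/
def cone (a : U) (L : Finset (Finset U)) : Finset (Finset U) := L ∪ L.image (insert a)

lemma mem_cone {a : U} {L : Finset (Finset U)} {s : Finset U} :
    s ∈ cone a L ↔ s ∈ L ∨ ∃ t ∈ L, insert a t = s := by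
  simp [cone]

/-- The link of a simplex. -/
def lk (K : Finset (Finset U)) (σ : Finset U) : Finset (Finset U) :=
  K.filter fun τ => Disjoint σ τ ∧ σ ∪ τ ∈ K

lemma mem_lk {K : Finset (Finset U)} (hK : IsComplex K) {σ τ : Finset U} :
    τ ∈ lk K σ ↔ Disjoint σ τ ∧ σ ∪ τ ∈ K := by
  simp only [lk, mem_filter, and_iff_right_iff_imp]
  exact fun h => hK.down_closed _ h.2 _ subset_union_right

/-- The stellar subdivision of `K` at `σ` with new vertex `b`. -/
def star (K : Finset (Finset U)) (σ : Finset U) (b : U) : Finset (Finset U) :=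
  (K.filter fun τ => ¬ σ ⊆ τ) ∪ ((K.filter fun τ => ¬ σ ⊆ τ ∧ τ ∪ σ ∈ K).image (insert b))

lemma mem_star {K : Finset (Finset U)} {σ ρ : Finset U} {b : U} :
    ρ ∈ star K σ b ↔ (ρ ∈ K ∧ ¬ σ ⊆ ρ) ∨
      ∃ τ ∈ K, ¬ σ ⊆ τ ∧ τ ∪ σ ∈ K ∧ insert b τ = ρ := by
  simp only [star, mem_union, mem_filter, mem_image]
  grind

lemma isComplex_cone {a : U} {L : Finset (Finset U)} (hL : IsComplex L) :
    IsComplex (cone a L) := by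
  refine ⟨mem_cone.2 (.inl hL.empty_mem), fun s hs t hts => ?_⟩
  rw [mem_cone] at hs ⊢
  rcases hs with hs | ⟨r, hr, rfl⟩
  · exact .inl (hL.down_closed s hs t hts)
  · by_cases ha : a ∈ t
    · exact .inr ⟨t.erase a, hL.down_closed r hr _ (by grind), by grind⟩
    · exact .inl (hL.down_closed r hr _ (by grind))

lemma isComplex_lk {K : Finset (Finset U)} (hK : IsComplex K) {σ : Finset U} (hσ : σ ∈ K) :
    IsComplex (lk K σ) := by
  refine ⟨(mem_lk hK).2 ⟨by simp, by simpa using hσ⟩, fun s hs t hts => ?_⟩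
  rw [mem_lk hK] at hs ⊢
  exact ⟨hs.1.mono_right hts, hK.down_closed _ hs.2 _ (union_subset_union_right hts)⟩

lemma isComplex_star {K : Finset (Finset U)} (hK : IsComplex K) {σ : Finset U} {b : U}
    (hσ : σ.Nonempty) : IsComplex (star K σ b) := by
  have hne : ¬ σ ⊆ ∅ := by simpa using hσ.ne_empty
  refine ⟨mem_star.2 (.inl ⟨hK.empty_mem, hne⟩), fun s hs t hts => ?_⟩
  rw [mem_star] at hs ⊢
  rcases hs with hs | ⟨r, hr, h1, h2, rfl⟩
  · exact .inl ⟨hK.down_closed s hs.1 t hts, fun h => hs.2 (h.trans hts)⟩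
  · by_cases ha : b ∈ t
    · refine .inr ⟨t.erase b, hK.down_closed r hr _ (by grind), fun h => h1 (h.trans (by grind)),
        hK.down_closed _ h2 _ (union_subset_union_left (by grind)), by grind⟩
    · have htr : t ⊆ r := by grind
      exact .inl ⟨hK.down_closed r hr _ htr, fun h => h1 (h.trans htr)⟩

lemma vset_star_subset {K : Finset (Finset U)} {σ : Finset U} {b : U} :
    vset (star K σ b) ⊆ insert b (vset K) := by
  intro v hv
  obtain ⟨s, hs, hvs⟩ := mem_vset.1 hv
  rcases mem_star.1 hs with hs | ⟨r, hr, -, -, rfl⟩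
  · exact mem_insert_of_mem (subset_vset hs.1 hvs)
  · rcases mem_insert.1 hvs with rfl | h
    · exact mem_insert_self _ _
    · exact mem_insert_of_mem (subset_vset hr h)

lemma vset_cone {a : U} {L : Finset (Finset U)} : vset (cone a L) ⊆ insert a (vset L) := by
  intro v hv
  obtain ⟨s, hs, hvs⟩ := mem_vset.1 hv
  rcases mem_cone.1 hs with hs | ⟨r, hr, rfl⟩
  · exact mem_insert_of_mem (subset_vset hs hvs)
  · rcases mem_insert.1 hvs with rfl | h
    · exact mem_insert_self _ _
    · exact mem_insert_of_mem (subset_vset hr h)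

/-- `K'` is a stellar subdivision of `K` at a simplex not contained in `P`, with a new vertex
outside `Z`. -/
def Step (P Z : Finset U) (K K' : Finset (Finset U)) : Prop :=
  ∃ σ ∈ K, ¬ σ ⊆ P ∧ ∃ b, b ∉ Z ∧ b ∉ vset K ∧ K' = star K σ b

/-- `K'` is an iterated stellar subdivision of `K` at simplices not contained in `P`, with new
vertices outside `Z`. -/
def Stell (P Z : Finset U) : Finset (Finset U) → Finset (Finset U) → Prop :=
  Relation.ReflTransGen (Step P Z)

/-- `K` is a complex of cards at most `n + 1` containing `L` as a full subcomplex. -/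
structure Rel (L : Finset (Finset U)) (n : ℕ) (K : Finset (Finset U)) : Prop where
  isComplex : IsComplex K
  subset : L ⊆ K
  full : ∀ s ∈ K, s ⊆ vset L → s ∈ L
  card_le : ∀ s ∈ K, s.card ≤ n + 1

lemma Rel.vset_subset {L K : Finset (Finset U)} {n : ℕ} (h : Rel L n K) : vset L ⊆ vset K := by
  intro v hv
  obtain ⟨s, hs, hvs⟩ := mem_vset.1 hv
  exact subset_vset (h.subset hs) hvs

lemma rel_cone {L : Finset (Finset U)} {n : ℕ} {a : U} (hL : IsComplex L)
    (hn : ∀ s ∈ L, s.card ≤ n) (ha : a ∉ vset L) : Rel L n (cone a L) := by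
  refine ⟨isComplex_cone hL, fun s hs => mem_cone.2 (.inl hs), fun s hs h => ?_, fun s hs => ?_⟩
  · rcases mem_cone.1 hs with hs | ⟨r, hr, rfl⟩
    · exact hs
    · exact absurd (h (mem_insert_self _ _)) ha
  · rcases mem_cone.1 hs with hs | ⟨r, hr, rfl⟩
    · exact (hn s hs).trans (Nat.le_succ _)
    · exact (card_insert_le _ _).trans (by simpa using hn r hr)

lemma Rel.step {L K K' : Finset (Finset U)} {n : ℕ} {Z : Finset U} (h : Rel L n K)
    (hs : Step (vset L) Z K K') : Rel L n K' := by
  obtain ⟨σ, hσ, hσP, b, -, hbK, rfl⟩ := hs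
  have hne : σ.Nonempty := by
    rw [nonempty_iff_ne_empty]; rintro rfl; simp at hσP
  refine ⟨isComplex_star h.isComplex hne, fun s hs => ?_, fun s hs hsL => ?_, fun s hs => ?_⟩
  · exact mem_star.2 (.inl ⟨h.subset hs, fun h' => hσP (h'.trans (subset_vset hs))⟩)
  · rcases mem_star.1 hs with hs | ⟨r, hr, -, -, rfl⟩
    · exact h.full s hs.1 hsL
    · exact absurd (h.vset_subset (hsL (mem_insert_self _ _))) hbK
  · rcases mem_star.1 hs with hs | ⟨r, hr, h1, h2, rfl⟩
    · exact h.card_le s hs.1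
    -- The new simplex is $r\cup\{b\}$, where $r$ is a proper subset of the simplex $r\cup\sigma$;
    -- so the dimension does not grow.
    · have h3 := h.card_le _ h2
      have h4 : r.card < (r ∪ σ).card := card_lt_card
        ⟨subset_union_left, fun h' => h1 (subset_union_right.trans h')⟩
      have := card_insert_le b r
      omega

lemma Rel.stell {L K K' : Finset (Finset U)} {n : ℕ} {Z : Finset U} (h : Rel L n K)
    (hs : Stell (vset L) Z K K') : Rel L n K' := by
  induction hs with
  | refl => exact h
  | tail _ h2 ih => exact ih.step h2

/-! ### Replacing the star of a simplex. -/

/-- `K` with the open star of `σ` replaced by the join of `∂σ` and `M`. -/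
def replaceStar (K : Finset (Finset U)) (σ : Finset U) (M : Finset (Finset U)) :
    Finset (Finset U) :=
  (K.filter fun τ => ¬ σ ⊆ τ) ∪ ((σ.ssubsets ×ˢ M).image fun x => x.1 ∪ x.2)

lemma mem_replaceStar {K M : Finset (Finset U)} {σ ρ : Finset U} :
    ρ ∈ replaceStar K σ M ↔ (ρ ∈ K ∧ ¬ σ ⊆ ρ) ∨ ∃ τ μ, τ ⊂ σ ∧ μ ∈ M ∧ τ ∪ μ = ρ := by
  simp only [replaceStar, mem_union, mem_filter, mem_image, mem_product, mem_ssubsets,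
    Prod.exists, and_assoc]

/-- The closed star of $\sigma$ is $\sigma * \mathrm{Lk}(\sigma)$, and starring it at $b$ gives
$\partial\sigma * (b * \mathrm{Lk}(\sigma))$. So replacement by the cone is a single stellar step,
the starting point of `Gluable.stell`. -/
lemma replaceStar_cone {K : Finset (Finset U)} (hK : IsComplex K) {σ : Finset U} {b : U} :
    replaceStar K σ (cone b (lk K σ)) = star K σ b := by
  ext ρ
  rw [mem_replaceStar, mem_star]
  constructor
  · rintro (h | ⟨τ, μ, hτ, hμ, rfl⟩)
    · exact .inl h
    · rcases mem_cone.1 hμ with hμ | ⟨ν, hν, rfl⟩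
      · rw [mem_lk hK] at hμ
        refine .inl ⟨hK.down_closed _ hμ.2 _ (union_subset_union_left hτ.1), fun h => hτ.2 ?_⟩
        intro x hx
        have := disjoint_left.1 hμ.1 hx
        grind
      · rw [mem_lk hK] at hν
        refine .inr ⟨τ ∪ ν, hK.down_closed _ hν.2 _ (union_subset_union_left hτ.1),
          fun h => hτ.2 ?_, hK.down_closed _ hν.2 _ ?_, by grind⟩
        · intro x hx
          have := disjoint_left.1 hν.1 hx
          grind
        · have := hτ.1
          grind
  · rintro (h | ⟨τ, hτ, h1, h2, rfl⟩)
    · exact .inl h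
    · refine .inr ⟨τ ∩ σ, insert b (τ \ σ), ⟨inter_subset_right, fun h => h1 (by grind)⟩,
        mem_cone.2 (.inr ⟨τ \ σ, (mem_lk hK).2 ⟨disjoint_sdiff, ?_⟩, rfl⟩), ?_⟩
      · exact hK.down_closed _ h2 _ (by grind)
      · ext x; simp only [mem_union, mem_inter, mem_insert, mem_sdiff]; tauto

/-- The properties of `M` under which `replaceStar K σ M` is a proper gluing. -/
structure Gluable (K : Finset (Finset U)) (σ : Finset U) (M : Finset (Finset U)) : Prop where
  isComplex : IsComplex M
  subset : lk K σ ⊆ M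
  full : ∀ s ∈ M, s ⊆ vset (lk K σ) → s ∈ lk K σ
  disj : ∀ v ∈ vset M, v ∈ vset K → v ∈ vset (lk K σ)

lemma disjoint_vset_lk {K : Finset (Finset U)} (hK : IsComplex K) {σ : Finset U} {v : U}
    (hv : v ∈ vset (lk K σ)) : v ∉ σ := by
  obtain ⟨s, hs, hvs⟩ := mem_vset.1 hv
  exact disjoint_right.1 ((mem_lk hK).1 hs).1 hvs

lemma Gluable.not_mem {K M : Finset (Finset U)} {σ : Finset U} (h : Gluable K σ M)
    (hK : IsComplex K) (hσ : σ ∈ K) {v : U} (hv : v ∈ vset M) : v ∉ σ := fun hvσ =>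
  disjoint_vset_lk hK (h.disj v hv (subset_vset hσ hvσ)) hvσ

/-- As $\kappa$ has a vertex outside $K$, every simplex containing it comes from $\partial\sigma *
M$; as $\kappa$ is disjoint from $\sigma$, it then lies in the factor from $M$. Hence subdividing
$M$ at $\kappa$ and forming the join with $\partial\sigma$ commute. -/
lemma star_replaceStar {K M : Finset (Finset U)} {σ κ : Finset U} {c : U} (hK : IsComplex K)
    (hσ : σ ∈ K) (hM : Gluable K σ M) (hκ : κ ∈ M) (hκL : ¬ κ ⊆ vset (lk K σ)) :
    star (replaceStar K σ M) κ c = replaceStar K σ (star M κ c) := by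
  obtain ⟨u, huκ, huL⟩ := not_subset.1 hκL
  have huK : u ∉ vset K := fun h => huL (hM.disj u (subset_vset hκ huκ) h)
  have hA : ∀ ρ ∈ K, ¬ κ ⊆ ρ := fun ρ hρ h => huK (subset_vset hρ (h huκ))
  have hκσ : ∀ x ∈ κ, x ∉ σ := fun x hx => hM.not_mem hK hσ (subset_vset hκ hx)
  have hsub : ∀ τ μ : Finset U, τ ⊂ σ → κ ⊆ τ ∪ μ → κ ⊆ μ := by
    intro τ μ hτ h x hx
    have := hκσ x hx
    have := h hx
    have := @hτ.1 x
    grind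
  ext ρ
  rw [mem_star, mem_replaceStar, mem_replaceStar]
  constructor
  · rintro (⟨h | ⟨τ, μ, hτ, hμ, rfl⟩, h'⟩ | ⟨ρ', h1, h2, h3, rfl⟩)
    · exact .inl h
    · refine .inr ⟨τ, μ, hτ, mem_star.2 (.inl ⟨hμ, fun h => h' (h.trans subset_union_right)⟩), rfl⟩
    · rcases mem_replaceStar.1 h3 with h3 | ⟨τ, μ, hτ, hμ, h3⟩
      · exact absurd subset_union_right (hA _ h3.1)
      · have hκμ : κ ⊆ μ := hsub τ μ hτ (h3 ▸ subset_union_right)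
        have hρ' : ρ' = (ρ' ∩ τ) ∪ (ρ' ∩ μ) := by
          rw [← inter_union_distrib_left, h3, inter_eq_left.2 subset_union_left]
        refine .inr ⟨ρ' ∩ τ, insert c (ρ' ∩ μ),
          ⟨inter_subset_right.trans hτ.1, fun h => hτ.2 (h.trans inter_subset_right)⟩,
          mem_star.2 (.inr ⟨ρ' ∩ μ, hM.isComplex.down_closed _ hμ _ inter_subset_right,
            fun h => h2 (h.trans inter_subset_left),
            hM.isComplex.down_closed _ hμ _ (union_subset inter_subset_right hκμ), rfl⟩), ?_⟩
        rw [union_insert, ← hρ']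
  · rintro (h | ⟨τ, μ, hτ, hμ, rfl⟩)
    · exact .inl ⟨.inl h, hA _ h.1⟩
    · rcases mem_star.1 hμ with ⟨hμ, h'⟩ | ⟨ν, hν, h1, h2, rfl⟩
      · exact .inl ⟨.inr ⟨τ, μ, hτ, hμ, rfl⟩, fun h => h' (hsub τ μ hτ h)⟩
      · refine .inr ⟨τ ∪ ν, mem_replaceStar.2 (.inr ⟨τ, ν, hτ, hν, rfl⟩),
          fun h => h1 (hsub τ ν hτ h), mem_replaceStar.2 (.inr ⟨τ, ν ∪ κ, hτ, h2, ?_⟩), ?_⟩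
        · rw [union_assoc]
        · rw [union_insert]

lemma Gluable.step {K M M' : Finset (Finset U)} {σ Z : Finset U} (h : Gluable K σ M)
    (hZ : vset K ⊆ Z)
    (hs : Step (vset (lk K σ)) Z M M') : Gluable K σ M' := by
  obtain ⟨κ, hκ, hκP, c, hcZ, hcM, rfl⟩ := hs
  have hne : κ.Nonempty := by
    rw [nonempty_iff_ne_empty]; rintro rfl; simp at hκP
  refine ⟨isComplex_star h.isComplex hne, fun s hs => ?_, fun s hs hsL => ?_, fun v hv hvK => ?_⟩
  · exact mem_star.2 (.inl ⟨h.subset hs, fun h' => hκP (h'.trans (subset_vset hs))⟩)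
  · rcases mem_star.1 hs with hs | ⟨r, hr, -, -, rfl⟩
    · exact h.full s hs.1 hsL
    · obtain ⟨t, ht, hct⟩ := mem_vset.1 (hsL (mem_insert_self _ _))
      exact absurd (subset_vset (h.subset ht) hct) hcM
  · rcases mem_insert.1 (vset_star_subset hv) with rfl | hv
    · exact absurd (hZ hvK) hcZ
    · exact h.disj v hv hvK

lemma gluable_cone {K : Finset (Finset U)} {σ : Finset U} {b : U} (hK : IsComplex K)
    (hσ : σ ∈ K) (hb : b ∉ vset K) : Gluable K σ (cone b (lk K σ)) := by
  have hL := isComplex_lk hK hσ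
  have hsub : vset (lk K σ) ⊆ vset K := by
    intro v hv
    obtain ⟨s, hs, hvs⟩ := mem_vset.1 hv
    exact subset_vset (mem_filter.1 hs).1 hvs
  refine ⟨isComplex_cone hL, fun s hs => mem_cone.2 (.inl hs), fun s hs h => ?_,
    fun v hv hvK => ?_⟩
  · rcases mem_cone.1 hs with hs | ⟨r, hr, rfl⟩
    · exact hs
    · exact absurd (hsub (h (mem_insert_self _ _))) hb
  · rcases mem_insert.1 (vset_cone hv) with rfl | h
    · exact absurd hvK hb
    · exact h

/-- Subdivisions of $M$ relative to the link lift to subdivisions of the glued complex, one step at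
a time by `star_replaceStar`. The new vertices must avoid all of $K$, not only $M$; this is the
purpose of the set of forbidden vertices in `Step`. -/
lemma Gluable.stell {K M M' : Finset (Finset U)} {σ P Z Z' : Finset U} (h : Gluable K σ M)
    (hK : IsComplex K) (hσ : σ ∈ K) (hσ0 : σ.Nonempty) (hP : P ⊆ vset K) (hZ : vset K ⊆ Z') (hZZ : Z ⊆ Z')
    (hs : Stell (vset (lk K σ)) Z' M M') :
    Gluable K σ M' ∧ Stell P Z (replaceStar K σ M) (replaceStar K σ M') := by
  induction hs with
  | refl => exact ⟨h, .refl⟩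
  | tail _ h2 ih =>
    obtain ⟨ih, ih'⟩ := ih
    refine ⟨ih.step hZ h2, ih'.tail ?_⟩
    obtain ⟨κ, hκ, hκP, c, hcZ, hcM, rfl⟩ := h2
    refine ⟨κ, mem_replaceStar.2 ?_, fun hκ' => hκP fun v hv =>
      ih.disj v (subset_vset hκ hv) (hP (hκ' hv)), c, fun hc => hcZ (hZZ hc), fun hc => ?_,
      (star_replaceStar hK hσ ih hκ hκP).symm⟩
    · exact .inr ⟨∅, κ, ⟨empty_subset _, by simpa using hσ0.ne_empty⟩, hκ, by simp⟩
    · obtain ⟨s, hs, hcs⟩ := mem_vset.1 hc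
      rcases mem_replaceStar.1 hs with hs | ⟨τ, μ, hτ, hμ, rfl⟩
      · exact hcZ (hZ (subset_vset hs.1 hcs))
      · rcases mem_union.1 hcs with h' | h'
        · exact hcZ (hZ (subset_vset hσ (hτ.1 h')))
        · exact hcM (subset_vset hμ h')

/-! ### Fillings of simplicial maps and the removal of bad simplices. -/

section Filling

variable {W : Type*} [DecidableEq W]

/-- The complexes that serve as targets: a possibly infinite set of simplices, the empty one
included. -/
structure IsTarget (Y : Set (Finset W)) : Prop where
  empty_mem : ∅ ∈ Y
  down_closed : ∀ s ∈ Y, ∀ t ⊆ s, t ∈ Y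

/-- The link of a simplex of a target. -/
def lkSet (Y : Set (Finset W)) (s : Finset W) : Set (Finset W) :=
  {t | Disjoint s t ∧ s ∪ t ∈ Y}

lemma IsTarget.lkSet {Y : Set (Finset W)} (hY : IsTarget Y) {s : Finset W} (hs : s ∈ Y) :
    IsTarget (lkSet Y s) :=
  ⟨⟨by simp, by simpa using hs⟩, fun _ ht _ hu =>
    ⟨ht.1.mono_right hu, hY.down_closed _ ht.2 _ (union_subset_union_right hu)⟩⟩

lemma lkSet_lkSet {Y : Set (Finset W)} {s t : Finset W} (hst : Disjoint s t) :
    StellarFill.lkSet (StellarFill.lkSet Y s) t = StellarFill.lkSet Y (s ∪ t) := by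
  ext u
  simp only [StellarFill.lkSet, Set.mem_ofPred_eq, disjoint_union_right, disjoint_union_left,
    union_assoc]
  tauto

variable (U) in
/-- Simplicial maps to `Y` from complexes of dimension less than `k` extend over stellar
subdivisions of the cone. -/
def Fill (Y : Set (Finset W)) (k : ℕ) : Prop :=
  ∀ L : Finset (Finset U), IsComplex L → (∀ s ∈ L, s.card ≤ k) →
    ∀ f : U → W, (∀ s ∈ L, s.image f ∈ Y) → ∀ Z : Finset U, vset L ⊆ Z → ∀ a ∉ Z,
      ∃ K, Stell (vset L) (insert a Z) (cone a L) K ∧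
        ∃ g : U → W, (∀ v ∈ vset L, g v = f v) ∧ ∀ s ∈ K, s.image g ∈ Y

/-- Every vertex of `s` has the same image under `g` as some other vertex of `s`. -/
def Doubled (g : U → W) (s : Finset U) : Prop := ∀ v ∈ s, ∃ w ∈ s, w ≠ v ∧ g w = g v

/-- Each fibre over the image has at least two elements. This inequality carries the dimension count
in `goodFill`. -/
lemma Doubled.two_mul_card_image_le {g : U → W} {s : Finset U} (h : Doubled g s) :
    2 * (s.image g).card ≤ s.card := by
  rw [card_eq_sum_card_image g s, mul_comm, ← smul_eq_mul]
  refine card_nsmul_le_sum _ _ _ fun w hw => ?_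
  obtain ⟨v, hv, rfl⟩ := mem_image.1 hw
  obtain ⟨v', hv', hne, he⟩ := h v hv
  exact one_lt_card.2 ⟨v, by simp [hv], v', by simp [hv', he], hne.symm⟩

lemma Doubled.insert {g : U → W} {s : Finset U} {w : U} (h : Doubled g s) (hw : w ∉ s)
    (hg : g w ∈ s.image g) : Doubled g (insert w s) := by
  obtain ⟨u, hu, hgu⟩ := mem_image.1 hg
  intro v hv
  rcases mem_insert.1 hv with rfl | hv
  · exact ⟨u, mem_insert_of_mem hu, fun h' => hw (h' ▸ hu), hgu⟩
  · obtain ⟨v', hv', h1, h2⟩ := h v hv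
    exact ⟨v', mem_insert_of_mem hv', h1, h2⟩

/-- The doubled simplices of `K` outside `L`. -/
noncomputable def badSet (L K : Finset (Finset U)) (g : U → W) : Finset (Finset U) := by
  classical exact K.filter fun s => Doubled g s ∧ s ∉ L

lemma mem_badSet {L K : Finset (Finset U)} {g : U → W} {s : Finset U} :
    s ∈ badSet L K g ↔ s ∈ K ∧ Doubled g s ∧ s ∉ L := by
  simp [badSet]

/-- Extension of simplicial maps over the cone, creating no doubled simplices. -/
def GoodFill (U : Type*) [DecidableEq U] (Y : Set (Finset W)) (k : ℕ) : Prop :=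
  ∀ L : Finset (Finset U), IsComplex L → (∀ s ∈ L, s.card ≤ k) →
    ∀ f : U → W, (∀ s ∈ L, s.image f ∈ Y) → ∀ Z : Finset U, vset L ⊆ Z → ∀ a ∉ Z,
      ∃ K, Stell (vset L) (insert a Z) (cone a L) K ∧
        ∃ g : U → W, (∀ v ∈ vset L, g v = f v) ∧ (∀ s ∈ K, s.image g ∈ Y) ∧
          ∀ s ∈ K, Doubled g s → s ∈ L

/-- One step of the removal of bad simplices: the star of a bad simplex `σ` of maximal dimension is
replaced by the join of `∂σ` and a good filling of its link. -/
lemma exists_badSet_ssubset [Infinite U] {Y : Set (Finset W)} (hY : IsTarget Y) {n : ℕ}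
    {L K : Finset (Finset U)} {Z : Finset U} (hK : Rel L n K)
    {g : U → W} (hg : ∀ s ∈ K, s.image g ∈ Y) {σ : Finset U} (hσ : σ ∈ badSet L K g)
    (hmax : ∀ τ ∈ badSet L K g, τ.card ≤ σ.card)
    (hfill : GoodFill U (StellarFill.lkSet Y (σ.image g)) (n + 1 - σ.card)) :
    ∃ K', Stell (vset L) Z K K' ∧ ∃ g' : U → W, (∀ v ∈ vset L, g' v = g v) ∧
      (∀ s ∈ K', s.image g' ∈ Y) ∧ badSet L K' g' ⊂ badSet L K g := by
  obtain ⟨hσK, hσd, hσL⟩ := mem_badSet.1 hσ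
  have hKc := hK.isComplex
  have hσ0 : σ.Nonempty := by
    rw [nonempty_iff_ne_empty]
    rintro rfl
    exact hσL (hK.full _ hσK (empty_subset _))
  have hlkc := isComplex_lk hKc hσK
  have hlk : ∀ τ ∈ lk K σ, τ.image g ∈ StellarFill.lkSet Y (σ.image g) := by
    intro τ hτ
    obtain ⟨hd, hτ⟩ := (mem_lk hKc).1 hτ
    refine ⟨?_, by rw [← image_union]; exact hg _ hτ⟩
    rw [disjoint_right]
    intro y hy hy'
    obtain ⟨w, hw, rfl⟩ := mem_image.1 hy
    have hwσ : w ∉ σ := disjoint_right.1 hd hw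
    -- A vertex $w$ of the link with image in $g(\sigma)$ would make $\sigma\cup\{w\}$ a larger bad
    -- simplex; it is not in $L$ because $L$ is full and $\sigma\notin L$.
    have hins : Insert.insert w σ ∈ K := hKc.down_closed _ hτ _ (by grind)
    have := hmax _ (mem_badSet.2 ⟨hins, hσd.insert hwσ hy', fun h =>
      hσL (hK.full _ hσK ((subset_insert _ _).trans (subset_vset h)))⟩)
    rw [card_insert_of_notMem hwσ] at this
    omega
  have hlkcard : ∀ τ ∈ lk K σ, τ.card ≤ n + 1 - σ.card := by
    intro τ hτ
    obtain ⟨hd, hτ⟩ := (mem_lk hKc).1 hτ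
    have := hK.card_le _ hτ
    rw [card_union_of_disjoint hd] at this
    omega
  have hlkv : vset (lk K σ) ⊆ vset K := by
    intro v hv
    obtain ⟨s, hs, hvs⟩ := mem_vset.1 hv
    exact subset_vset (mem_filter.1 hs).1 hvs
  obtain ⟨b, hb⟩ := Infinite.exists_notMem_finset (vset K ∪ Z)
  have hbK : b ∉ vset K := fun h => hb (mem_union_left _ h)
  obtain ⟨M, hM, h, hgh, hhY, hhd⟩ := hfill (lk K σ) hlkc hlkcard g hlk (vset K ∪ Z)
    (hlkv.trans subset_union_left) b hb
  obtain ⟨hglue, hst⟩ := (gluable_cone hKc hσK hbK).stell hKc hσK hσ0 hK.vset_subset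
    (subset_union_left.trans (subset_insert b _)) (subset_union_right.trans (subset_insert b _)) hM
  rw [replaceStar_cone hKc] at hst
  -- The old map on old vertices, the filling on new ones; the two agree on the link, which contains
  -- all vertices common to $K$ and $M$.
  set g' : U → W := fun v => if v ∈ vset K then g v else h v with hg'
  have hg'K : ∀ s ⊆ vset K, s.image g' = s.image g := fun s hs =>
    image_congr fun v hv => by simp [hg', hs hv]
  have hg'M' : ∀ v ∈ vset M, g' v = h v := by
    intro v hv
    by_cases hvK : v ∈ vset K
    · simp [hg', hvK, hgh v (hglue.disj v hv hvK)]
    · simp [hg', hvK]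
  have hg'M : ∀ s ∈ M, s.image g' = s.image h := fun s hs =>
    image_congr fun v hv => hg'M' v (subset_vset hs hv)
  refine ⟨replaceStar K σ M, .trans (.single ⟨σ, hσK, fun h' => hσL (hK.full _ hσK h'), b,
    fun h' => hb (mem_union_right _ h'), hbK, rfl⟩) hst, g', fun v hv => ?_, fun s hs => ?_, ?_⟩
  · simp [hg', hK.vset_subset hv]
  · rcases mem_replaceStar.1 hs with ⟨hs, -⟩ | ⟨τ, μ, hτ, hμ, rfl⟩
    · rw [hg'K s (subset_vset hs)]; exact hg s hs
    · rw [image_union, hg'K τ (hτ.1.trans (subset_vset hσK)), hg'M μ hμ]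
      exact hY.down_closed _ (hhY μ hμ).2 _ (union_subset_union_left (image_subset_image hτ.1))
  · have hσn : σ ∉ badSet L (replaceStar K σ M) g' := by
      intro h'
      rcases mem_replaceStar.1 (mem_badSet.1 h').1 with ⟨-, hs⟩ | ⟨τ, μ, hτ, hμ, he⟩
      · exact hs subset_rfl
      · refine hτ.2 fun x hx => ?_
        rcases mem_union.1 (he ▸ hx) with h1 | h1
        · exact h1
        · exact absurd hx (hglue.not_mem hKc hσK (subset_vset hμ h1))
    refine ⟨fun ρ hρ => ?_, fun h' => hσn (h' hσ)⟩
    obtain ⟨hρ, hρd, hρL⟩ := mem_badSet.1 hρ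
    have hdK : ρ ∈ K → ρ ∈ badSet L K g := by
      refine fun hρK => mem_badSet.2 ⟨hρK, fun v hv => ?_, hρL⟩
      obtain ⟨w, hw, h1, h2⟩ := hρd v hv
      refine ⟨w, hw, h1, ?_⟩
      simpa [hg', subset_vset hρK hv, subset_vset hρK hw] using h2
    rcases mem_replaceStar.1 hρ with hρ | ⟨τ, μ, hτ, hμ, rfl⟩
    · exact hdK hρ.1
    -- The images of $\tau\subset\sigma$ and of $\mu$ are disjoint, one lying in $g(\sigma)$ and the
    -- other in its link. So if $\tau\cup\mu$ is doubled, then $\mu$ is doubled by itself, and the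
    -- good filling has $\mu\in\mathrm{Lk}(\sigma)$. Thus $\tau\cup\mu$ was already a bad simplex of
    -- $K$.
    · have hμd : Doubled h μ := by
        intro v hv
        obtain ⟨w, hw, h1, h2⟩ := hρd v (mem_union_right _ hv)
        have hgv := hg'M' v (subset_vset hμ hv)
        rcases mem_union.1 hw with hw | hw
        · exfalso
          refine disjoint_left.1 (hhY μ hμ).1 (mem_image_of_mem g (hτ.1 hw)) ?_
          have : g' w = g w := by simp [hg', subset_vset hσK (hτ.1 hw)]
          rw [← this, h2, hgv]
          exact mem_image_of_mem _ hv
        · exact ⟨w, hw, h1, by rw [← hg'M' w (subset_vset hμ hw), h2, hgv]⟩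
      have hμL := (mem_lk hKc).1 (hhd μ hμ hμd)
      exact hdK (hKc.down_closed _ hμL.2 _ (union_subset_union_left hτ.1))

lemma Stell.trans {P Z : Finset U} {K K' K'' : Finset (Finset U)} (h : Stell P Z K K')
    (h' : Stell P Z K' K'') : Stell P Z K K'' :=
  Relation.ReflTransGen.trans h h'

/-- If the links of `Y` are sufficiently connected, then `Y` has good fillings. -/
theorem goodFill [Infinite U] (n : ℕ) : ∀ {Y : Set (Finset W)}, IsTarget Y →
    (∀ s ∈ Y, ∀ k, k + s.card ≤ n → Fill U (StellarFill.lkSet Y s) k) → GoodFill U Y n := by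
  induction n using Nat.strong_induction_on with
  | _ n ih =>
  intro Y hY hfill L hL hLn f hf Z hZ a ha
  have hfill0 : Fill U Y n := by
    have := hfill ∅ hY.empty_mem n (by simp)
    rwa [show StellarFill.lkSet Y ∅ = Y by ext; simp [StellarFill.lkSet]] at this
  obtain ⟨K, hK, g, hgf, hgY⟩ := hfill0 L hL hLn f hf Z hZ a ha
  have hrel := rel_cone hL hLn (fun h => ha (hZ h))
  -- Inner induction on the number of bad simplices, with `Y` fixed.
  suffices H : ∀ N : ℕ, ∀ K, Stell (vset L) (Insert.insert a Z) (cone a L) K → ∀ g : U → W,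
      (∀ v ∈ vset L, g v = f v) → (∀ s ∈ K, s.image g ∈ Y) → (badSet L K g).card = N →
      ∃ K, Stell (vset L) (Insert.insert a Z) (cone a L) K ∧
        ∃ g : U → W, (∀ v ∈ vset L, g v = f v) ∧ (∀ s ∈ K, s.image g ∈ Y) ∧
          ∀ s ∈ K, Doubled g s → s ∈ L from H _ K hK g hgf hgY rfl
  intro N
  induction N using Nat.strong_induction_on with
  | _ N ihN =>
  rintro K hK g hgf hgY rfl
  rcases (badSet L K g).eq_empty_or_nonempty with h0 | h0
  · refine ⟨K, hK, g, hgf, hgY, fun s hs hd => ?_⟩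
    by_contra hsL
    have := mem_badSet.2 ⟨hs, hd, hsL⟩
    simp [h0] at this
  · have hKr := hrel.stell hK
    obtain ⟨σ, hσ, hmax⟩ := exists_max_image _ card h0
    obtain ⟨hσK, hσd, hσL⟩ := mem_badSet.1 hσ
    have hσ0 : σ.Nonempty := by
      rw [nonempty_iff_ne_empty]
      rintro rfl
      exact hσL hL.empty_mem
    have hc := hσd.two_mul_card_image_le
    have hc0 := (hσ0.image g).card_pos
    have hcn := hKr.card_le σ hσK
    -- Outer induction, applied to the link of $g(\sigma)$. From $|\sigma|\ge 2|g(\sigma)|\ge 2$ one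
    -- gets $n+1-|\sigma|<n$, and $k+|s|\le n+1-|\sigma|$ implies $k+|g(\sigma)\cup s|\le n$.
    have hg2 : GoodFill U (StellarFill.lkSet Y (σ.image g)) (n + 1 - σ.card) := by
      refine ih _ (by omega) (hY.lkSet (hgY σ hσK)) fun s hs k hk => ?_
      rw [lkSet_lkSet hs.1]
      refine hfill _ hs.2 k ?_
      rw [card_union_of_disjoint hs.1]
      omega
    obtain ⟨K', hK', g', hg', hgY', hlt⟩ := exists_badSet_ssubset hY hKr
      (Z := Insert.insert a Z) hgY hσ hmax hg2
    exact ihN _ (card_lt_card hlt) K' (hK.trans hK') g' (fun v hv => by rw [hg' v hv, hgf v hv])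
      hgY' rfl

end Filling

end Combinatorics

/-! ### Radial homeomorphism between the cube and the corner simplex. -/

section CubeSimplex

variable {m : ℕ}

/-- Radial rescaling of the standard cube onto the standard corner simplex. -/
noncomputable def cubeToCorner (y : Fin m → ℝ) : Fin m → ℝ := (‖y‖ / ∑ i, y i) • y

/-- Radial rescaling of the standard corner simplex onto the standard cube. -/
noncomputable def cornerToCube (q : Fin m → ℝ) : Fin m → ℝ := ((∑ i, q i) / ‖q‖) • q

lemma apply_le_sum {q : Fin m → ℝ} (hq : 0 ≤ q) (i : Fin m) : q i ≤ ∑ i, q i :=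
  single_le_sum (f := q) (fun j _ => hq j) (mem_univ i)

lemma norm_le_sum {q : Fin m → ℝ} (hq : 0 ≤ q) : ‖q‖ ≤ ∑ i, q i := by
  refine (pi_norm_le_iff_of_nonneg (sum_nonneg fun j _ => hq j)).2 fun i => ?_
  rw [Real.norm_of_nonneg (hq i)]
  exact apply_le_sum hq i

lemma sum_pos_of_ne {q : Fin m → ℝ} (hq : 0 ≤ q) (h : q ≠ 0) : 0 < ∑ i, q i :=
  (norm_pos_iff.2 h).trans_le (norm_le_sum hq)

lemma norm_cubeToCorner_le {q : Fin m → ℝ} (hq : 0 ≤ q) : ‖cubeToCorner q‖ ≤ ‖q‖ := by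
  by_cases h : q = 0
  · simp [h, cubeToCorner]
  · have h1 := sum_pos_of_ne hq h
    rw [cubeToCorner, norm_smul, norm_div, norm_norm, Real.norm_of_nonneg h1.le, div_mul_eq_mul_div,
      div_le_iff₀ h1]
    exact mul_le_mul_of_nonneg_left (norm_le_sum hq) (norm_nonneg _)

lemma norm_cornerToCube {q : Fin m → ℝ} (hq : 0 ≤ q) : ‖cornerToCube q‖ = ∑ i, q i := by
  by_cases h : q = 0
  · simp [h, cornerToCube]
  · have h1 := sum_pos_of_ne hq h
    have h2 := norm_pos_iff.2 h
    rw [cornerToCube, norm_smul, norm_div, norm_norm, Real.norm_of_nonneg h1.le]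
    field_simp

/-- Only the origin needs an argument: there the quotient is $0/0$, the value is $0$, and the norm
estimate gives the limit. -/
lemma continuousOn_cubeToCorner : ContinuousOn (cubeToCorner (m := m)) {q | 0 ≤ q} := by
  intro q hq
  by_cases h : q = 0
  · subst h
    rw [ContinuousWithinAt, show cubeToCorner (0 : Fin m → ℝ) = 0 by simp [cubeToCorner]]
    refine squeeze_zero_norm' (a := fun q => ‖q‖) ?_ ?_
    · filter_upwards [self_mem_nhdsWithin] with q hq using norm_cubeToCorner_le hq
    · exact (continuous_norm.tendsto' 0 0 norm_zero).mono_left nhdsWithin_le_nhds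
  · have h1 := sum_pos_of_ne hq h
    refine ContinuousAt.continuousWithinAt ?_
    unfold cubeToCorner
    refine ContinuousAt.smul (ContinuousAt.div (by fun_prop) (by fun_prop) h1.ne') (by fun_prop)

lemma continuousOn_cornerToCube : ContinuousOn (cornerToCube (m := m)) {q | 0 ≤ q} := by
  intro q hq
  by_cases h : q = 0
  · subst h
    rw [ContinuousWithinAt, show cornerToCube (0 : Fin m → ℝ) = 0 by simp [cornerToCube]]
    refine squeeze_zero_norm' (a := fun q => ∑ i, q i) ?_ ?_
    · filter_upwards [self_mem_nhdsWithin] with q hq using (norm_cornerToCube hq).le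
    · exact (Continuous.tendsto' (by fun_prop) 0 0 (by simp)).mono_left nhdsWithin_le_nhds
  · have h1 := norm_pos_iff.2 h
    refine ContinuousAt.continuousWithinAt ?_
    unfold cornerToCube
    refine ContinuousAt.smul (ContinuousAt.div (by fun_prop) (by fun_prop) h1.ne') (by fun_prop)

lemma sum_cubeToCorner {y : Fin m → ℝ} (hy : 0 ≤ y) : ∑ i, cubeToCorner y i = ‖y‖ := by
  by_cases h : y = 0
  · simp [h, cubeToCorner]
  · have h1 := sum_pos_of_ne hy h
    simp only [cubeToCorner, Pi.smul_apply, smul_eq_mul, ← mul_sum]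
    field_simp

lemma cubeToCorner_cornerToCube {q : Fin m → ℝ} (hq : 0 ≤ q) :
    cubeToCorner (cornerToCube q) = q := by
  by_cases h : q = 0
  · simp [h, cornerToCube, cubeToCorner]
  · have h1 := sum_pos_of_ne hq h
    have h2 := norm_pos_iff.2 h
    rw [cubeToCorner, norm_cornerToCube hq]
    simp only [cornerToCube, Pi.smul_apply, smul_eq_mul, ← mul_sum, smul_smul]
    rw [show (∑ i, q i) / ((∑ i, q i) / ‖q‖ * ∑ i, q i) * ((∑ i, q i) / ‖q‖) = 1 by field_simp,
      one_smul]

end CubeSimplex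

/-! ### Closed simplices in coordinates, and extension of maps over them. -/

section Cells

variable {U : Type*} [DecidableEq U]

/-- The closed simplex with vertex set `τ`, in barycentric coordinates. -/
def cell (τ : Finset U) : Set (U → ℝ) :=
  {x | (∀ v, 0 ≤ x v) ∧ (∀ v ∉ τ, x v = 0) ∧ ∑ v ∈ τ, x v = 1}

/-- The union of the closed simplices of a complex. -/
def geo (K : Finset (Finset U)) : Set (U → ℝ) := ⋃ τ ∈ K, cell τ

lemma mem_geo {K : Finset (Finset U)} {x : U → ℝ} : x ∈ geo K ↔ ∃ τ ∈ K, x ∈ cell τ := by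
  simp [geo]

lemma isClosed_cell (τ : Finset U) : IsClosed (cell τ) := by
  have : cell τ = (⋂ v, {x : U → ℝ | 0 ≤ x v}) ∩ ((⋂ v ∈ {v | v ∉ τ}, {x : U → ℝ | x v = 0}) ∩
      {x | ∑ v ∈ τ, x v = 1}) := by
    ext x; simp [cell]
  rw [this]
  refine IsClosed.inter (isClosed_iInter fun v => ?_) (IsClosed.inter
    (isClosed_biInter fun v _ => ?_) ?_)
  · exact isClosed_le (by fun_prop) (by fun_prop)
  · exact isClosed_eq (by fun_prop) (by fun_prop)
  · exact isClosed_eq (by fun_prop) (by fun_prop)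

lemma isClosed_geo (K : Finset (Finset U)) : IsClosed (geo K) :=
  isClosed_biUnion_finset fun τ _ => isClosed_cell τ

lemma mem_cell_of_subset {τ ρ : Finset U} {x : U → ℝ} (hx : x ∈ cell τ)
    (h : ∀ v ∈ τ, v ∉ ρ → x v = 0) : x ∈ cell ρ := by
  have hρ : ∀ v ∉ ρ, x v = 0 := fun v hv => by
    by_cases hvτ : v ∈ τ
    · exact h v hvτ hv
    · exact hx.2.1 v hvτ
  refine ⟨hx.1, hρ, ?_⟩
  rw [← hx.2.2]
  calc ∑ v ∈ ρ, x v = ∑ v ∈ ρ ∪ τ, x v :=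
        sum_subset subset_union_left fun v _ hv => hρ v hv
    _ = ∑ v ∈ τ, x v := (sum_subset subset_union_right fun v _ hv => hx.2.1 v hv).symm

lemma cell_mono {τ ρ : Finset U} (h : τ ⊆ ρ) : cell τ ⊆ cell ρ := fun _ hx =>
  mem_cell_of_subset hx fun _ hv hv' => absurd (h hv) hv'

lemma mem_cell_inter {τ ρ : Finset U} {x : U → ℝ} (hx : x ∈ cell τ) (hx' : x ∈ cell ρ) :
    x ∈ cell (τ ∩ ρ) := by
  refine mem_cell_of_subset hx fun v hv hv' => hx'.2.1 v fun h => hv' (mem_inter.2 ⟨hv, h⟩)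

lemma mem_cell_erase {τ : Finset U} {x : U → ℝ} (hx : x ∈ cell τ) {v : U} (hv : x v = 0) :
    x ∈ cell (τ.erase v) :=
  mem_cell_of_subset hx fun w hw hw' => by
    have : w = v := by by_contra h; exact hw' (mem_erase.2 ⟨h, hw⟩)
    rw [this, hv]

/-- Connectivity is phrased with cubes. Dropping the coordinate $v_0$ identifies the simplex with a
corner simplex, and radial rescaling identifies that with a cube of dimension $|\tau|-1$. With `α`
from the cube and `β` to it, extend $F\circ\alpha$ from the boundary to $G$ and take $G\circ\beta$.
It suffices that $\alpha\circ\beta$ is the identity and that both maps preserve boundaries. -/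
lemma exists_extension_cell {Y : Type*} [TopologicalSpace Y] {k : ℤ}
    (hY : IsKConnected k Y) {τ : Finset U} (hτ : τ.Nonempty) (hk : (τ.card : ℤ) ≤ k + 2)
    {F : (U → ℝ) → Y} (hF : ContinuousOn F (⋃ ρ ∈ τ.ssubsets, cell ρ)) :
    ∃ F' : (U → ℝ) → Y, ContinuousOn F' (cell τ) ∧
      Set.EqOn F' F (⋃ ρ ∈ τ.ssubsets, cell ρ) := by
  obtain ⟨v₀, hv₀⟩ := hτ
  set m := (τ.erase v₀).card with hm
  have hcard : m + 1 = τ.card := card_erase_add_one hv₀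
  let e : Fin m ≃ {v // v ∈ τ.erase v₀} := (τ.erase v₀).equivFin.symm
  have hsum : ∀ x : U → ℝ, ∑ v ∈ τ.erase v₀, x v = ∑ i, x (e i) := fun x => by
    rw [← sum_coe_sort]
    exact (Equiv.sum_comp e fun v => x v.1).symm
  have hsum' : ∀ x ∈ cell τ, ∑ i, x (e i) = 1 - x v₀ := fun x hx => by
    rw [← hsum, ← hx.2.2, ← add_sum_erase _ _ hv₀]; ring
  let val : (Fin m → unitInterval) → Fin m → ℝ := fun y i => y i
  have hval : Continuous val := by fun_prop
  have hval0 : ∀ y, 0 ≤ val y := fun y i => (y i).2.1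
  let α : (Fin m → unitInterval) → U → ℝ := fun y v =>
    if h : v ∈ τ.erase v₀ then cubeToCorner (val y) (e.symm ⟨v, h⟩) else
      if v = v₀ then 1 - ‖val y‖ else 0
  have hαc : Continuous α := by
    have hc : Continuous fun y => cubeToCorner (val y) :=
      continuousOn_cubeToCorner.comp_continuous hval hval0
    refine continuous_pi fun v => ?_
    by_cases h : v ∈ τ.erase v₀
    · simp only [α, h, dif_pos]
      exact (continuous_apply _).comp hc
    · by_cases h' : v = v₀
      · subst h'
        simp only [α, if_true, notMem_erase, not_false_eq_true, dif_neg]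
        fun_prop
      · simp only [α, h, h', dif_neg, if_false, not_false_eq_true]
        fun_prop
  have hαe : ∀ y i, α y (e i) = cubeToCorner (val y) i := fun y i => by
    simp only [α, (e i).2, dif_pos, Subtype.coe_eta, Equiv.symm_apply_apply]
  have hα0 : ∀ y, α y v₀ = 1 - ‖val y‖ := fun y => by simp [α]
  have hval1 : ∀ y, ‖val y‖ ≤ 1 := fun y =>
    (pi_norm_le_iff_of_nonneg zero_le_one).2 fun i => by
      rw [Real.norm_of_nonneg (hval0 y i)]; exact (y i).2.2
  have hαcell : ∀ y, α y ∈ cell τ := by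
    refine fun y => ⟨fun v => ?_, fun v hv => ?_, ?_⟩
    · simp only [α]
      split_ifs with h h'
      · exact mul_nonneg (div_nonneg (norm_nonneg _) (sum_nonneg fun i _ => hval0 y i))
          (hval0 y _)
      · linarith [hval1 y]
      · exact le_rfl
    · have h2 : v ≠ v₀ := by rintro rfl; exact hv hv₀
      simp [α, h2, hv]
    · rw [← add_sum_erase _ _ hv₀, hsum, hα0]
      simp only [hαe, sum_cubeToCorner (hval0 y)]
      ring
  have hαb : ∀ y ∈ Cube.boundary (Fin m), α y ∈ ⋃ ρ ∈ τ.ssubsets, cell ρ := by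
    rintro y ⟨i, hi⟩
    have key : ∀ v ∈ τ, α y v = 0 → α y ∈ ⋃ ρ ∈ τ.ssubsets, cell ρ := fun v hv h0 =>
      Set.mem_biUnion (mem_ssubsets.2 (erase_ssubset hv)) (mem_cell_erase (hαcell y) h0)
    rcases hi with hi | hi
    · refine key (e i) (erase_subset _ _ (e i).2) ?_
      rw [hαe]
      simp [cubeToCorner, val, hi]
    · refine key v₀ hv₀ ?_
      rw [hα0, sub_eq_zero]
      refine le_antisymm ?_ (hval1 y)
      have := norm_le_pi_norm (val y) i
      simpa [val, hi] using this
  -- The clamping by `Set.projIcc` makes `β` total; it changes nothing on the simplex (`hβv`).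
  let β : (U → ℝ) → Fin m → unitInterval := fun x i =>
    Set.projIcc 0 1 zero_le_one (cornerToCube (fun i => x (e i)) i)
  have hβc : ContinuousOn β (cell τ) := by
    refine continuousOn_pi.2 fun i => continuous_projIcc.comp_continuousOn ?_
    refine (continuous_apply i).comp_continuousOn ?_
    exact continuousOn_cornerToCube.comp (Continuous.continuousOn (by fun_prop))
      fun x hx i => hx.1 _
  have hx0 : ∀ x ∈ cell τ, (0 : Fin m → ℝ) ≤ fun i => x (e i) := fun x hx i => hx.1 _
  have hβv : ∀ x ∈ cell τ, val (β x) = cornerToCube fun i => x (e i) := by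
    intro x hx
    funext i
    have h0 : 0 ≤ cornerToCube (fun i => x (e i)) i :=
      mul_nonneg (div_nonneg (sum_nonneg fun i _ => hx.1 _) (norm_nonneg _)) (hx.1 _)
    have h1 : cornerToCube (fun i => x (e i)) i ≤ 1 := by
      refine (le_abs_self _).trans ((norm_le_pi_norm (cornerToCube fun i => x (e i)) i).trans ?_)
      rw [norm_cornerToCube (hx0 x hx), hsum' x hx]
      linarith [hx.1 v₀]
    simp only [val, β, Set.projIcc_of_mem zero_le_one (Set.mem_Icc.2 ⟨h0, h1⟩)]
  have hαβ : ∀ x ∈ cell τ, α (β x) = x := by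
    intro x hx
    funext v
    by_cases h : v ∈ τ.erase v₀
    · obtain ⟨i, hi⟩ := e.surjective ⟨v, h⟩
      have hv : v = e i := by rw [hi]
      rw [hv, hαe, hβv x hx, cubeToCorner_cornerToCube (hx0 x hx)]
    · by_cases h' : v = v₀
      · rw [h', hα0, hβv x hx, norm_cornerToCube (hx0 x hx), hsum' x hx]; ring
      · simp only [α, h, h', dif_neg, if_false, not_false_eq_true]
        exact (hx.2.1 v fun hv => h (mem_erase.2 ⟨h', hv⟩)).symm
  obtain ⟨G, hG⟩ := hY m (by omega) ⟨fun y => F (α y.1),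
    hF.comp_continuous (hαc.comp continuous_subtype_val) fun y => hαb y.1 y.2⟩
  refine ⟨fun x => G (β x), G.continuous.comp_continuousOn hβc, fun x hx => ?_⟩
  obtain ⟨ρ, hρ, hxρ⟩ := Set.mem_iUnion₂.1 hx
  rw [mem_ssubsets] at hρ
  have hxτ : x ∈ cell τ := cell_mono hρ.1 hxρ
  obtain ⟨v, hvτ, hvρ⟩ := exists_of_ssubset hρ
  have hxv : x v = 0 := hxρ.2.1 v hvρ
  have hb : β x ∈ Cube.boundary (Fin m) := by
    have hβi : ∀ i, ((β x i : unitInterval) : ℝ) = cornerToCube (fun i => x (e i)) i := fun i =>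
      congrFun (hβv x hxτ) i
    by_cases h' : v = v₀
    · have hs : ∑ i, x (e i) = 1 := by rw [hsum' x hxτ, ← h', hxv, sub_zero]
      have hn : ‖cornerToCube fun i => x (e i)‖ = 1 := by
        rw [norm_cornerToCube (hx0 x hxτ), hs]
      have : Nonempty (Fin m) := by
        by_contra h
        rw [not_nonempty_iff] at h
        simp at hs
      obtain ⟨i, hi⟩ := Finite.exists_max fun i => ‖cornerToCube (fun i => x (e i)) i‖
      replace hi : ‖cornerToCube (fun i => x (e i)) i‖ = 1 := le_antisymm
        (hn ▸ norm_le_pi_norm _ i) (hn ▸ (pi_norm_le_iff_of_nonneg (norm_nonneg _)).2 hi)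
      refine ⟨i, .inr (Subtype.ext ?_)⟩
      rw [hβi]
      rw [Real.norm_of_nonneg] at hi
      · exact hi
      · rw [← hβi]; exact (β x i).2.1
    · obtain ⟨i, hi⟩ := e.surjective ⟨v, mem_erase.2 ⟨h', hvτ⟩⟩
      refine ⟨i, .inl (Subtype.ext ?_)⟩
      rw [hβi]
      simp [cornerToCube, hi, hxv]
  have := hG ⟨β x, hb⟩
  simp only [ContinuousMap.coe_mk] at this
  exact this.trans (by rw [hαβ x hxτ])

/-- Extension of a map over the remaining simplices of a complex, whose dimensions are bounded by
the connectivity of the target. -/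
theorem exists_extension_geo {Y : Type*} [TopologicalSpace Y] {k : ℤ}
    (hY : IsKConnected k Y) {K : Finset (Finset U)} (hK : IsComplex K) :
    ∀ (N : ℕ) (L : Finset (Finset U)), IsComplex L → L ⊆ K → (K \ L).card = N →
      (∀ τ ∈ K, τ ∉ L → (τ.card : ℤ) ≤ k + 2) → ∀ F : (U → ℝ) → Y, ContinuousOn F (geo L) →
      ∃ F' : (U → ℝ) → Y, ContinuousOn F' (geo K) ∧ Set.EqOn F' F (geo L) := by
  classical
  intro N
  induction N with
  | zero =>
    intro L _ hLK hc _ F hF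
    have : L = K := hLK.antisymm (sdiff_eq_empty_iff_subset.1 (card_eq_zero.1 hc))
    subst this
    exact ⟨F, hF, fun x _ => rfl⟩
  | succ N ih =>
    intro L hL hLK hc hk F hF
    have hne : (K \ L).Nonempty := by rw [← card_pos]; omega
    obtain ⟨τ, hτ, hmin⟩ := exists_min_image _ card hne
    obtain ⟨hτK, hτL⟩ := mem_sdiff.1 hτ
    -- A missing simplex of least cardinality has its whole boundary in $L$, and hence meets the
    -- realization of $L$ in its boundary only.
    have hfaces : ∀ ρ, ρ ⊂ τ → ρ ∈ L := by
      intro ρ hρ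
      by_contra h
      have := hmin ρ (mem_sdiff.2 ⟨hK.down_closed τ hτK ρ hρ.1, h⟩)
      exact absurd (card_lt_card hρ) (by omega)
    have hτ0 : τ.Nonempty := by
      rw [nonempty_iff_ne_empty]; rintro rfl; exact hτL hL.empty_mem
    have hbd : (⋃ ρ ∈ τ.ssubsets, cell ρ) ⊆ geo L :=
      Set.iUnion₂_subset fun ρ hρ x hx => mem_geo.2 ⟨ρ, hfaces ρ (mem_ssubsets.1 hρ), hx⟩
    obtain ⟨F₁, hF₁, hF₁e⟩ := exists_extension_cell hY hτ0 (hk τ hτK hτL) (hF.mono hbd)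
    let F₂ : (U → ℝ) → Y := fun x => if x ∈ geo L then F x else F₁ x
    have hF₂L : Set.EqOn F₂ F (geo L) := fun x hx => by simp [F₂, hx]
    have hF₂τ : Set.EqOn F₂ F₁ (cell τ) := by
      intro x hx
      by_cases h : x ∈ geo L
      · rw [hF₂L h]
        obtain ⟨ρ, hρ, hxρ⟩ := mem_geo.1 h
        refine (hF₁e (Set.mem_biUnion (x := ρ ∩ τ) (mem_ssubsets.2 ⟨inter_subset_right, fun h' =>
          hτL (hL.down_closed ρ hρ τ (h'.trans inter_subset_left))⟩) (mem_cell_inter hxρ hx))).symm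
      · simp [F₂, h]
    have hL' : IsComplex (insert τ L) := by
      refine ⟨mem_insert_of_mem hL.empty_mem, fun s hs t hts => ?_⟩
      rcases mem_insert.1 hs with rfl | hs
      · by_cases h : t = s
        · simp [h]
        · exact mem_insert_of_mem (hfaces t (ssubset_of_subset_of_ne hts h))
      · exact mem_insert_of_mem (hL.down_closed s hs t hts)
    have hgeo : geo (insert τ L) = geo L ∪ cell τ := by
      simp [geo, Set.union_comm]
    have hF₂c : ContinuousOn F₂ (geo (insert τ L)) := by
      rw [hgeo]
      exact (hF.congr hF₂L).union_of_isClosed (hF₁.congr hF₂τ) (isClosed_geo L) (isClosed_cell τ)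
    obtain ⟨F', hF', hF'e⟩ := ih (insert τ L) hL' (insert_subset hτK hLK) (by
        rw [sdiff_insert, card_erase_of_mem hτ, hc]; rfl)
      (fun ρ hρ hρL => hk ρ hρ fun h => hρL (mem_insert_of_mem h)) F₂ hF₂c
    refine ⟨F', hF', fun x hx => ?_⟩
    rw [hF'e (by rw [hgeo]; exact .inl hx), hF₂L hx]

end Cells

/-! ### The weak topology. -/

section RealizationTopology

variable {W : Type*} {X : PreAbstractSimplicialComplex W}

lemma continuous_realization_of_support {Z : Type*} [TopologicalSpace Z] {s : Finset W}
    (hs : s ∈ X.faces) {F : Z → Realization X} (hF : ∀ z, (F z).1.support ⊆ s)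
    (hc : ∀ w, Continuous fun z => (F z).1 w) : Continuous F := by
  let t₁ : TopologicalSpace {p : Realization X // p.1.support ⊆ s} :=
    TopologicalSpace.induced (fun p => (p.1.1 : W → ℝ)) inferInstance
  have h1 : Continuous fun z => (⟨F z, hF z⟩ : {p : Realization X // p.1.support ⊆ s}) :=
    continuous_induced_rng.2 (continuous_pi hc)
  have h2 : Continuous (Subtype.val : {p : Realization X // p.1.support ⊆ s} → Realization X) := by
    rw [continuous_iff_coinduced_le]
    exact le_iSup (fun s : X.faces => TopologicalSpace.coinduced
      (Subtype.val : {p : Realization X // p.1.support ⊆ s.1} → Realization X)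
      (TopologicalSpace.induced (fun p => (p.1.1 : W → ℝ)) inferInstance)) ⟨s, hs⟩
  exact h2.comp h1

lemma isOpen_openStar (w : W) : IsOpen {p : Realization X | 0 < p.1 w} := by
  refine isOpen_iSup_iff.2 fun s => ?_
  rw [isOpen_coinduced]
  refine isOpen_induced_iff.2 ⟨{x | 0 < x w}, isOpen_lt (by fun_prop) (by fun_prop), rfl⟩

lemma isTarget_insert_faces (X : PreAbstractSimplicialComplex W) :
    IsTarget (insert ∅ X.faces) := by
  refine ⟨.inl rfl, fun s hs t ht => ?_⟩
  rcases t.eq_empty_or_nonempty with h | h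
  · exact .inl h
  · rcases hs with rfl | hs
    · exact .inl (subset_empty.1 ht)
    · exact .inr ((X.isRelLowerSet_faces hs).2 ht h)

end RealizationTopology

/-! ### The continuous extension over the cone. -/

section Push

variable {U W : Type*} [DecidableEq U] [DecidableEq W]

/-- The image of a point in barycentric coordinates under the map of vertices `f`. -/
noncomputable def push (f : U → W) (S : Finset U) (x : U → ℝ) : W →₀ ℝ :=
  ∑ v ∈ S, Finsupp.single (f v) (x v)

lemma push_apply (f : U → W) (S : Finset U) (x : U → ℝ) (w : W) :
    push f S x w = ∑ v ∈ S, if f v = w then x v else 0 := by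
  simp [push, Finsupp.finsetSum_apply, Finsupp.single_apply]

lemma push_support {f : U → W} {S τ : Finset U} {x : U → ℝ} (hx : x ∈ cell τ) :
    (push f S x).support ⊆ τ.image f := by
  intro w hw
  rw [Finsupp.mem_support_iff, push_apply] at hw
  obtain ⟨v, -, hv⟩ := exists_ne_zero_of_sum_ne_zero hw
  rw [ne_eq, ite_eq_right_iff, Classical.not_imp] at hv
  refine mem_image.2 ⟨v, ?_, hv.1⟩
  by_contra h
  exact hv.2 (hx.2.1 v h)

lemma isRealizationPoint_push {X : PreAbstractSimplicialComplex W} {f : U → W} {S τ : Finset U}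
    {x : U → ℝ} (hτS : τ ⊆ S) (hτ : τ.image f ∈ insert ∅ X.faces) (hx : x ∈ cell τ) :
    IsRealizationPoint X (push f S x) := by
  have hsum : ((push f S x).sum fun _ a => a) = 1 := by
    rw [push, ← Finsupp.sum_finsetSum_index (fun _ => rfl) (fun _ _ _ => rfl)]
    simp only [Finsupp.sum_single_index]
    rw [← hx.2.2]
    exact (sum_subset hτS fun v _ hv => hx.2.1 v hv).symm
  have hne : (push f S x).support.Nonempty := by
    rw [nonempty_iff_ne_empty]
    intro h
    rw [Finsupp.support_eq_empty.1 h] at hsum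
    simp at hsum
  refine ⟨?_, fun w => ?_, hsum⟩
  · rcases (isTarget_insert_faces X).down_closed _ hτ _ (push_support (S := S) hx) with h | h
    · exact absurd h hne.ne_empty
    · exact h
  · rw [push_apply]
    exact sum_nonneg fun v _ => by split_ifs; exacts [hx.1 v, le_rfl]

/-- A simplicial map to `X` extends continuously over the cone if `X` is sufficiently connected. -/
lemma exists_extension_cone {X : PreAbstractSimplicialComplex W} {k : ℕ}
    (hX : IsKConnected ((k : ℤ) - 1) (Realization X)) {L : Finset (Finset U)} (hL : IsComplex L)
    (hk : ∀ s ∈ L, s.card ≤ k) {f : U → W} (hf : ∀ s ∈ L, s.image f ∈ insert ∅ X.faces) (a : U) :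
    ∃ F : (U → ℝ) → Realization X, ContinuousOn F (geo (cone a L)) ∧
      ∀ x ∈ geo L, (F x).1 = push f (vset L) x := by
  classical
  -- Connectivity for $m=0$: the boundary of the $0$-cube is empty.
  have : Nonempty (Realization X) := by
    obtain ⟨F, -⟩ := hX 0 (by omega) ⟨fun x => absurd x.2.choose.2 (by simp), by
      refine continuous_of_const fun x => absurd x.2.choose.2 (by simp)⟩
    exact ⟨F 0⟩
  let F₀ : (U → ℝ) → Realization X := fun x =>
    if h : IsRealizationPoint X (push f (vset L) x) then ⟨_, h⟩ else Classical.arbitrary _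
  have hF₀ : ∀ x ∈ geo L, (F₀ x).1 = push f (vset L) x := fun x hx => by
    obtain ⟨τ, hτ, hxτ⟩ := mem_geo.1 hx
    have := isRealizationPoint_push (subset_vset hτ) (hf τ hτ) hxτ
    simp [F₀, this]
  have hcell : ∀ τ ∈ L, ContinuousOn F₀ (cell τ) := by
    intro τ hτ
    rcases hf τ hτ with h | h
    · have : τ = ∅ := image_eq_empty.1 h
      subst this
      convert! continuousOn_empty F₀
      ext x
      simp [cell]
    · rw [continuousOn_iff_continuous_domRestrict]
      refine continuous_realization_of_support h (fun x => ?_) fun w => ?_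
      · change (F₀ x.1).1.support ⊆ _
        rw [hF₀ x.1 (mem_geo.2 ⟨τ, hτ, x.2⟩)]
        exact push_support x.2
      · have : (fun z : cell τ => (F₀ z.1).1 w) = fun z =>
            ∑ v ∈ vset L, if f v = w then z.1 v else 0 := by
          funext x
          rw [hF₀ x.1 (mem_geo.2 ⟨τ, hτ, x.2⟩), push_apply]
        refine this ▸ ?_
        refine continuous_finsetSum _ fun v _ => ?_
        split_ifs
        · exact (continuous_apply v).comp continuous_subtype_val
        · exact continuous_const
  have hF₀c : ContinuousOn F₀ (geo L) := by
    have : ∀ M : Finset (Finset U), M ⊆ L → ContinuousOn F₀ (geo M) := by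
      intro M
      induction M using Finset.induction_on with
      | empty => intro _; simp [geo]
      | insert τ M _ ih =>
        intro hM
        have : geo (insert τ M) = cell τ ∪ geo M := by simp [geo]
        rw [this]
        exact (hcell τ (hM (mem_insert_self _ _))).union_of_isClosed
          (ih ((subset_insert _ _).trans hM)) (isClosed_cell τ) (isClosed_geo M)
    exact this L subset_rfl
  obtain ⟨F, hF, hFe⟩ := exists_extension_geo hX (isComplex_cone hL (a := a)) _ L hL
    (fun s hs => mem_cone.2 (.inl hs)) rfl (fun τ hτ _ => by
      rcases mem_cone.1 hτ with h | ⟨r, hr, rfl⟩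
      · have := hk τ h; omega
      · have := hk r hr
        have := card_insert_le a r
        omega) F₀ hF₀c
  exact ⟨F, hF, fun x hx => by rw [hFe hx, hF₀ x hx]⟩

end Push

/-! ### Distances, midpoints and the Lebesgue number. -/

section Mesh

variable {U : Type*}

/-- The square of the Euclidean distance, in the coordinates in `S`. -/
def sqd (S : Finset U) (x y : U → ℝ) : ℝ := ∑ v ∈ S, (x v - y v) ^ 2

lemma sqd_self (S : Finset U) (x : U → ℝ) : sqd S x x = 0 := by simp [sqd]

lemma sqd_comm (S : Finset U) (x y : U → ℝ) : sqd S x y = sqd S y x :=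
  sum_congr rfl fun _ _ => by ring

lemma sqd_nonneg (S : Finset U) (x y : U → ℝ) : 0 ≤ sqd S x y :=
  sum_nonneg fun _ _ => sq_nonneg _

/-- The midpoint of two points. -/
noncomputable def mid (x y : U → ℝ) : U → ℝ := fun v => (x v + y v) / 2

/-- The median formula. If $xy$ is a longest side, of squared length $d$, the right side is at most
$(2d+2d-d)/4=\tfrac34 d$; this is the source of the factor $3/4$ below. -/
lemma sqd_mid (S : Finset U) (x y z : U → ℝ) :
    sqd S (mid x y) z = (2 * sqd S x z + 2 * sqd S y z - sqd S x y) / 4 := by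
  simp only [sqd, mid, mul_sum, ← sum_add_distrib, ← sum_sub_distrib, sum_div]
  exact sum_congr rfl fun v _ => by ring

/-- The barycenter of the points `q u`, for `u ∈ κ`. -/
noncomputable def avg (κ : Finset U) (q : U → U → ℝ) : U → ℝ :=
  fun v => (∑ u ∈ κ, q u v) / κ.card

lemma sqd_avg_le {S κ : Finset U} (hκ : κ.Nonempty) {q : U → U → ℝ} {x : U → ℝ} {c : ℝ}
    (h : ∀ u ∈ κ, sqd S x (q u) ≤ c) : sqd S x (avg κ q) ≤ c := by
  have hc : (0 : ℝ) < κ.card := by exact_mod_cast hκ.card_pos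
  have key : ∀ v, (x v - avg κ q v) ^ 2 ≤ (∑ u ∈ κ, (x v - q u v) ^ 2) / κ.card := by
    intro v
    have h1 : x v - avg κ q v = (∑ u ∈ κ, (x v - q u v)) / κ.card := by
      simp only [avg, sum_sub_distrib, sum_const, nsmul_eq_mul]
      field_simp
    rw [h1, div_pow, div_le_div_iff₀ (by positivity) hc]
    have := sq_sum_le_card_mul_sum_sq (s := κ) (f := fun u => x v - q u v)
    nlinarith
  calc sqd S x (avg κ q) ≤ ∑ v ∈ S, (∑ u ∈ κ, (x v - q u v) ^ 2) / κ.card :=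
        sum_le_sum fun v _ => key v
    _ = (∑ u ∈ κ, sqd S x (q u)) / κ.card := by
        rw [← sum_div, sum_comm]; rfl
    _ ≤ (∑ _u ∈ κ, c) / κ.card := by gcongr with u hu; exact h u hu
    _ = c := by rw [sum_const, nsmul_eq_mul]; field_simp

variable [DecidableEq U]

lemma mid_mem_cell {t : Finset U} {x y : U → ℝ} (hx : x ∈ cell t) (hy : y ∈ cell t) :
    mid x y ∈ cell t := by
  refine ⟨fun v => ?_, fun v hv => ?_, ?_⟩
  · have := hx.1 v; have := hy.1 v; simp only [mid]; linarith
  · simp [mid, hx.2.1 v hv, hy.2.1 v hv]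
  · simp only [mid, ← sum_div, sum_add_distrib, hx.2.2, hy.2.2]; norm_num

lemma avg_mem_cell {t κ : Finset U} (hκ : κ.Nonempty) {q : U → U → ℝ}
    (h : ∀ u ∈ κ, q u ∈ cell t) : avg κ q ∈ cell t := by
  have hc : (0 : ℝ) < κ.card := by exact_mod_cast hκ.card_pos
  refine ⟨fun v => ?_, fun v hv => ?_, ?_⟩
  · exact div_nonneg (sum_nonneg fun u hu => (h u hu).1 v) hc.le
  · rw [avg, sum_eq_zero fun u hu => (h u hu).2.1 v hv, zero_div]
  · simp only [avg, ← sum_div]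
    rw [sum_comm, sum_congr rfl fun u hu => (h u hu).2.2, sum_const, nsmul_eq_mul]
    field_simp

/-- The preimages of the open vertex stars cover a compact set. As the complex is finite, the
relevant points have finitely many coordinates, and `E` extends these by zero. -/
lemma exists_lebesgue_number {W : Type*} {X : PreAbstractSimplicialComplex W}
    {C : Finset (Finset U)} {S : Finset U} (hS : vset C ⊆ S) {F : (U → ℝ) → Realization X}
    (hF : ContinuousOn F (geo C)) :
    ∃ δ > 0, ∀ x ∈ geo C, ∃ w, ∀ y ∈ geo C, sqd S x y < δ → 0 < (F y).1 w := by
  choose O hO hOe using fun w => continuousOn_iff'.1 hF _ (isOpen_openStar (X := X) w)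
  let E : (S → ℝ) → U → ℝ := fun x v => if h : v ∈ S then x ⟨v, h⟩ else 0
  have hE : Continuous E := by
    refine continuous_pi fun v => ?_
    by_cases h : v ∈ S
    · simp only [E, h, dif_pos]; fun_prop
    · simp only [E, h, dif_neg, not_false_eq_true]; fun_prop
  have hEx : ∀ x ∈ geo C, E (fun v => x v) = x := by
    intro x hx
    obtain ⟨τ, hτ, hxτ⟩ := mem_geo.1 hx
    funext v
    by_cases h : v ∈ S
    · simp [E, h]
    · simp only [E, h, dif_neg, not_false_eq_true]
      exact (hxτ.2.1 v fun h' => h (hS (subset_vset hτ h'))).symm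
  have hcomp : IsCompact (Set.Icc 0 1 ∩ E ⁻¹' geo C) :=
    isCompact_Icc.inter_right ((isClosed_geo C).preimage hE)
  have hmem : ∀ x ∈ geo C, (fun v : S => x v) ∈ Set.Icc 0 1 ∩ E ⁻¹' geo C := by
    intro x hx
    refine ⟨⟨fun v => ?_, fun v => ?_⟩, ?_⟩
    · obtain ⟨τ, hτ, hxτ⟩ := mem_geo.1 hx
      exact hxτ.1 v
    · obtain ⟨τ, hτ, hxτ⟩ := mem_geo.1 hx
      by_cases h : v.1 ∈ τ
      · have := single_le_sum (f := x) (fun j _ => hxτ.1 j) h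
        rwa [hxτ.2.2] at this
      · simp [hxτ.2.1 v h]
    · rw [Set.mem_preimage, hEx x hx]; exact hx
  obtain ⟨δ, hδ, h⟩ := lebesgue_number_lemma_of_metric (c := fun w => E ⁻¹' O w) hcomp
    (fun w => (hO w).preimage hE) (by
      rintro x ⟨-, hx⟩
      have hne : (F (E x)).1.support.Nonempty := (X.isRelLowerSet_faces (F (E x)).2.1).1
      obtain ⟨w, hw⟩ := hne
      have : E x ∈ F ⁻¹' {p | 0 < p.1 w} ∩ geo C :=
        ⟨lt_of_le_of_ne ((F (E x)).2.2.1 w) (Ne.symm (Finsupp.mem_support_iff.1 hw)), hx⟩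
      rw [hOe] at this
      exact Set.mem_iUnion.2 ⟨w, this.1⟩)
  refine ⟨δ ^ 2, by positivity, fun x hx => ?_⟩
  obtain ⟨w, hw⟩ := h _ (hmem x hx)
  refine ⟨w, fun y hy hxy => ?_⟩
  have hy' : (fun v : S => y v) ∈ Metric.ball (fun v : S => x v) δ := by
    rw [Metric.mem_ball, dist_pi_lt_iff hδ]
    intro v
    rw [Real.dist_eq, ← abs_of_pos hδ, ← sq_lt_sq]
    have := single_le_sum (f := fun v => (x v - y v) ^ 2) (fun j _ => sq_nonneg _) v.2
    simp only [sqd] at hxy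
    nlinarith
  have := hw hy'
  rw [Set.mem_preimage, hEx y hy] at this
  have : y ∈ F ⁻¹' {p | 0 < p.1 w} ∩ geo C := by rw [hOe]; exact ⟨this, hy⟩
  exact this.1

end Mesh

/-! ### Fine stellar subdivisions of the cone. -/

section Placement

variable {U : Type*} [DecidableEq U]

/-- A placement of the vertices of a complex `K` containing `L` in the geometric cone on `L`, such
that every simplex of `K` is placed in a simplex of the cone, and the vertices of `L` are at their
natural places. -/
structure Placed (a : U) (L : Finset (Finset U)) (n : ℕ) (K : Finset (Finset U))
    (q : U → U → ℝ) : Prop where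
  rel : Rel L n K
  cellwise : ∀ s ∈ K, ∃ t ∈ cone a L, ∀ v ∈ s, q v ∈ cell t
  base : ∀ v ∈ vset L, q v = Pi.single v 1

lemma single_mem_cell {s : Finset U} {v : U} (h : v ∈ s) : (Pi.single v 1 : U → ℝ) ∈ cell s := by
  refine ⟨fun w => ?_, fun w hw => ?_, ?_⟩
  · by_cases h : w = v <;> simp [h]
  · have : w ≠ v := by rintro rfl; exact hw h
    simp [this]
  · simp [Pi.single_apply, h]

lemma placed_cone {a : U} {L : Finset (Finset U)} {n : ℕ} (hL : IsComplex L)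
    (hn : ∀ s ∈ L, s.card ≤ n) (ha : a ∉ vset L) :
    Placed a L n (cone a L) fun v => Pi.single v 1 :=
  ⟨rel_cone hL hn ha, fun s hs => ⟨s, hs, fun _ hv => single_mem_cell hv⟩, fun _ _ => rfl⟩

/-- Subdividing edges is enough for the approximation. The placement need not be injective: it only
serves to choose vertex images. -/
lemma Placed.step {a : U} {L K : Finset (Finset U)} {n : ℕ} {q : U → U → ℝ}
    (h : Placed a L n K q) {Z : Finset U} {u w b : U} (he : {u, w} ∈ K) (hP : ¬ {u, w} ⊆ vset L)
    (hbZ : b ∉ Z) (hb : b ∉ vset K) {p : U → ℝ}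
    (hp : ∀ t, q u ∈ cell t → q w ∈ cell t → p ∈ cell t) :
    Step (vset L) Z K (star K {u, w} b) ∧
      Placed a L n (star K {u, w} b) (Function.update q b p) := by
  have hst : Step (vset L) Z K (star K {u, w} b) := ⟨_, he, hP, b, hbZ, hb, rfl⟩
  refine ⟨hst, h.rel.step hst, fun s hs => ?_, fun v hv => ?_⟩
  · have hne : ∀ s ∈ K, ∀ v ∈ s, Function.update q b p v = q v := fun s hs v hv =>
      Function.update_of_ne (fun h : v = b => hb (h ▸ subset_vset hs hv)) _ _
    rcases mem_star.1 hs with ⟨hs, -⟩ | ⟨τ, hτ, -, h2, rfl⟩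
    · obtain ⟨t, ht, hq⟩ := h.cellwise s hs
      exact ⟨t, ht, fun v hv => by rw [hne s hs v hv]; exact hq v hv⟩
    · obtain ⟨t, ht, hq⟩ := h.cellwise _ h2
      refine ⟨t, ht, fun v hv => ?_⟩
      rcases mem_insert.1 hv with rfl | hv
      · rw [Function.update_self]
        exact hp t (hq u (by simp)) (hq w (by simp))
      · rw [hne τ hτ v hv]
        exact hq v (mem_union_left _ hv)
  · rw [Function.update_of_ne, h.base v hv]
    rintro rfl
    exact hb (h.rel.vset_subset hv)

lemma pair_mem_of_mem_star {K : Finset (Finset U)} {σ : Finset U} {b x y : U}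
    (h : {x, y} ∈ star K σ b) (hx : x ≠ b) (hy : y ≠ b) : {x, y} ∈ K ∧ ¬ σ ⊆ {x, y} := by
  rcases mem_star.1 h with h | ⟨τ, -, -, -, h⟩
  · exact h
  · have : b ∈ ({x, y} : Finset U) := h ▸ mem_insert_self b τ
    simp only [mem_insert, mem_singleton] at this
    grind

lemma pair_union_mem_of_mem_star {K : Finset (Finset U)} (hK : IsComplex K) {σ : Finset U}
    {b y : U} (hb : b ∉ vset K) (h : {b, y} ∈ star K σ b) (hy : y ≠ b) :
    insert y σ ∈ K := by
  rcases mem_star.1 h with h | ⟨τ, -, -, h2, h⟩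
  · exact absurd (subset_vset h.1 (by simp)) hb
  · refine hK.down_closed _ h2 _ (insert_subset (mem_union_left _ ?_) subset_union_right)
    have : y ∈ insert b τ := h ▸ by simp
    exact mem_of_mem_insert_of_ne this hy

lemma pair_subset_of_mem {K : Finset (Finset U)} (hK : IsComplex K) {s : Finset U} (hs : s ∈ K)
    {x y : U} (hx : x ∈ s) (hy : y ∈ s) : {x, y} ∈ K :=
  hK.down_closed s hs _ (by grind)

/-- Subdividing the edges from the apex to `L` separates the apex from `L`. -/
lemma exists_collar [Infinite U] {a : U} {L : Finset (Finset U)} {n : ℕ} {Z : Finset U}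
    (haL : a ∉ vset L) : ∀ (N : ℕ) (K : Finset (Finset U)) (q : U → U → ℝ),
      Placed a L n K q → (∀ u ∈ vset K, u ≠ a → q u a = 0) →
      ((vset L).filter fun w => {a, w} ∈ K).card = N →
      ∃ K' q', Stell (vset L) Z K K' ∧ Placed a L n K' q' ∧
        ∀ u w, {u, w} ∈ K' → w ∈ vset L → q' u a = 0 := by
  intro N
  induction N using Nat.strong_induction_on with
  | _ N ih =>
  rintro K q hq h0 rfl
  rcases ((vset L).filter fun w => {a, w} ∈ K).eq_empty_or_nonempty with hE | ⟨w, hw⟩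
  · refine ⟨K, q, .refl, hq, fun u w huw hw => h0 u (subset_vset huw (by simp)) ?_⟩
    rintro rfl
    exact notMem_empty w (hE ▸ mem_filter.2 ⟨hw, huw⟩)
  · obtain ⟨hwL, hwK⟩ := mem_filter.1 hw
    have hwa : w ≠ a := by rintro rfl; exact haL hwL
    obtain ⟨b, hb⟩ := Infinite.exists_notMem_finset (insert a (vset K ∪ Z))
    simp only [mem_insert, mem_union, not_or] at hb
    obtain ⟨hba, hbK, hbZ⟩ := hb
    have hwb : w ≠ b := by rintro rfl; exact hbK (hq.rel.vset_subset hwL)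
    -- The new vertex of the edge $aw$ is placed on top of $w$ itself. So all vertices other than
    -- the apex stay in the base, while the number of edges from the apex to $L$ drops.
    obtain ⟨hst, hpl⟩ := hq.step hwK (fun h => haL (h (by simp))) hbZ hbK (p := q w)
      fun t _ h => h
    suffices H : _ ∧ _ by
      obtain ⟨K', q', h1, h2, h3⟩ := ih _ (card_lt_card H.1) _ _ hpl H.2 rfl
      exact ⟨K', q', .head hst h1, h2, h3⟩
    constructor
    · refine ⟨fun x hx => ?_, fun h => ?_⟩
      · obtain ⟨hxL, hx⟩ := mem_filter.1 hx
        refine mem_filter.2 ⟨hxL, (pair_mem_of_mem_star hx (Ne.symm hba) ?_).1⟩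
        rintro rfl
        exact hbK (hq.rel.vset_subset hxL)
      · have := (mem_filter.1 (h hw)).2
        exact (pair_mem_of_mem_star this (Ne.symm hba) hwb).2 subset_rfl
    · intro u hu hua
      rcases mem_insert.1 (vset_star_subset hu) with rfl | hu
      · rw [Function.update_self]
        exact h0 w (subset_vset hwK (by simp)) hwa
      · rw [Function.update_of_ne (fun h : u = b => hbK (h ▸ hu))]
        exact h0 u hu hua

/-- The edges of `K` that miss `L` have squared length at most `c`. -/
def MeshLE (S : Finset U) (L K : Finset (Finset U)) (q : U → U → ℝ) (c : ℝ) : Prop :=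
  ∀ u w, {u, w} ∈ K → u ∉ vset L → w ∉ vset L → sqd S (q u) (q w) ≤ c

/-- Bisecting the longest edges that miss `L`, one after the other, reduces the mesh. -/
lemma exists_mesh_reduction [Infinite U] {a : U} {L : Finset (Finset U)} {n : ℕ} {Z S : Finset U}
    {c : ℝ} (hc : 0 ≤ c) : ∀ (N : ℕ) (K : Finset (Finset U)) (q : U → U → ℝ),
      Placed a L n K q → (∀ u w, {u, w} ∈ K → w ∈ vset L → q u a = 0) → MeshLE S L K q c →
      (((vset K ×ˢ vset K).filter fun e => {e.1, e.2} ∈ K ∧ e.1 ∉ vset L ∧ e.2 ∉ vset L ∧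
        3 / 4 * c < sqd S (q e.1) (q e.2)).card = N) →
      ∃ K' q', Stell (vset L) Z K K' ∧ Placed a L n K' q' ∧
        (∀ u w, {u, w} ∈ K' → w ∈ vset L → q' u a = 0) ∧ MeshLE S L K' q' (3 / 4 * c) := by
  classical
  intro N
  induction N using Nat.strong_induction_on with
  | _ N ih =>
  rintro K q hq h0 hm rfl
  have hKc := hq.rel.isComplex
  set B := (vset K ×ˢ vset K).filter fun e => {e.1, e.2} ∈ K ∧ e.1 ∉ vset L ∧ e.2 ∉ vset L ∧
        3 / 4 * c < sqd S (q e.1) (q e.2) with hB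
  have hBmem : ∀ u w, (u, w) ∈ B ↔ {u, w} ∈ K ∧ u ∉ vset L ∧ w ∉ vset L ∧
      3 / 4 * c < sqd S (q u) (q w) := by
    intro u w
    rw [hB, mem_filter, and_iff_right_iff_imp]
    exact fun h => mem_product.2 ⟨subset_vset h.1 (by simp), subset_vset h.1 (by simp)⟩
  rcases B.eq_empty_or_nonempty with hE | hne
  · refine ⟨K, q, .refl, hq, h0, fun u w h hu hw => ?_⟩
    by_contra hlt
    have := (hBmem u w).2 ⟨h, hu, hw, not_le.1 hlt⟩
    simp [hE] at this
  · obtain ⟨⟨u, w⟩, huw, hmax⟩ := exists_max_image B (fun e => sqd S (q e.1) (q e.2)) hne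
    obtain ⟨he, hu, hw, hlong⟩ := (hBmem u w).1 huw
    set d := sqd S (q u) (q w) with hd
    -- The edge $uw$ is longest among all edges missing $L$, since those not in `B` are shorter than
    -- any edge in `B`.
    have hle : ∀ x y, {x, y} ∈ K → x ∉ vset L → y ∉ vset L → sqd S (q x) (q y) ≤ d := by
      intro x y h hx hy
      by_cases hlt : 3 / 4 * c < sqd S (q x) (q y)
      · exact hmax (x, y) ((hBmem x y).2 ⟨h, hx, hy, hlt⟩)
      · exact (not_lt.1 hlt).trans hlong.le
    have hdc : d ≤ c := hm u w he hu hw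
    obtain ⟨b, hb⟩ := Infinite.exists_notMem_finset (vset K ∪ Z)
    simp only [mem_union, not_or] at hb
    obtain ⟨hbK, hbZ⟩ := hb
    have hbL : b ∉ vset L := fun h => hbK (hq.rel.vset_subset h)
    obtain ⟨hst, hpl⟩ := hq.step he (fun h => hu (h (by simp))) hbZ hbK (p := mid (q u) (q w))
      fun t => mid_mem_cell
    set K₁ := star K {u, w} b
    set q₁ := Function.update q b (mid (q u) (q w)) with hq₁
    have hq₁b : q₁ b = mid (q u) (q w) := Function.update_self ..
    have hq₁n : ∀ x, x ≠ b → q₁ x = q x := fun x hx => Function.update_of_ne hx _ _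
    have hnew : ∀ y, {b, y} ∈ K₁ → y ∉ vset L → sqd S (q₁ b) (q₁ y) ≤ 3 / 4 * d := by
      intro y hy hyL
      have hd0 : 0 ≤ d := sqd_nonneg _ _ _
      by_cases hyb : y = b
      · rw [hyb, sqd_self]; linarith
      -- A neighbour $y$ of the midpoint spans a triangle with $u$ and $w$, so the median formula
      -- applies. No new edge missing $L$ exceeds $\tfrac34 c$, and the number of longer ones
      -- decreases.
      · have hyK := pair_union_mem_of_mem_star hKc hbK hy hyb
        rw [hq₁b, hq₁n y hyb, sqd_mid]
        have h1 := hle u y (pair_subset_of_mem hKc hyK (by simp) (by simp)) hu hyL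
        have h2 := hle w y (pair_subset_of_mem hKc hyK (by simp) (by simp)) hw hyL
        linarith
    have hnew' : ∀ x y, {x, y} ∈ K₁ → x ∉ vset L → y ∉ vset L →
        sqd S (q₁ x) (q₁ y) ≤ 3 / 4 * c ∨
          ({x, y} ∈ K ∧ ¬ {u, w} ⊆ ({x, y} : Finset U) ∧ q₁ x = q x ∧ q₁ y = q y) := by
      intro x y hxy hx hy
      by_cases hxb : x = b
      · subst hxb
        exact .inl ((hnew y hxy hy).trans (by linarith))
      · by_cases hyb : y = b
        · subst hyb
          rw [pair_comm] at hxy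
          rw [sqd_comm]
          exact .inl ((hnew x hxy hx).trans (by linarith))
        · obtain ⟨h1, h2⟩ := pair_mem_of_mem_star hxy hxb hyb
          exact .inr ⟨h1, h2, hq₁n x hxb, hq₁n y hyb⟩
    suffices H : _ ∧ _ ∧ _ by
      obtain ⟨K', q', h1, h2, h3, h4⟩ := ih _ (card_lt_card H.1) K₁ q₁ hpl H.2.1 H.2.2 rfl
      exact ⟨K', q', .head hst h1, h2, h3, h4⟩
    refine ⟨?_, ?_, ?_⟩
    · refine ⟨fun e he' => ?_, fun h => ?_⟩
      · obtain ⟨x, y⟩ := e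
        obtain ⟨-, hxy, hx, hy, hl⟩ := mem_filter.1 he'
        rcases hnew' x y hxy hx hy with h | ⟨h1, -, h2, h3⟩
        · exact absurd hl (not_lt.2 h)
        · exact (hBmem x y).2 ⟨h1, hx, hy, by rwa [← h2, ← h3]⟩
      · obtain ⟨-, hxy, hx, hy, hl⟩ := mem_filter.1 (h huw)
        rcases hnew' u w hxy hx hy with h | ⟨-, h, -⟩
        · exact absurd hl (not_lt.2 h)
        · exact h subset_rfl
    · intro x y hxy hy
      have hyb : y ≠ b := by rintro rfl; exact hbL hy
      by_cases hxb : x = b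
      -- A vertex of $L$ adjacent to the midpoint is adjacent to both ends $u$ and $w$, which
      -- therefore lie in the base, and so does the midpoint.
      · subst hxb
        have hyK := pair_union_mem_of_mem_star hKc hbK hxy hyb
        have h1 := h0 u y (pair_subset_of_mem hKc hyK (by simp) (by simp)) hy
        have h2 := h0 w y (pair_subset_of_mem hKc hyK (by simp) (by simp)) hy
        simp [hq₁b, mid, h1, h2]
      · rw [hq₁n x hxb]
        exact h0 x y (pair_mem_of_mem_star hxy hxb hyb).1 hy
    · intro x y hxy hx hy
      rcases hnew' x y hxy hx hy with h | ⟨h1, -, h2, h3⟩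
      · exact h.trans (by linarith)
      · rw [h2, h3]; exact hm x y h1 hx hy

lemma exists_fine [Infinite U] {a : U} {L K : Finset (Finset U)} {n : ℕ} {Z S : Finset U}
    {q : U → U → ℝ} (hq : Placed a L n K q)
    (h0 : ∀ u w, {u, w} ∈ K → w ∈ vset L → q u a = 0) {ε : ℝ} (hε : 0 < ε) :
    ∃ K' q', Stell (vset L) Z K K' ∧ Placed a L n K' q' ∧
        (∀ u w, {u, w} ∈ K' → w ∈ vset L → q' u a = 0) ∧ MeshLE S L K' q' ε := by
  set c := ∑ e ∈ vset K ×ˢ vset K, sqd S (q e.1) (q e.2) with hc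
  have hc0 : 0 ≤ c := sum_nonneg fun e _ => sqd_nonneg _ _ _
  have hcm : MeshLE S L K q c := fun u w h _ _ =>
    single_le_sum (f := fun e : U × U => sqd S (q e.1) (q e.2)) (fun e _ => sqd_nonneg _ _ _)
      (mem_product.2 ⟨subset_vset h (by simp), subset_vset h (by simp)⟩ : (u, w) ∈ _)
  have key : ∀ j : ℕ, ∃ K' q', Stell (vset L) Z K K' ∧ Placed a L n K' q' ∧
      (∀ u w, {u, w} ∈ K' → w ∈ vset L → q' u a = 0) ∧ MeshLE S L K' q' ((3 / 4) ^ j * c) := by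
    intro j
    induction j with
    | zero => exact ⟨K, q, .refl, hq, h0, by simpa using hcm⟩
    | succ j ih =>
      obtain ⟨K₁, q₁, h1, h2, h3, h4⟩ := ih
      obtain ⟨K₂, q₂, h5, h6, h7, h8⟩ := exists_mesh_reduction (Z := Z) (by positivity) _ K₁ q₁
        h2 h3 h4 rfl
      exact ⟨K₂, q₂, h1.trans h5, h6, h7, by rwa [pow_succ', mul_assoc]⟩
  have hlim : Filter.Tendsto (fun j : ℕ => (3 / 4 : ℝ) ^ j * c) Filter.atTop (nhds 0) := by
    simpa using (tendsto_pow_atTop_nhds_zero_of_lt_one (by norm_num : (0 : ℝ) ≤ 3 / 4)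
      (by norm_num)).mul_const c
  obtain ⟨j, hj⟩ := (hlim.eventually (gt_mem_nhds hε)).exists
  obtain ⟨K', q', h1, h2, h3, h4⟩ := key j
  exact ⟨K', q', h1, h2, h3, fun u w h hu hw => (h4 u w h hu hw).trans hj.le⟩

end Placement

/-- The relative simplicial approximation: simplicial maps to a sufficiently connected complex
extend over stellar subdivisions of the cone. -/
theorem fill_of_isKConnected {U W : Type*} [DecidableEq U] [Infinite U] [DecidableEq W]
    {X : PreAbstractSimplicialComplex W} {k : ℕ}
    (hX : IsKConnected ((k : ℤ) - 1) (Realization X)) : Fill U (insert ∅ X.faces) k := by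
  intro L hL hk f hf Z hZ a ha
  have haL : a ∉ vset L := fun h => ha (hZ h)
  have hY := isTarget_insert_faces X
  obtain ⟨F, hF, hFL⟩ := exists_extension_cone hX hL hk hf a
  obtain ⟨δ, hδ, hleb⟩ := exists_lebesgue_number (S := insert a (vset L)) vset_cone hF
  obtain ⟨K₁, q₁, hst₁, hq₁, h0₁⟩ := exists_collar (Z := insert a Z) haL _ _ _
    (placed_cone hL hk haL) (fun u _ hu => by simp [hu.symm]) rfl
  obtain ⟨K, q, hst, hq, h0, hm⟩ := exists_fine (Z := insert a Z) (S := insert a (vset L)) hq₁ h0₁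
    (half_pos hδ)
  refine ⟨K, hst₁.trans hst, ?_⟩
  have hKc := hq.rel.isComplex
  have hgeo : ∀ u ∈ vset K, q u ∈ geo (cone a L) := fun u hu => by
    obtain ⟨t, ht, h⟩ := hq.cellwise _ (hKc.singleton_mem hu)
    exact mem_geo.2 ⟨t, ht, h u (by simp)⟩
  have : Nonempty W := ⟨(X.isRelLowerSet_faces (F 0).2.1).1.choose⟩
  -- `r x` is a vertex of $X$ whose open star contains the image under $F$ of the
  -- $\delta$-neighbourhood of $x$.
  choose! r hr using hleb
  refine ⟨fun u => if u ∈ vset L then f u else r (q u), fun v hv => by simp [hv], fun s hs => ?_⟩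
  obtain ⟨t, ht, hqt⟩ := hq.cellwise s hs
  rcases s.eq_empty_or_nonempty with rfl | hs0
  · exact .inl rfl
  by_cases hsL : ∃ w ∈ s, w ∈ vset L
  -- A simplex meeting $L$ is placed, thanks to the collar, in a simplex $t\setminus\{a\}$ of $L$.
  -- There $F$ is the affine extension of $f$, so all the chosen vertices belong to the simplex
  -- $f(t\setminus\{a\})$.
  · obtain ⟨w, hws, hwL⟩ := hsL
    have htL : t.erase a ∈ L := by
      rcases mem_cone.1 ht with h | ⟨ρ, hρ, rfl⟩
      · exact hL.down_closed t h _ (erase_subset _ _)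
      · exact hL.down_closed ρ hρ _ (by rw [erase_insert_eq_erase]; exact erase_subset _ _)
    refine hY.down_closed _ (hf _ htL) _ fun y hy => ?_
    obtain ⟨u, hu, rfl⟩ := mem_image.1 hy
    by_cases huL : u ∈ vset L
    · simp only [huL, if_true]
      refine mem_image_of_mem _ (mem_erase.2 ⟨by rintro rfl; exact haL huL, ?_⟩)
      by_contra hut
      have := (hqt u hu).2.1 u hut
      simp [hq.base u huL] at this
    · simp only [huL, if_false]
      have hua : q u a = 0 := h0 u w (pair_subset_of_mem hKc hs hu hws) hwL
      have hcell := mem_cell_erase (hqt u hu) hua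
      have hqg := hgeo u (subset_vset hs hu)
      have hpos := hr (q u) hqg (q u) hqg (by rw [sqd_self]; exact hδ)
      rw [hFL _ (mem_geo.2 ⟨_, htL, hcell⟩)] at hpos
      exact push_support hcell (Finsupp.mem_support_iff.2 hpos.ne')
  · push Not at hsL
    -- The barycenter of the placed vertices is within the Lebesgue number of each of them, so all
    -- chosen vertices lie in the support of its image, which is a simplex.
    have havg := mem_geo.2 ⟨t, ht, avg_mem_cell hs0 hqt⟩
    refine hY.down_closed _ (.inr (F (avg s q)).2.1) _ fun y hy => ?_
    obtain ⟨u, hu, rfl⟩ := mem_image.1 hy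
    simp only [hsL u hu, if_false]
    refine Finsupp.mem_support_iff.2 (hr (q u) (hgeo u (subset_vset hs hu)) _ havg ?_).ne'
    refine (sqd_avg_le hs0 fun x hx => hm u x (pair_subset_of_mem hKc hs hu hx) (hsL u hu)
      (hsL x hx)).trans_lt (half_lt_self hδ)

/-- Weakly Cohen–Macaulay complexes have good fillings. -/
theorem goodFill_of_isWeaklyCohenMacaulay {U W : Type*} [DecidableEq U] [Infinite U]
    [DecidableEq W] {X : PreAbstractSimplicialComplex W} {n : ℕ}
    (hX : IsWeaklyCohenMacaulay X n) : GoodFill U (insert ∅ X.faces) n := by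
  refine goodFill n (isTarget_insert_faces X) fun s hs k hk => ?_
  rcases s.eq_empty_or_nonempty with rfl | hs0
  · rw [show lkSet (insert ∅ X.faces) ∅ = insert ∅ X.faces by ext; simp [lkSet]]
    exact fill_of_isKConnected fun m hm => hX.1 m (by simp at hk; omega)
  · have hsX : s ∈ X.faces := hs.resolve_left hs0.ne_empty
    have hlk : lkSet (insert ∅ X.faces) s = insert ∅ (link X s).faces := by
      ext t
      simp only [lkSet, link, Set.mem_ofPred_eq, Set.mem_insert_iff, union_eq_empty,
        hs0.ne_empty, false_and, false_or]
      rcases t.eq_empty_or_nonempty with rfl | ht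
      · simpa using hsX
      · simp only [ht, ht.ne_empty, true_and, false_or]
        convert! Iff.rfl
    rw [hlk]
    have hp := hs0.card_pos
    -- With $p=|s|-1$, the hypothesis $k+|s|\le n$ reads $k-1\le n-p-2$.
    exact fill_of_isKConnected fun m hm => hX.2 (s.card - 1) s hsX (by omega) m (by
      push_cast [Nat.cast_sub hp]
      omega)

/-! ### Hyperplane arrangements and their derived subdivisions. -/

section Arrangement

variable {E : Type*} [AddCommGroup E] [Module ℝ E]

/-- Each functional in `H` that does not vanish at `x` has the same sign at `x` and at `p`: in the
arrangement of hyperplanes given by `H`, the point `x` lies in the closure of the cell of `p`. -/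
def Adh (H : Finset (E →ₗ[ℝ] ℝ)) (x p : E) : Prop :=
  ∀ h ∈ H, (0 ≤ h p → 0 ≤ h x) ∧ (h p ≤ 0 → h x ≤ 0)

variable {H : Finset (E →ₗ[ℝ] ℝ)}

lemma Adh.refl (x : E) : Adh H x x := fun _ _ => ⟨id, id⟩

lemma Adh.trans {x y z : E} (h₁ : Adh H x y) (h₂ : Adh H y z) : Adh H x z := fun h hh =>
  ⟨fun h0 => (h₁ h hh).1 ((h₂ h hh).1 h0), fun h0 => (h₁ h hh).2 ((h₂ h hh).2 h0)⟩

lemma Adh.smul {x p : E} (h₁ : Adh H x p) {c : ℝ} (hc : 0 ≤ c) : Adh H (c • x) p := by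
  intro h hh
  simp only [map_smul, smul_eq_mul]
  exact ⟨fun h0 => mul_nonneg hc ((h₁ h hh).1 h0),
    fun h0 => mul_nonpos_of_nonneg_of_nonpos hc ((h₁ h hh).2 h0)⟩

lemma adh_sum {p : E} {A : Finset E} {c : E → ℝ} (hc : ∀ q ∈ A, 0 ≤ c q)
    (hA : ∀ q ∈ A, Adh H q p) : Adh H (∑ q ∈ A, c q • q) p := by
  intro h hh
  simp only [map_sum]
  exact ⟨fun h0 => sum_nonneg fun q hq => ((hA q hq).smul (hc q hq) h hh).1 h0,
    fun h0 => sum_nonpos fun q hq => ((hA q hq).smul (hc q hq) h hh).2 h0⟩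

/-- All terms have the weak sign of the functional at $p$, so nothing cancels. Together with
`adh_sum`, a positive combination of a chain lies in the open cell of its top element. -/
lemma adh_sum_of_mem {p : E} {A : Finset E} {c : E → ℝ} (hc : ∀ q ∈ A, 0 < c q)
    (hA : ∀ q ∈ A, Adh H q p) (hp : p ∈ A) : Adh H p (∑ q ∈ A, c q • q) := by
  intro h hh
  simp only [map_sum, map_smul, smul_eq_mul]
  constructor
  · intro h0
    by_contra hlt
    rw [not_le] at hlt
    refine absurd h0 (not_le.2 (sum_neg' (fun q hq => ?_) ⟨p, hp, ?_⟩))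
    · exact mul_nonpos_of_nonneg_of_nonpos (hc q hq).le ((hA q hq h hh).2 hlt.le)
    · exact mul_neg_of_pos_of_neg (hc p hp) hlt
  · intro h0
    by_contra hlt
    rw [not_le] at hlt
    refine absurd h0 (not_le.2 (sum_pos' (fun q hq => ?_) ⟨p, hp, ?_⟩))
    · exact mul_nonneg (hc q hq).le ((hA q hq h hh).1 hlt.le)
    · exact mul_pos (hc p hp) hlt

lemma exists_top {A : Finset E} (hA : A.Nonempty)
    (hch : ∀ p ∈ A, ∀ q ∈ A, Adh H p q ∨ Adh H q p) : ∃ t ∈ A, ∀ p ∈ A, Adh H p t := by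
  classical
  induction hA using Finset.Nonempty.cons_induction with
  | singleton a => exact ⟨a, by simp, fun p hp => by rw [mem_singleton.1 hp]; exact .refl a⟩
  | cons a s has hs ih =>
    obtain ⟨t, ht, htm⟩ := ih fun p hp q hq => hch p (by simp [hp]) q (by simp [hq])
    rcases hch a (by simp) t (by simp [ht]) with h | h
    · exact ⟨t, by simp [ht], fun p hp => by
        rcases mem_cons.1 hp with rfl | hp
        exacts [h, htm p hp]⟩
    · exact ⟨a, by simp, fun p hp => by
        rcases mem_cons.1 hp with rfl | hp
        exacts [.refl p, (htm p hp).trans h]⟩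

/-- A union `C` of closed cells of the arrangement `H`, cut by the hyperplane `μ = 1`, with bounded
cells. -/
structure CellUnion (H : Finset (E →ₗ[ℝ] ℝ)) (μ : E →ₗ[ℝ] ℝ) (C : Set E) : Prop where
  eq_one : ∀ x ∈ C, μ x = 1
  closed : ∀ p ∈ C, ∀ x, Adh H x p → μ x = 1 → x ∈ C
  pos : ∀ p ∈ C, ∀ x, Adh H x p → x ≠ 0 → 0 < μ x

/-- `R` contains one point of each open cell of `C`. -/
structure Reps (H : Finset (E →ₗ[ℝ] ℝ)) (C R : Set E) : Prop where
  finite : R.Finite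
  subset : R ⊆ C
  eq_of_adh : ∀ p ∈ R, ∀ q ∈ R, Adh H p q → Adh H q p → p = q
  exists_rep : ∀ x ∈ C, ∃ p ∈ R, Adh H p x ∧ Adh H x p

lemma exists_reps (H : Finset (E →ₗ[ℝ] ℝ)) (C : Set E) : ∃ R, Reps H C R := by
  classical
  let sgn : E → H → SignType := fun x h => SignType.sign (h.1 x)
  have hsgn : ∀ x y, sgn x = sgn y ↔ Adh H x y ∧ Adh H y x := by
    intro x y
    constructor
    · intro h
      have key : ∀ x y, sgn x = sgn y → Adh H x y := by
        intro x y h f hf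
        have := congrFun h ⟨f, hf⟩
        simp only [sgn] at this
        constructor
        · intro h0
          rw [← sign_nonneg_iff, this, sign_nonneg_iff]
          exact h0
        · intro h0
          rw [← sign_nonpos_iff, this, sign_nonpos_iff]
          exact h0
      exact ⟨key x y h, key y x h.symm⟩
    · rintro ⟨h₁, h₂⟩
      funext ⟨f, hf⟩
      have h1 := h₁ f hf
      have h2 := h₂ f hf
      simp only [sgn]
      rcases lt_trichotomy (f x) 0 with h | h | h
      · have : f y < 0 := by by_contra h'; linarith [h1.1 (not_lt.1 h')]
        rw [sign_neg h, sign_neg this]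
      · have : f y = 0 := le_antisymm (h2.2 h.le) (h2.1 h.ge)
        rw [h, this]
      · have : 0 < f y := by by_contra h'; linarith [h1.2 (not_lt.1 h')]
        rw [sign_pos h, sign_pos this]
  have hch : ∀ s : sgn '' C, ∃ x ∈ C, sgn x = s := fun s => s.2
  choose r hrC hrs using hch
  refine ⟨Set.range r, Set.finite_range r, ?_, ?_, fun x hx => ⟨r ⟨sgn x, x, hx, rfl⟩, ⟨_, rfl⟩, ?_⟩⟩
  · rintro _ ⟨s, rfl⟩; exact hrC s
  · rintro _ ⟨s, rfl⟩ _ ⟨t, rfl⟩ h1 h2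
    congr 1
    refine Subtype.ext ?_
    rw [← hrs s, ← hrs t]
    exact (hsgn _ _).2 ⟨h1, h2⟩
  · exact (hsgn _ _).1 (hrs ⟨sgn x, x, hx, rfl⟩)

/-- A chain of representatives, ordered by adherence of the cells. -/
structure Chain (H : Finset (E →ₗ[ℝ] ℝ)) (R : Set E) (A : Finset E) : Prop where
  subset : ∀ p ∈ A, p ∈ R
  total : ∀ p ∈ A, ∀ q ∈ A, Adh H p q ∨ Adh H q p

lemma Chain.mono {R : Set E} {A B : Finset E} (hB : Chain H R B) (h : A ⊆ B) : Chain H R A :=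
  ⟨fun p hp => hB.subset p (h hp), fun p hp q hq => hB.total p (h hp) q (h hq)⟩

variable {μ : E →ₗ[ℝ] ℝ} {C R : Set E}

lemma CellUnion.map_sum (hC : CellUnion H μ C) (hR : Reps H C R) {A : Finset E}
    (hA : Chain H R A) (c : E → ℝ) : μ (∑ p ∈ A, c p • p) = ∑ p ∈ A, c p := by
  rw [_root_.map_sum]
  refine sum_congr rfl fun p hp => ?_
  rw [map_smul, hC.eq_one p (hR.subset (hA.subset p hp)), smul_eq_mul, mul_one]

/-- The common sum lies in the open cell of the top of either chain, so the tops coincide.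
Subtracting the smaller of their two coefficients shortens a chain, and induction applies. If the
coefficients differ, the shortened chain would equal one that still contains the top, which is
impossible. -/
lemma chain_unique [DecidableEq E] (hC : CellUnion H μ C) (hR : Reps H C R) :
    ∀ (N : ℕ) (A B : Finset E) (c d : E → ℝ), A.card + B.card = N → Chain H R A → Chain H R B →
      (∀ p ∈ A, 0 < c p) → (∀ p ∈ B, 0 < d p) → ∑ p ∈ A, c p • p = ∑ p ∈ B, d p • p → A = B := by
  intro N
  induction N using Nat.strong_induction_on with
  | _ N ih =>
  rintro A B c d rfl hA hB hc hd he
  have hμ : ∑ p ∈ A, c p = ∑ p ∈ B, d p := by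
    rw [← hC.map_sum hR hA, ← hC.map_sum hR hB, he]
  rcases A.eq_empty_or_nonempty with rfl | hA0
  · by_contra hne
    have := sum_pos hd (nonempty_iff_ne_empty.2 (Ne.symm hne))
    rw [← hμ] at this
    simp at this
  rcases B.eq_empty_or_nonempty with rfl | hB0
  · have := sum_pos hc hA0
    rw [hμ] at this
    simp at this
  obtain ⟨t, htA, ht⟩ := exists_top hA0 hA.total
  obtain ⟨u, huB, hu⟩ := exists_top hB0 hB.total
  have htu : t = u := by
    refine hR.eq_of_adh t (hA.subset t htA) u (hB.subset u huB) ?_ ?_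
    · exact (adh_sum_of_mem hc ht htA).trans (he ▸ adh_sum (fun p hp => (hd p hp).le) hu)
    · exact (adh_sum_of_mem hd hu huB).trans (he ▸ adh_sum (fun p hp => (hc p hp).le) ht)
  subst htu
  have hAc := card_erase_lt_of_mem htA
  have hBc := card_erase_lt_of_mem huB
  have hupd : ∀ (B : Finset E) (d : E → ℝ) (e : ℝ), t ∈ B →
      ∑ p ∈ B, Function.update d t e p • p = e • t + ∑ p ∈ B.erase t, d p • p := by
    intro B d e htB
    rw [← add_sum_erase _ _ htB, Function.update_self]
    congr 1
    refine sum_congr rfl fun p hp => ?_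
    rw [Function.update_of_ne (ne_of_mem_erase hp)]
  have hposu : ∀ (B : Finset E) (d : E → ℝ) (e : ℝ), 0 < e → (∀ p ∈ B, 0 < d p) →
      ∀ p ∈ B, 0 < Function.update d t e p := by
    intro B d e he hd p hp
    by_cases h : p = t
    · rw [h, Function.update_self]; exact he
    · rw [Function.update_of_ne h]; exact hd p hp
  rw [← add_sum_erase _ _ htA, ← add_sum_erase _ _ huB] at he
  rcases lt_trichotomy (c t) (d t) with h | h | h
  · have := ih _ (by omega) (A.erase t) B c (Function.update d t (d t - c t)) rfl
      (hA.mono (erase_subset _ _)) hB (fun p hp => hc p (mem_of_mem_erase hp))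
      (hposu B d _ (sub_pos.2 h) hd) (by
        rw [hupd B d _ huB, sub_smul, ← sub_eq_zero]
        rw [← sub_eq_zero] at he
        rw [← he]; abel)
    exact absurd (this ▸ huB) (notMem_erase t A)
  · have := ih _ (by omega) (A.erase t) (B.erase t) c d rfl
      (hA.mono (erase_subset _ _)) (hB.mono (erase_subset _ _))
      (fun p hp => hc p (mem_of_mem_erase hp)) (fun p hp => hd p (mem_of_mem_erase hp)) (by
        rw [h] at he
        exact add_left_cancel he)
    rw [← insert_erase htA, this, insert_erase huB]
  · have := ih _ (by omega) A (B.erase t) (Function.update c t (c t - d t)) d rfl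
      hA (hB.mono (erase_subset _ _)) (hposu A c _ (sub_pos.2 h) hc)
      (fun p hp => hd p (mem_of_mem_erase hp)) (by
        rw [hupd A c _ htA, sub_smul, ← sub_eq_zero]
        rw [← sub_eq_zero] at he
        rw [← he]; abel)
    exact absurd (this ▸ htA) (notMem_erase t B)

/-- Move from $x$ away from the representative $p$ of its cell until a functional first vanishes.
The point $y=x-rp$ reached lies in a smaller cell of the closure, and induction on the number of
non-vanishing functionals gives a chain for $y$, to which $p$ is added on top. -/
lemma exists_chain [DecidableEq E] (hC : CellUnion H μ C) (hR : Reps H C R) :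
    ∀ (N : ℕ) (x : E), (H.filter fun h => h x ≠ 0).card = N → x ≠ 0 → (∃ p ∈ C, Adh H x p) →
      ∃ (A : Finset E) (c : E → ℝ), Chain H R A ∧ (∀ p ∈ A, 0 < c p) ∧ (∀ p ∈ A, Adh H p x) ∧
        ∑ p ∈ A, c p • p = x := by
  intro N
  induction N using Nat.strong_induction_on with
  | _ N ih =>
  rintro x rfl hx ⟨z, hzC, hxz⟩
  have hμ := hC.pos z hzC x hxz hx
  have hxC : (μ x)⁻¹ • x ∈ C := hC.closed z hzC _ (hxz.smul (inv_nonneg.2 hμ.le)) (by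
    rw [map_smul, smul_eq_mul, inv_mul_cancel₀ hμ.ne'])
  obtain ⟨p, hp, hpx, hxp⟩ := hR.exists_rep _ hxC
  replace hpx : Adh H p x := hpx.trans ((Adh.refl x).smul (inv_nonneg.2 hμ.le))
  replace hxp : Adh H x p := by
    have := hxp.smul hμ.le
    rwa [smul_smul, mul_inv_cancel₀ hμ.ne', one_smul] at this
  -- If all functionals vanished at $x$, then $-x$ would lie in the closed cell too, against the
  -- positivity of `μ`.
  have hJ : (H.filter fun h => h x ≠ 0).Nonempty := by
    rw [nonempty_iff_ne_empty]
    intro h0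
    have hz : ∀ h ∈ H, h x = 0 := fun h hh => by
      by_contra h'
      exact notMem_empty h (h0 ▸ mem_filter.2 ⟨hh, h'⟩)
    have := hC.pos z hzC (-x) (fun h hh => by simp [hz h hh]) (neg_ne_zero.2 hx)
    rw [map_neg] at this
    linarith
  -- The least ratio is the first time at which a functional vanishes along $x-rp$.
  obtain ⟨h₀, hh₀, hmin⟩ := exists_min_image _ (fun h => h x / h p) hJ
  obtain ⟨hh₀H, hh₀x⟩ := mem_filter.1 hh₀
  have hsign : ∀ h ∈ H, (0 < h x → 0 < h p) ∧ (h x < 0 → h p < 0) ∧ (h x = 0 → h p = 0) := by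
    intro h hh
    have h1 := hpx h hh
    have h2 := hxp h hh
    refine ⟨fun h0 => ?_, fun h0 => ?_, fun h0 => le_antisymm (h1.2 h0.le) (h1.1 h0.ge)⟩
    · by_contra h'; linarith [h2.2 (not_lt.1 h')]
    · by_contra h'; linarith [h2.1 (not_lt.1 h')]
  have hh₀p : h₀ p ≠ 0 := by
    rcases lt_or_gt_of_ne hh₀x with h | h
    · exact ((hsign h₀ hh₀H).2.1 h).ne
    · exact ((hsign h₀ hh₀H).1 h).ne'
  set r := h₀ x / h₀ p with hr
  have hr0 : 0 < r := by
    rcases lt_or_gt_of_ne hh₀x with h | h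
    · exact div_pos_of_neg_of_neg h ((hsign h₀ hh₀H).2.1 h)
    · exact div_pos h ((hsign h₀ hh₀H).1 h)
  set y := x - r • p with hy
  have hhy : ∀ h : E →ₗ[ℝ] ℝ, h y = h x - r * h p := fun h => by simp [hy]
  have hyx : Adh H y x := by
    intro h hh
    rw [hhy]
    rcases lt_trichotomy (h x) 0 with h0 | h0 | h0
    · have h1 := (hsign h hh).2.1 h0
      have h2 : r ≤ h x / h p := hmin h (mem_filter.2 ⟨hh, h0.ne⟩)
      rw [le_div_iff_of_neg h1] at h2
      exact ⟨fun h' => by linarith, fun _ => by linarith⟩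
    · rw [h0, (hsign h hh).2.2 h0]; simp
    · have h1 := (hsign h hh).1 h0
      have h2 : r ≤ h x / h p := hmin h (mem_filter.2 ⟨hh, h0.ne'⟩)
      rw [le_div_iff₀ h1] at h2
      exact ⟨fun _ => by linarith, fun h' => by linarith⟩
  have hxy : x = r • p + y := by rw [hy]; abel
  have hy₀ : h₀ y = 0 := by rw [hhy, hr, div_mul_cancel₀ _ hh₀p, sub_self]
  by_cases hy0 : y = 0
  · refine ⟨{p}, fun _ => r, ⟨by simpa using hp, fun q hq q' hq' => ?_⟩, fun _ _ => hr0,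
      by simpa using hpx, by simp [hxy, hy0]⟩
    rw [mem_singleton.1 hq, mem_singleton.1 hq']
    exact .inl (.refl p)
  · obtain ⟨A, c, hA, hc, hAy, hsum⟩ := ih _ (card_lt_card (by
      refine ⟨fun h hh => ?_, fun h' => ?_⟩
      · obtain ⟨hh, hhy'⟩ := mem_filter.1 hh
        refine mem_filter.2 ⟨hh, fun h0 => hhy' ?_⟩
        rw [hhy, h0, (hsign h hh).2.2 h0]; simp
      · exact (mem_filter.1 (h' hh₀)).2 hy₀)) y rfl hy0 ⟨z, hzC, hyx.trans hxz⟩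
    have hpA : p ∉ A := fun hpA => by
      have := hAy p hpA h₀ hh₀H
      exact hh₀p (le_antisymm (this.2 hy₀.le) (this.1 hy₀.ge))
    have hne : ∀ q ∈ A, q ≠ p := by rintro q hq rfl; exact hpA hq
    have hAp : ∀ q ∈ A, Adh H q p := fun q hq => ((hAy q hq).trans hyx).trans hxp
    refine ⟨insert p A, Function.update c p r, ⟨fun q hq => ?_, fun q hq q' hq' => ?_⟩,
      fun q hq => ?_, fun q hq => ?_, ?_⟩
    · rcases mem_insert.1 hq with rfl | hq
      exacts [hp, hA.subset q hq]
    · rcases mem_insert.1 hq with hq | hq <;> rcases mem_insert.1 hq' with hq' | hq'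
      · rw [hq, hq']; exact .inl (.refl _)
      · rw [hq]; exact .inr (hAp _ hq')
      · rw [hq']; exact .inl (hAp _ hq)
      · exact hA.total _ hq _ hq'
    · rcases mem_insert.1 hq with rfl | hq
      · rwa [Function.update_self]
      · rw [Function.update_of_ne (hne q hq)]; exact hc q hq
    · rcases mem_insert.1 hq with rfl | hq
      exacts [hpx, (hAy q hq).trans hyx]
    · rw [sum_insert hpA, Function.update_self, hxy]
      congr 1
      rw [← hsum]
      exact sum_congr rfl fun q hq => by rw [Function.update_of_ne (hne q hq)]

/-- The derived subdivision of a union of cells of an arrangement. -/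
theorem exists_derived_subdivision (hC : CellUnion H μ C) :
    ∃ S : Geometry.SimplicialComplex ℝ E, S.faces.Finite ∧ S.space = C ∧
      ∀ s ∈ S.faces, ∃ t ∈ C, ∀ x ∈ convexHull ℝ (s : Set E), Adh H x t := by
  classical
  obtain ⟨R, hR⟩ := exists_reps H C
  have hconv : ∀ {A : Finset E} {x : E}, x ∈ convexHull ℝ (A : Set E) →
      ∃ (B : Finset E) (c : E → ℝ), B ⊆ A ∧ (∀ p ∈ B, 0 < c p) ∧ ∑ p ∈ B, c p = 1 ∧
        ∑ p ∈ B, c p • p = x := by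
    intro A x hx
    obtain ⟨w, hw0, hw1, hw⟩ := mem_convexHull'.1 hx
    have hz : ∀ p ∈ A, p ∉ A.filter (fun p => 0 < w p) → w p = 0 := fun p hp hp' =>
      le_antisymm (not_lt.1 fun h => hp' (mem_filter.2 ⟨hp, h⟩)) (hw0 p hp)
    refine ⟨A.filter fun p => 0 < w p, w, filter_subset _ _, fun p hp => (mem_filter.1 hp).2, ?_, ?_⟩
    · rw [← hw1]
      exact sum_subset (filter_subset _ _) fun p hp hp' => hz p hp hp'
    · rw [← hw]
      exact sum_subset (filter_subset _ _) fun p hp hp' => by rw [hz p hp hp', zero_smul]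
  have hind : ∀ {A : Finset E}, Chain H R A → AffineIndependent ℝ ((↑) : A → E) := by
    intro A hA
    refine (affineIndependent_iff).2 fun s w _ hw => ?_
    let w' : E → ℝ := fun p => if h : p ∈ A then w ⟨p, h⟩ else 0
    have hw' : ∑ p ∈ s.map (Function.Embedding.subtype _), w' p • p = 0 := by
      rw [sum_map, ← hw]
      refine sum_congr rfl fun e _ => ?_
      simp [w']
    set s' := s.map (Function.Embedding.subtype _) with hs'
    have hs'A : s' ⊆ A := fun p hp => by
      obtain ⟨e, -, rfl⟩ := mem_map.1 hp
      exact e.2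
    -- A linear relation, split by sign, is an equality of two positive combinations of chains;
    -- uniqueness makes the two disjoint supports equal, hence empty.
    have hsplit : ∑ p ∈ s' with 0 < w' p, w' p • p = ∑ p ∈ s' with w' p < 0, (-w' p) • p := by
      have h1 := sum_filter_add_sum_filter_not s' (fun p => 0 < w' p) fun p => w' p • p
      have h2 : ∑ p ∈ s' with ¬ 0 < w' p, w' p • p = ∑ p ∈ s' with w' p < 0, w' p • p := by
        refine (sum_subset (fun p hp => ?_) fun p hp hp' => ?_).symm
        · rw [mem_filter] at hp ⊢
          exact ⟨hp.1, hp.2.le.not_gt⟩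
        · rw [mem_filter] at hp hp'
          have : w' p = 0 := by
            rcases lt_trichotomy (w' p) 0 with h | h | h
            exacts [absurd ⟨hp.1, h⟩ hp', h, absurd h hp.2]
          rw [this, zero_smul]
      rw [h2, hw'] at h1
      simp only [neg_smul, sum_neg_distrib]
      exact eq_neg_of_add_eq_zero_left h1
    have heq := chain_unique hC hR _ _ _ w' (fun p => -w' p) rfl
      (hA.mono ((filter_subset _ _).trans hs'A)) (hA.mono ((filter_subset _ _).trans hs'A))
      (fun p hp => (mem_filter.1 hp).2) (fun p hp => neg_pos.2 (mem_filter.1 hp).2) hsplit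
    intro e he
    have hes : e.1 ∈ s' := mem_map.2 ⟨e, he, rfl⟩
    have hew : w' e.1 = w e := by simp [w']
    rw [← hew]
    rcases lt_trichotomy (w' e.1) 0 with h | h | h
    · have h1 : e.1 ∈ s'.filter fun p => w' p < 0 := mem_filter.2 ⟨hes, h⟩
      rw [← heq] at h1
      exact absurd (mem_filter.1 h1).2 h.not_gt
    · exact h
    · have h1 : e.1 ∈ s'.filter fun p => 0 < w' p := mem_filter.2 ⟨hes, h⟩
      rw [heq] at h1
      exact absurd (mem_filter.1 h1).2 h.not_gt
  have hadh : ∀ {A : Finset E}, A.Nonempty → Chain H R A → ∃ t ∈ C,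
      ∀ x ∈ convexHull ℝ (A : Set E), Adh H x t := by
    intro A hA0 hA
    obtain ⟨t, htA, ht⟩ := exists_top hA0 hA.total
    refine ⟨t, hR.subset (hA.subset t htA), fun x hx => ?_⟩
    obtain ⟨B, c, hBA, hc, -, rfl⟩ := hconv hx
    exact adh_sum (fun p hp => (hc p hp).le) fun p hp => ht p (hBA hp)
  refine ⟨⟨⟨{A | A.Nonempty ∧ Chain H R A}, ?_⟩, fun h => hind h.2, ?_⟩, ?_, ?_, ?_⟩
  · exact fun A hA => ⟨hA.1, fun B hBA hB => ⟨hB, hA.2.mono hBA⟩⟩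
  · rintro A B ⟨-, hA⟩ ⟨-, hB⟩ x ⟨hxA, hxB⟩
    obtain ⟨A', c, hAA, hc, hc1, hcx⟩ := hconv hxA
    obtain ⟨B', d, hBB, hd, -, hdx⟩ := hconv hxB
    have := chain_unique hC hR _ A' B' c d rfl (hA.mono hAA) (hB.mono hBB) hc hd (hcx.trans hdx.symm)
    subst this
    rw [← coe_inter]
    refine convexHull_mono (coe_subset.2 (subset_inter hAA hBB)) ?_
    exact mem_convexHull'.2 ⟨c, fun p hp => (hc p hp).le, hc1, hcx⟩
  · refine (hR.finite.toFinset.powerset.finite_toSet).subset ?_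
    rintro A ⟨-, hA⟩
    exact mem_powerset.2 fun p hp => hR.finite.mem_toFinset.2 (hA.subset p hp)
  · ext x
    rw [Geometry.SimplicialComplex.mem_space_iff]
    constructor
    · rintro ⟨A, ⟨hA0, hA⟩, hx⟩
      obtain ⟨t, ht, h⟩ := hadh hA0 hA
      refine hC.closed t ht x (h x hx) ?_
      obtain ⟨B, c, hBA, -, hc1, rfl⟩ := hconv hx
      rw [hC.map_sum hR (hA.mono hBA), hc1]
    · intro hx
      have hx1 := hC.eq_one x hx
      have hx0 : x ≠ 0 := by rintro rfl; simp at hx1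
      obtain ⟨A, c, hA, hc, -, hsum⟩ := exists_chain hC hR _ x rfl hx0 ⟨x, hx, .refl x⟩
      have hA0 : A.Nonempty := by
        rw [nonempty_iff_ne_empty]
        rintro rfl
        exact hx0 (by simpa using hsum.symm)
      refine ⟨A, ⟨hA0, hA⟩, mem_convexHull'.2 ⟨c, fun p hp => (hc p hp).le, ?_, hsum⟩⟩
      rw [← hC.map_sum hR hA, hsum, hx1]
  · rintro A ⟨hA0, hA⟩
    exact hadh hA0 hA

end Arrangement

/-! ### The sum of barycentric coordinates. -/

section Mass

variable {V : Type*}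

/-- The sum of the coordinates. -/
noncomputable def mass : (V →₀ ℝ) →ₗ[ℝ] ℝ := Finsupp.linearCombination ℝ fun _ => 1

lemma mass_eq_sum (x : V →₀ ℝ) : mass x = x.sum fun _ a => a := by
  simp [mass, Finsupp.linearCombination_apply]

lemma mass_single (v : V) (c : ℝ) : mass (Finsupp.single v c) = c := by
  simp [mass]

lemma isRealizationPoint_iff {K : PreAbstractSimplicialComplex V} {x : V →₀ ℝ} :
    IsRealizationPoint K x ↔ x.support ∈ K.faces ∧ (∀ v, 0 ≤ x v) ∧ mass x = 1 := by
  rw [mass_eq_sum, IsRealizationPoint]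

lemma mass_pos {x : V →₀ ℝ} (hx : ∀ v, 0 ≤ x v) (h0 : x ≠ 0) : 0 < mass x := by
  rw [mass_eq_sum]
  refine sum_pos (fun v hv => lt_of_le_of_ne (hx v) (Ne.symm (Finsupp.mem_support_iff.1 hv))) ?_
  exact Finsupp.support_nonempty_iff.2 h0

lemma Realization.mass_eq {K : PreAbstractSimplicialComplex V} (p : Realization K) :
    mass p.1 = 1 := (isRealizationPoint_iff.1 p.2).2.2

end Mass

/-! ### Piecewise linear maps as maps linear on the cells of an arrangement. -/

section PL

variable {V : Type*} {K : PreAbstractSimplicialComplex V} {n : ℕ}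

/-- `F` is linear on each closed cell of the arrangement of hyperplanes `H`. -/
def AdhLinear (H : Finset ((V →₀ ℝ) →ₗ[ℝ] ℝ)) (F : Realization K → Fin n → ℝ) : Prop :=
  ∀ p : Realization K, ∃ A : (V →₀ ℝ) →ₗ[ℝ] (Fin n → ℝ),
    ∀ x : Realization K, Adh H x.1 p.1 → F x = A x.1

lemma Adh.mono {E : Type*} [AddCommGroup E] [Module ℝ E] {H H' : Finset (E →ₗ[ℝ] ℝ)}
    (h : H ⊆ H') {x p : E} (hx : Adh H' x p) : Adh H x p := fun f hf => hx f (h hf)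

/-- The coordinate functionals. -/
noncomputable def coords (V : Type*) [Finite V] : Finset ((V →₀ ℝ) →ₗ[ℝ] ℝ) := by
  classical
  exact (Set.finite_range fun v : V => (Finsupp.lapply v : (V →₀ ℝ) →ₗ[ℝ] ℝ)).toFinset

lemma lapply_mem_coords [Finite V] (v : V) : Finsupp.lapply v ∈ coords V := by
  simp [coords]

lemma Adh.coord [Finite V] {H : Finset ((V →₀ ℝ) →ₗ[ℝ] ℝ)} (hH : coords V ⊆ H) {x p : V →₀ ℝ}
    (hp : ∀ v, 0 ≤ p v) (hx : Adh H x p) : (∀ v, 0 ≤ x v) ∧ x.support ⊆ p.support := by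
  have h0 : ∀ v, 0 ≤ x v := fun v => (hx _ (hH (lapply_mem_coords v))).1 (hp v)
  refine ⟨h0, fun v hv => ?_⟩
  rw [Finsupp.mem_support_iff] at hv ⊢
  exact fun hpv => hv (le_antisymm ((hx _ (hH (lapply_mem_coords v))).2 hpv.le) (h0 v))

/-- With the coordinates among the functionals, adherence preserves non-negativity and can only
shrink the support. -/
lemma cellUnion_realization [Finite V] {H : Finset ((V →₀ ℝ) →ₗ[ℝ] ℝ)} (hH : coords V ⊆ H) :
    CellUnion H mass {p | IsRealizationPoint K p} := by
  refine ⟨fun x hx => (isRealizationPoint_iff.1 hx).2.2, fun p hp x hx h1 => ?_,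
    fun p hp x hx h0 => mass_pos (hx.coord hH hp.2.1).1 h0⟩
  obtain ⟨h2, h3⟩ := hx.coord hH hp.2.1
  refine isRealizationPoint_iff.2 ⟨(K.isRelLowerSet_faces hp.1).2 h3 ?_, h2, h1⟩
  rw [nonempty_iff_ne_empty, ne_eq, Finsupp.support_eq_empty]
  rintro rfl
  simp at h1

lemma AdhLinear.isPiecewiseLinear [Finite V] {H : Finset ((V →₀ ℝ) →ₗ[ℝ] ℝ)}
    {F : Realization K → Fin n → ℝ} (hF : AdhLinear H F) : IsPiecewiseLinear K F := by
  classical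
  obtain ⟨S, hfin, hspace, hS⟩ := exists_derived_subdivision
    (cellUnion_realization (K := K) (H := coords V ∪ H) subset_union_left)
  refine ⟨S, hfin, hspace, fun s hs => ?_, fun s hs => ?_⟩
  · obtain ⟨t, ht, h⟩ := hS s hs
    exact ⟨_, ht.1, fun x hx => ((h x hx).coord subset_union_left ht.2.1).2⟩
  · obtain ⟨t, ht, h⟩ := hS s hs
    obtain ⟨A, hA⟩ := hF ⟨t, ht⟩
    exact ⟨A.toAffineMap, fun p hp => hA p ((h _ hp).mono subset_union_right)⟩

lemma continuous_coord (v : V) : Continuous fun p : Realization K => p.1 v := by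
  refine continuous_def.2 fun U hU => isOpen_iSup_iff.2 fun s => ?_
  rw [isOpen_coinduced]
  exact isOpen_induced_iff.2 ⟨{x | x v ∈ U}, hU.preimage (continuous_apply v), rfl⟩

lemma continuous_linear {W : Type*} [TopologicalSpace W] [AddCommGroup W] [Module ℝ W]
    [ContinuousAdd W] [ContinuousSMul ℝ W] [Finite V] (A : (V →₀ ℝ) →ₗ[ℝ] W) :
    Continuous fun p : Realization K => A p.1 := by
  have := Fintype.ofFinite V
  have h : ∀ x : V →₀ ℝ, A x = ∑ v, x v • A (Finsupp.single v 1) := by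
    intro x
    conv_lhs => rw [← Finsupp.univ_sum_single x]
    rw [map_sum]
    refine sum_congr rfl fun v _ => ?_
    rw [← map_smul, Finsupp.smul_single_one]
  rw [show (fun p : Realization K => A p.1) = fun p => ∑ v, p.1 v • A (Finsupp.single v 1) from
    funext fun p => h p.1]
  exact continuous_finsetSum _ fun v _ => (continuous_coord v).smul continuous_const

lemma AdhLinear.continuous [Finite V] {H : Finset ((V →₀ ℝ) →ₗ[ℝ] ℝ)}
    {F : Realization K → Fin n → ℝ} (hF : AdhLinear H F) : Continuous F := by
  obtain ⟨R, hR⟩ := exists_reps H {p | IsRealizationPoint K p}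
  have := hR.finite.to_subtype
  have hcl : ∀ q : V →₀ ℝ, IsClosed {x : Realization K | Adh H x.1 q} := by
    intro q
    simp only [Adh, Set.ofPred_forall]
    refine isClosed_biInter fun h _ => IsClosed.inter ?_ ?_
    · by_cases h0 : 0 ≤ h q
      · simp only [h0, forall_const]
        exact isClosed_le continuous_const (continuous_linear h)
      · simp only [h0, false_imp_iff]
        exact isClosed_univ
    · by_cases h0 : h q ≤ 0
      · simp only [h0, forall_const]
        exact isClosed_le (continuous_linear h) continuous_const
      · simp only [h0, false_imp_iff]
        exact isClosed_univ
  refine (locallyFinite_of_finite fun q : R => {x : Realization K | Adh H x.1 q}).continuous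
    (Set.eq_univ_of_forall fun x => ?_) (fun q => hcl q) fun q => ?_
  · obtain ⟨q, hq, -, hxq⟩ := hR.exists_rep x.1 x.2
    exact Set.mem_iUnion.2 ⟨⟨q, hq⟩, hxq⟩
  · obtain ⟨A, hA⟩ := hF ⟨q, hR.subset q.2⟩
    exact (continuous_linear A).continuousOn.congr fun x hx => hA x hx

/-- A finite union of images of compact simplices. It will turn a continuous bijection onto the cube
into a homeomorphism. -/
lemma compactSpace_realization [Finite V] (K : PreAbstractSimplicialComplex V) :
    CompactSpace (Realization K) := by
  classical
  have := Fintype.ofFinite V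
  have hcell : ∀ s : Finset V, IsCompact (cell s) := by
    intro s
    refine (isCompact_Icc (a := (0 : V → ℝ)) (b := 1)).of_isClosed_subset (isClosed_cell s) ?_
    intro x hx
    refine ⟨fun v => hx.1 v, fun v => ?_⟩
    by_cases h : v ∈ s
    · have := single_le_sum (f := x) (fun j _ => hx.1 j) h
      rwa [hx.2.2] at this
    · simp [hx.2.1 v h]
  have himg : ∀ s : K.faces, ∃ S : Set (Realization K), IsCompact S ∧
      {p : Realization K | p.1.support ⊆ s.1} ⊆ S := by
    intro s
    have hpt : ∀ x ∈ cell s.1, IsRealizationPoint K (Finsupp.equivFunOnFinite.symm x) := by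
      intro x hx
      have hsum : mass (Finsupp.equivFunOnFinite.symm x) = 1 := by
        rw [mass_eq_sum, Finsupp.sum_fintype _ _ fun _ => rfl, ← hx.2.2]
        exact (sum_subset (subset_univ _) fun v _ hv => hx.2.1 v hv).symm
      refine isRealizationPoint_iff.2 ⟨(K.isRelLowerSet_faces s.2).2 (fun v hv => ?_) ?_,
        hx.1, hsum⟩
      · by_contra h
        exact Finsupp.mem_support_iff.1 hv (hx.2.1 v h)
      · rw [nonempty_iff_ne_empty, ne_eq, Finsupp.support_eq_empty]
        intro h
        rw [h] at hsum
        simp at hsum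
    let j : cell s.1 → Realization K := fun x => ⟨_, hpt x.1 x.2⟩
    have hj : Continuous j := by
      refine continuous_realization_of_support s.2 (fun x v hv => ?_) fun v => ?_
      · by_contra h
        exact Finsupp.mem_support_iff.1 hv (x.2.2.1 v h)
      · exact (continuous_apply v).comp continuous_subtype_val
    have := isCompact_iff_compactSpace.1 (hcell s.1)
    refine ⟨Set.range j, isCompact_range hj, fun p hp => ?_⟩
    have hpc : (p.1 : V → ℝ) ∈ cell s.1 := by
      refine ⟨p.2.2.1, fun v hv => ?_, ?_⟩
      · by_contra h
        exact hv (hp (Finsupp.mem_support_iff.2 h))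
      · rw [← p.2.2.2, Finsupp.sum_of_support_subset _ hp _ fun _ _ => rfl]
    exact ⟨⟨p.1, hpc⟩, Subtype.ext (by ext v; simp [j])⟩
  choose S hSc hS using himg
  refine ⟨?_⟩
  rw [show (Set.univ : Set (Realization K)) = ⋃ s, S s from
    (Set.eq_univ_of_forall fun p => Set.mem_iUnion.2 ⟨⟨_, p.2.1⟩, hS ⟨_, p.2.1⟩ (Subset.refl _)⟩).symm]
  exact isCompact_iUnion hSc

/-- A simplex spanned by linearly independent points is a closed cell of an arrangement. -/
lemma exists_arrangement_of_linearIndepOn [Finite V] {s : Finset (V →₀ ℝ)}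
    (hs : LinearIndepOn ℝ id (s : Set (V →₀ ℝ))) (h1 : ∀ p ∈ s, mass p = 1) :
    ∃ H : Finset ((V →₀ ℝ) →ₗ[ℝ] ℝ), ∀ p ∈ convexHull ℝ (s : Set (V →₀ ℝ)), ∀ x,
      Adh H x p → mass x = 1 → x ∈ convexHull ℝ (s : Set (V →₀ ℝ)) := by
  classical
  -- The functionals are the coordinates in a basis that extends $s$: the simplex is given by their
  -- signs and total mass $1$.
  let b := Module.Basis.extend hs
  have := FiniteDimensional.fintypeBasisIndex b
  have hsub : (s : Set (V →₀ ℝ)) ⊆ hs.extend (Set.subset_univ _) := hs.subset_extend _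
  refine ⟨univ.image fun i => b.coord i, fun p hp x hx hx1 => ?_⟩
  obtain ⟨w, hw0, -, hw⟩ := mem_convexHull'.1 hp
  have hbs : ∀ q (hq : q ∈ s), b ⟨q, hsub hq⟩ = q := fun q hq => Module.Basis.extend_apply_self hs _
  have hcoord : ∀ i, b.coord i p = if i.1 ∈ s then w i.1 else 0 := by
    intro i
    rw [← hw, map_sum]
    have : ∀ q ∈ s, b.coord i (w q • q) = if q = i.1 then w q else 0 := by
      intro q hq
      have hq1 : b.coord i q = if q = i.1 then 1 else 0 := by
        conv_lhs => rw [← hbs q hq]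
        rw [Module.Basis.coord_apply, Module.Basis.repr_self, Finsupp.single_apply]
        simp [Subtype.ext_iff]
      rw [map_smul, smul_eq_mul, hq1]
      split_ifs <;> simp
    rw [sum_congr rfl this, sum_ite_eq' s i.1]
  have hx0 : ∀ i, 0 ≤ b.coord i x ∧ (i.1 ∉ s → b.coord i x = 0) := by
    intro i
    have hi := hx (b.coord i) (by simp)
    have hp0 : 0 ≤ b.coord i p := by
      rw [hcoord]
      split_ifs with h
      exacts [hw0 _ h, le_rfl]
    refine ⟨hi.1 hp0, fun h => le_antisymm (hi.2 ?_) (hi.1 hp0)⟩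
    rw [hcoord, if_neg h]
  let c : (V →₀ ℝ) → ℝ := fun q => if h : q ∈ s then b.coord ⟨q, hsub h⟩ x else 0
  have hcx : ∑ q ∈ s, c q • q = x := by
    conv_rhs => rw [← b.sum_repr x]
    have h2 : ∀ i, b.repr x i • b i = c i.1 • i.1 := by
      intro i
      by_cases h : i.1 ∈ s
      · simp only [c, h, dif_pos, Module.Basis.coord_apply]
        rw [show b i = i.1 from Module.Basis.extend_apply_self hs i]
      · have := (hx0 i).2 h
        rw [Module.Basis.coord_apply] at this
        simp [c, h, this]
    rw [sum_congr rfl fun i _ => h2 i]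
    have h3 : s = (univ.filter fun i : hs.extend (Set.subset_univ _) => i.1 ∈ s).image
        Subtype.val := by
      ext q
      simp only [mem_image, mem_filter, mem_univ, true_and, Subtype.exists, exists_and_left,
        exists_prop, exists_eq_right_right]
      exact ⟨fun h => ⟨h, hsub h⟩, fun h => h.1⟩
    conv_lhs => rw [h3]
    rw [sum_image (fun i _ j _ h => Subtype.ext h), sum_filter]
    refine sum_congr rfl fun i _ => ?_
    split_ifs with h
    · rfl
    · simp [c, h]
  refine mem_convexHull'.2 ⟨c, fun q hq => ?_, ?_, hcx⟩
  · simp only [c, hq, dif_pos]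
    exact (hx0 _).1
  · rw [← hx1, ← hcx, map_sum]
    refine sum_congr rfl fun q hq => ?_
    rw [map_smul, h1 q hq, smul_eq_mul, mul_one]

lemma exists_adhLinear [Finite V] {F : Realization K → Fin n → ℝ} (hF : IsPiecewiseLinear K F) :
    ∃ H, AdhLinear H F := by
  classical
  obtain ⟨S, hfin, hspace, -, hS⟩ := hF
  have hmass : ∀ s ∈ S.faces, ∀ p ∈ s, mass p = 1 := fun s hs p hp => by
    have : p ∈ S.space := S.subset_space hs hp
    rw [hspace] at this
    exact (isRealizationPoint_iff.1 this).2.2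
  -- On the hyperplane of mass $1$, affine independence is linear independence.
  have hlin : ∀ s ∈ S.faces, LinearIndepOn ℝ id (s : Set (V →₀ ℝ)) := by
    intro s hs
    rw [LinearIndepOn, linearIndependent_iff']
    intro t w hw
    refine affineIndependent_iff.1 (S.indep hs) t w ?_ hw
    have h := congrArg mass hw
    rw [map_sum, map_zero] at h
    rw [← h]
    refine sum_congr rfl fun q _ => ?_
    rw [map_smul, id, hmass s hs q.1 q.2, smul_eq_mul, mul_one]
  choose! Hs hHs using fun s hs => exists_arrangement_of_linearIndepOn (hlin s hs) (hmass s hs)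
  refine ⟨hfin.toFinset.biUnion Hs, fun p => ?_⟩
  have hp : p.1 ∈ S.space := by rw [hspace]; exact p.2
  obtain ⟨s, hs, hps⟩ := Geometry.SimplicialComplex.mem_space_iff.1 hp
  obtain ⟨A, hA⟩ := hS s hs
  -- The affine map made linear: its constant term is multiplied by the mass, which is $1$ on the
  -- realization.
  refine ⟨A.linear + mass.smulRight (A 0), fun x hx => ?_⟩
  rw [hA x (hHs s hs p.1 hps x.1 (hx.mono fun h hh =>
    mem_biUnion.2 ⟨s, hfin.mem_toFinset.2 hs, hh⟩) (Realization.mass_eq x))]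
  conv_lhs => rw [AffineMap.decomp A]
  simp [(Realization.mass_eq x)]

end PL

/-! ### The dimension of a triangulation of the boundary. -/

section Dimension

variable {V : Type*} {K : PreAbstractSimplicialComplex V} {n : ℕ}

/-- A point in the interior of a simplex in general position with respect to finitely many
functionals. -/
lemma exists_generic (H : Finset ((V →₀ ℝ) →ₗ[ℝ] ℝ)) {s : Finset V} (hs : s.Nonempty) :
    ∃ p : V →₀ ℝ, p.support = s ∧ (∀ v ∈ s, 0 < p v) ∧ mass p = 1 ∧
      ∀ h ∈ H, h p = 0 → ∀ v ∈ s, h (Finsupp.single v 1) = 0 := by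
  classical
  have key : ∃ p : V →₀ ℝ, p.support = s ∧ (∀ v ∈ s, 0 < p v) ∧
      ∀ h ∈ H, h p = 0 → ∀ v ∈ s, h (Finsupp.single v 1) = 0 := by
    induction H using Finset.induction_on with
    | empty =>
      refine ⟨Finsupp.indicator s fun _ _ => 1, ?_, ?_, by simp⟩
      · ext v; simp [Finsupp.indicator_apply]
      · intro v hv; simp [hv]
    | insert f H _ ih =>
      obtain ⟨p, hps, hp0, hp⟩ := ih
      by_cases hf : f p = 0 → ∀ v ∈ s, f (Finsupp.single v 1) = 0
      · refine ⟨p, hps, hp0, fun h hh => ?_⟩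
        rcases mem_insert.1 hh with rfl | hh
        exacts [hf, hp h hh]
      · push Not at hf
        obtain ⟨hfp, v, hv, hfv⟩ := hf
        -- Moving $p$ towards $v$ makes $f$ non-zero. All but finitely many step lengths create no
        -- new zero among the functionals treated before.
        obtain ⟨ε, hε, hεH⟩ := (Set.Ioi_infinite (0 : ℝ)).exists_notMem_finset
          (H.image fun h => -h p / h (Finsupp.single v 1))
        rw [Set.mem_Ioi] at hε
        refine ⟨p + Finsupp.single v ε, ?_, fun w hw => ?_, fun h hh h0 => ?_⟩
        · ext w
          rw [Finsupp.mem_support_iff, Finsupp.add_apply, Finsupp.single_apply, ← hps,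
            Finsupp.mem_support_iff]
          split_ifs with hvw
          · subst hvw
            have := hp0 v hv
            exact ⟨fun _ => this.ne', fun _ => by positivity⟩
          · rw [add_zero]
        · rw [Finsupp.add_apply, Finsupp.single_apply]
          have := hp0 w hw
          split_ifs <;> linarith
        · have hh1 : h (p + Finsupp.single v ε) = h p + ε * h (Finsupp.single v 1) := by
            rw [map_add, ← Finsupp.smul_single_one, map_smul, smul_eq_mul]
          rw [hh1] at h0
          rcases mem_insert.1 hh with rfl | hh
          · rw [hfp, zero_add] at h0
            exact absurd h0 (mul_ne_zero hε.ne' hfv)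
          · by_cases hv0 : h (Finsupp.single v 1) = 0
            · rw [hv0, mul_zero, add_zero] at h0
              exact hp h hh h0
            · refine absurd (mem_image.2 ⟨h, hh, ?_⟩) hεH
              rw [div_eq_iff hv0]
              linarith
  obtain ⟨p, hps, hp0, hp⟩ := key
  have hp0' : ∀ v, 0 ≤ p v := fun v => by
    by_cases hv : v ∈ s
    · exact (hp0 v hv).le
    · rw [← hps, Finsupp.notMem_support_iff] at hv
      exact hv.ge
  have hm : 0 < mass p := mass_pos hp0' (by rintro rfl; simp at hps; simp [← hps] at hs)
  refine ⟨(mass p)⁻¹ • p, ?_, fun v hv => ?_, ?_, fun h hh h0 => ?_⟩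
  · rw [Finsupp.support_smul_eq (inv_ne_zero hm.ne'), hps]
  · have := hp0 v hv
    rw [Finsupp.smul_apply, smul_eq_mul]
    positivity
  · rw [map_smul, smul_eq_mul, inv_mul_cancel₀ hm.ne']
  · rw [map_smul, smul_eq_mul, mul_eq_zero] at h0
    exact hp h hh (h0.resolve_left (inv_ne_zero hm.ne'))

/-- An injective piecewise linear map into the boundary of the `n`-cube is defined on a complex of
dimension less than `n`. -/
lemma card_le_of_injective [Finite V] {H : Finset ((V →₀ ℝ) →ₗ[ℝ] ℝ)}
    {F : Realization K → Fin n → ℝ} (hF : AdhLinear H F) (hinj : Function.Injective F)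
    (hb : ∀ p, ∃ i, F p i = 0 ∨ F p i = 1) {s : Finset V} (hs : s ∈ K.faces) : s.card ≤ n := by
  classical
  by_contra hcard
  rw [not_le] at hcard
  have hs0 := (K.isRelLowerSet_faces hs).1
  obtain ⟨R, hR⟩ := exists_reps H {p | IsRealizationPoint K p}
  choose A hA using hF
  have := hR.finite.fintype
  -- These functionals express that a coordinate of a linear piece of $F$ takes the value $0$ or
  -- $1$.
  let Q : Finset ((V →₀ ℝ) →ₗ[ℝ] ℝ) := (univ : Finset (R × Fin n × Fin 2)).image fun x =>
    LinearMap.proj x.2.1 ∘ₗ A ⟨x.1, hR.subset x.1.2⟩ - ((x.2.2 : ℕ) : ℝ) • mass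
  obtain ⟨p, hps, hp0, hp1, hp⟩ := exists_generic (H ∪ Q) hs0
  have hpK : IsRealizationPoint K p := isRealizationPoint_iff.2 ⟨hps ▸ hs, fun v => by
    by_cases hv : v ∈ s
    · exact (hp0 v hv).le
    · rw [← hps, Finsupp.notMem_support_iff] at hv
      exact hv.ge, hp1⟩
  obtain ⟨r, hr, -, hpr⟩ := hR.exists_rep p hpK
  have hFp := hA ⟨r, hR.subset hr⟩ ⟨p, hpK⟩ hpr
  set B := A ⟨r, hR.subset hr⟩ with hB
  obtain ⟨i, c, hic⟩ : ∃ i, ∃ c : Fin 2, B p i = ((c : ℕ) : ℝ) := by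
    obtain ⟨i, hi⟩ := hb ⟨p, hpK⟩
    rw [hFp] at hi
    rcases hi with hi | hi
    · exact ⟨i, 0, by simpa using hi⟩
    · exact ⟨i, 1, by simpa using hi⟩
  -- A generic point $p$ is sent to a face of the cube, so by genericity the linear piece $B$ at $p$
  -- sends all vertices of $s$ to the hyperplane of that face.
  have hvan : ∀ v ∈ s, B (Finsupp.single v 1) i = ((c : ℕ) : ℝ) := by
    intro v hv
    have := hp (LinearMap.proj i ∘ₗ B - ((c : ℕ) : ℝ) • mass)
      (mem_union_right _ (mem_image.2 ⟨(⟨r, hr⟩, i, c), mem_univ _, rfl⟩))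
      (by simp [hic, hp1]) v hv
    simpa [mass_single, sub_eq_zero] using this
  let J : (s →₀ ℝ) →ₗ[ℝ] (V →₀ ℝ) := Finsupp.lmapDomain ℝ ℝ Subtype.val
  have hJ : Function.Injective J := Finsupp.mapDomain_injective Subtype.val_injective
  -- The $i$-th coordinate of $B$ is a multiple of the mass on $s$, so the mass takes its place.
  -- With $|s|>n$, these $n$ equations have a non-zero solution $x$, and moving $p$ along $x$ does
  -- not change $B$.
  let M : (s →₀ ℝ) →ₗ[ℝ] (Fin n → ℝ) :=
    LinearMap.pi fun j => if j = i then mass ∘ₗ J else LinearMap.proj j ∘ₗ B ∘ₗ J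
  have hker : LinearMap.ker M ≠ ⊥ := LinearMap.ker_ne_bot_of_finrank_lt (by
    simp [Module.finrank_finsupp_self, hcard])
  obtain ⟨x, hxM, hx0⟩ := (Submodule.ne_bot_iff _).1 hker
  have hMx : ∀ j, M x j = 0 := fun j => by rw [LinearMap.mem_ker.1 hxM]; rfl
  have hlin : ∀ h : (V →₀ ℝ) →ₗ[ℝ] ℝ, h (J x) = ∑ v : s, x v * h (Finsupp.single v.1 1) := by
    intro h
    conv_lhs => rw [← Finsupp.univ_sum_single x]
    simp only [map_sum]
    refine sum_congr rfl fun v _ => ?_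
    simp only [J, Finsupp.lmapDomain_apply, Finsupp.mapDomain_single]
    rw [← Finsupp.smul_single_one, map_smul, smul_eq_mul]
  have hmJ : mass (J x) = 0 := by
    have := hMx i
    simpa [M] using this
  have hBJ : B (J x) = 0 := by
    funext j
    by_cases hj : j = i
    · subst hj
      have h1 := hlin (LinearMap.proj j ∘ₗ B)
      have h2 := hlin mass
      rw [hmJ] at h2
      simp only [LinearMap.comp_apply, LinearMap.proj_apply] at h1
      rw [h1, sum_congr rfl fun v _ => by rw [hvan v.1 v.2], ← sum_mul]
      simp only [mass_single, mul_one] at h2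
      rw [← h2, zero_mul]; rfl
    · have := hMx j
      simpa [M, hj] using this
  -- A step short enough for $p+\varepsilon x$ to stay in the closed cell of $p$; functionals that
  -- vanish at $p$ vanish along $x$ by genericity.
  obtain ⟨ε, hε, hεH⟩ : ∃ ε > 0, ∀ h ∈ H ∪ coords V, |ε * h (J x)| ≤ |h p| ∨ h p = 0 := by
    have : ∀ G : Finset ((V →₀ ℝ) →ₗ[ℝ] ℝ), ∃ ε > 0, ∀ h ∈ G, |ε * h (J x)| ≤ |h p| ∨ h p = 0 := by
      intro G
      induction G using Finset.induction_on with
      | empty => exact ⟨1, one_pos, by simp⟩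
      | insert f G _ ih =>
        obtain ⟨ε, hε, h⟩ := ih
        by_cases hf : f p = 0
        · exact ⟨ε, hε, fun g hg => by
            rcases mem_insert.1 hg with rfl | hg
            exacts [.inr hf, h g hg]⟩
        · have hf' := abs_pos.2 hf
          refine ⟨min ε (|f p| / (|f (J x)| + 1)), by positivity, fun g hg => ?_⟩
          have hpos : 0 < min ε (|f p| / (|f (J x)| + 1)) := by positivity
          rw [abs_mul, abs_of_pos hpos]
          rcases mem_insert.1 hg with rfl | hg
          · left
            calc _ ≤ |g p| / (|g (J x)| + 1) * |g (J x)| := by gcongr; exact min_le_right _ _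
              _ ≤ |g p| / (|g (J x)| + 1) * (|g (J x)| + 1) := by gcongr; linarith
              _ = |g p| := by field_simp
          · refine (h g hg).imp_left fun h' => ?_
            rw [abs_mul, abs_of_pos hε] at h'
            exact (mul_le_mul_of_nonneg_right (min_le_left _ _) (abs_nonneg _)).trans h'
    exact this _
  have hJs : ∀ v ∉ s, J x v = 0 := fun v hv => by
    simp only [J, Finsupp.lmapDomain_apply]
    exact Finsupp.mapDomain_of_notMem_range _ _ (by simpa using hv)
  have hadh : Adh (H ∪ coords V) (p + ε • J x) p := by
    intro h hh
    rw [map_add, map_smul, smul_eq_mul]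
    rcases hεH h hh with h1 | h1
    · refine ⟨fun h0 => ?_, fun h0 => ?_⟩
      · rw [abs_of_nonneg h0] at h1
        linarith [neg_abs_le (ε * h (J x))]
      · rw [abs_of_nonpos h0] at h1
        linarith [le_abs_self (ε * h (J x))]
    · have : h (J x) = 0 := by
        rcases mem_union.1 hh with hh | hh
        · rw [hlin h]
          refine sum_eq_zero fun v _ => ?_
          rw [hp h (mem_union_left _ hh) h1 v.1 v.2, mul_zero]
        · simp only [coords, Set.Finite.mem_toFinset, Set.mem_range] at hh
          obtain ⟨v, rfl⟩ := hh
          have hv : v ∉ s := fun hv => (hp0 v hv).ne' h1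
          exact hJs v hv
      rw [h1, this]; simp
  have hq : IsRealizationPoint K (p + ε • J x) :=
    (cellUnion_realization (K := K) subset_union_right).closed p hpK _ hadh (by
      rw [map_add, map_smul, hmJ, hp1]; simp)
  have hFq := hA ⟨r, hR.subset hr⟩ ⟨_, hq⟩ ((hadh.mono subset_union_left).trans hpr)
  rw [map_add, map_smul, hBJ, smul_zero, add_zero, ← hFp] at hFq
  have := congrArg Subtype.val (hinj hFq)
  simp only [add_eq_left, smul_eq_zero, hε.ne', false_or] at this
  exact hx0 (hJ (by rw [this, map_zero]))

end Dimension

/-! ### Stellar subdivisions as geometric subdivisions. -/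

section StellarGeometry

variable {U : Type*} [DecidableEq U]

/-- The points with non-negative coordinates whose support is a simplex of `K`. -/
def fcone (K : Finset (Finset U)) : Set (U →₀ ℝ) := {x | x.support ∈ K ∧ ∀ v, 0 ≤ x v}

/-- The barycenter of a simplex. -/
noncomputable def barycenter (σ : Finset U) : U →₀ ℝ :=
  Finsupp.indicator σ fun _ _ => (σ.card : ℝ)⁻¹

lemma barycenter_apply (σ : Finset U) (v : U) :
    barycenter σ v = if v ∈ σ then (σ.card : ℝ)⁻¹ else 0 := by
  simp [barycenter, Finsupp.indicator_apply]

lemma mass_barycenter {σ : Finset U} (hσ : σ.Nonempty) : mass (barycenter σ) = 1 := by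
  have hc : (0 : ℝ) < σ.card := by exact_mod_cast hσ.card_pos
  rw [mass_eq_sum, Finsupp.sum_of_support_subset (s := σ) _ (fun v hv => ?_) _ fun _ _ => rfl]
  · rw [sum_congr rfl fun v hv => by rw [barycenter_apply, if_pos hv], sum_const, nsmul_eq_mul,
      mul_inv_cancel₀ hc.ne']
  · by_contra h
    rw [Finsupp.mem_support_iff, barycenter_apply, if_neg h] at hv
    exact hv rfl

/-- The linear map that sends the new vertex `b` of a stellar subdivision to the barycenter
of `σ`. -/
noncomputable def collapse (σ : Finset U) (b : U) : (U →₀ ℝ) →ₗ[ℝ] (U →₀ ℝ) :=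
  LinearMap.id + (Finsupp.lapply b).smulRight (barycenter σ - Finsupp.single b 1)

lemma collapse_apply (σ : Finset U) (b : U) (x : U →₀ ℝ) (v : U) :
    collapse σ b x v = (if v = b then 0 else x v) + if v ∈ σ then x b / σ.card else 0 := by
  simp only [collapse, LinearMap.add_apply, LinearMap.id_apply, LinearMap.smulRight_apply,
    Finsupp.lapply_apply, Finsupp.add_apply, Finsupp.smul_apply, Finsupp.sub_apply,
    barycenter_apply, Finsupp.single_apply, smul_eq_mul]
  by_cases h : v = b
  · subst h; split_ifs <;> ring_nf
  · have h' : ¬ b = v := fun h' => h h'.symm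
    split_ifs <;> ring

lemma linearCombination_update (pos : U → U →₀ ℝ) (σ : Finset U) (b : U) :
    Finsupp.linearCombination ℝ (Function.update pos b
      (Finsupp.linearCombination ℝ pos (barycenter σ))) =
      Finsupp.linearCombination ℝ pos ∘ₗ collapse σ b := by
  refine Finsupp.lhom_ext' fun v => LinearMap.ext_ring ?_
  by_cases h : v = b
  · subst h
    simp [collapse]
  · have h' : ¬ b = v := fun h' => h h'.symm
    simp [collapse, h]

/-- A point of the subdivision has a zero coordinate on $\sigma$, so its $b$-coordinate divided by
$|\sigma|$ is the minimum over $\sigma$ of the coordinates of its image. The inverse subtracts this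
minimum $m$ on $\sigma$ and puts $m|\sigma|$ on $b$. -/
lemma bijOn_collapse {K : Finset (Finset U)} (hK : IsComplex K) {σ : Finset U} {b : U}
    (hσ : σ ∈ K) (hσ0 : σ.Nonempty) (hb : b ∉ vset K) :
    Set.BijOn (collapse σ b) (fcone (star K σ b)) (fcone K) := by
  have hc : (0 : ℝ) < σ.card := by exact_mod_cast hσ0.card_pos
  have hbσ : b ∉ σ := fun h => hb (subset_vset hσ h)
  have hzero : ∀ x ∈ fcone (star K σ b), ∃ v ∈ σ, x v = 0 := by
    intro x hx
    obtain ⟨τ, h1, h2⟩ : ∃ τ, ¬ σ ⊆ τ ∧ x.support ⊆ insert b τ := by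
      rcases mem_star.1 hx.1 with h | ⟨τ, -, h, -, he⟩
      · exact ⟨_, h.2, subset_insert _ _⟩
      · exact ⟨τ, h, he.ge⟩
    obtain ⟨v, hv, hvτ⟩ := not_subset.1 h1
    refine ⟨v, hv, ?_⟩
    by_contra hxv
    rcases mem_insert.1 (h2 (Finsupp.mem_support_iff.2 hxv)) with rfl | h
    exacts [hbσ hv, hvτ h]
  refine ⟨fun x hx => ⟨?_, fun v => ?_⟩, fun x hx y hy hxy => ?_, fun x hx => ?_⟩
  · rcases mem_star.1 hx.1 with h | ⟨τ, hτ, -, h, he⟩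
    · have hxb : x b = 0 := by
        by_contra h'
        exact hb (subset_vset h.1 (Finsupp.mem_support_iff.2 h'))
      have : collapse σ b x = x := by
        ext v
        rw [collapse_apply, hxb]
        split_ifs with h1 <;> simp [h1, hxb]
      rw [this]
      exact h.1
    · refine hK.down_closed _ h _ fun v hv => ?_
      rw [Finsupp.mem_support_iff, collapse_apply] at hv
      by_contra hvn
      rw [mem_union, not_or] at hvn
      rw [if_neg hvn.2, add_zero] at hv
      split_ifs at hv with hvb
      · exact hv rfl
      · have := Finsupp.mem_support_iff.2 hv
        rw [← he] at this
        exact hvn.1 (mem_of_mem_insert_of_ne this hvb)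
  · rw [collapse_apply]
    have h1 := hx.2 v
    have h2 := hx.2 b
    split_ifs <;> positivity
  · have hle : ∀ x ∈ fcone (star K σ b), ∀ y ∈ fcone (star K σ b),
        collapse σ b x = collapse σ b y → y b ≤ x b := by
      intro x hx y hy hxy
      obtain ⟨v, hv, hxv⟩ := hzero x hx
      have hvb : v ≠ b := by rintro rfl; exact hbσ hv
      have := DFunLike.congr_fun hxy v
      rw [collapse_apply, collapse_apply, if_neg hvb, if_neg hvb, if_pos hv, if_pos hv, hxv,
        zero_add] at this
      have h1 : y b / σ.card ≤ x b / σ.card := by linarith [hy.2 v]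
      rwa [div_le_div_iff_of_pos_right hc] at h1
    have hbe : x b = y b := le_antisymm (hle y hy x hx hxy.symm) (hle x hx y hy hxy)
    ext v
    by_cases hvb : v = b
    · rw [hvb, hbe]
    · have := DFunLike.congr_fun hxy v
      rw [collapse_apply, collapse_apply, if_neg hvb, if_neg hvb, hbe] at this
      linarith
  · obtain ⟨u, hu, hmin⟩ := exists_min_image σ x hσ0
    set m := x u with hm
    have hm0 : 0 ≤ m := hx.2 u
    have hxb : x b = 0 := by
      by_contra h'
      exact hb (subset_vset hx.1 (Finsupp.mem_support_iff.2 h'))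
    set y : U →₀ ℝ := x - (m * σ.card) • barycenter σ + Finsupp.single b (m * σ.card) with hy
    have hyv : ∀ v, y v = (x v - if v ∈ σ then m else 0) + if v = b then m * σ.card else 0 := by
      intro v
      simp only [hy, Finsupp.add_apply, Finsupp.sub_apply, Finsupp.smul_apply, barycenter_apply,
        Finsupp.single_apply, smul_eq_mul, mul_ite, mul_zero, eq_comm (a := b)]
      rw [mul_assoc, mul_inv_cancel₀ hc.ne', mul_one]
    have hyb : y b = m * σ.card := by rw [hyv, hxb, if_neg hbσ, if_pos rfl]; ring
    have hynb : ∀ v, v ≠ b → y v = x v - if v ∈ σ then m else 0 := fun v hv => by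
      rw [hyv, if_neg hv, add_zero]
    have hub : u ≠ b := by rintro h; exact hbσ (h ▸ hu)
    have hyu : y u = 0 := by rw [hynb u hub, if_pos hu, ← hm, sub_self]
    have hysub : y.support.erase b ⊆ x.support := by
      intro v hv
      obtain ⟨hvb, hv⟩ := mem_erase.1 hv
      rw [Finsupp.mem_support_iff, hynb v hvb] at hv
      rw [Finsupp.mem_support_iff]
      intro h
      rw [h] at hv
      split_ifs at hv with hvσ
      · have := hmin v hvσ
        exact hv (by linarith)
      · simp at hv
    refine ⟨y, ⟨mem_star.2 ?_, fun v => ?_⟩, ?_⟩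
    · rcases hm0.eq_or_lt with h0 | h0
      · left
        have hyx : y = x := by
          ext v
          rw [hyv, ← h0]
          simp
        rw [hyx]
        refine ⟨hx.1, fun h => Finsupp.mem_support_iff.1 (h hu) ?_⟩
        rw [← hm, ← h0]
      · refine .inr ⟨y.support.erase b, hK.down_closed _ hx.1 _ hysub, fun h => ?_,
          hK.down_closed _ hx.1 _ (union_subset hysub fun v hv => ?_), insert_erase ?_⟩
        · exact Finsupp.mem_support_iff.1 (mem_of_mem_erase (h hu)) hyu
        · exact Finsupp.mem_support_iff.2 (h0.trans_le (hmin v hv)).ne'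
        · rw [Finsupp.mem_support_iff, hyb]
          positivity
    · rw [hyv]
      have h1 := hx.2 v
      split_ifs with hvσ hvb hvb
      · have := hmin v hvσ
        have : 0 ≤ m * σ.card := by positivity
        linarith
      · have := hmin v hvσ
        linarith
      · positivity
      · linarith
    · ext v
      rw [collapse_apply, hyb, mul_div_assoc, div_self hc.ne', mul_one]
      by_cases hvb : v = b
      · subst hvb
        rw [if_pos rfl, if_neg hbσ, hxb, add_zero]
      · rw [if_neg hvb, hynb v hvb]
        ring

/-- An iterated stellar subdivision `K` of `C` is a geometric subdivision: its vertices can be placed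
in the realization of `C` in such a way that the resulting map is bijective. -/
lemma Stell.exists_position {L C K : Finset (Finset U)} {n : ℕ} {Z : Finset U} (hC : Rel L n C)
    (h : Stell (vset L) Z C K) : ∃ pos : U → U →₀ ℝ,
      Set.BijOn (Finsupp.linearCombination ℝ pos) (fcone K) (fcone C) ∧
      (∀ v ∈ vset L, pos v = Finsupp.single v 1) ∧ ∀ v, mass (pos v) = 1 := by
  induction h with
  | refl =>
    refine ⟨fun v => Finsupp.single v 1, ?_, fun _ _ => rfl, fun v => mass_single v 1⟩
    have : Finsupp.linearCombination ℝ (fun v : U => Finsupp.single v (1 : ℝ)) = LinearMap.id :=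
      Finsupp.lhom_ext' fun v => LinearMap.ext_ring (by simp)
    rw [this]
    exact Set.bijOn_id _
  | tail h1 h2 ih =>
    obtain ⟨pos, hpos, hposL, hmass⟩ := ih
    have hrel := hC.stell h1
    obtain ⟨σ, hσ, hσP, b, -, hbK, rfl⟩ := h2
    have hσ0 : σ.Nonempty := by
      rw [nonempty_iff_ne_empty]; rintro rfl; simp at hσP
    refine ⟨Function.update pos b (Finsupp.linearCombination ℝ pos (barycenter σ)), ?_,
      fun v hv => ?_, fun v => ?_⟩
    · rw [linearCombination_update, LinearMap.coe_comp]
      exact hpos.comp (bijOn_collapse hrel.isComplex hσ hσ0 hbK)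
    · rw [Function.update_of_ne, hposL v hv]
      rintro rfl
      exact hbK (hrel.vset_subset hv)
    · by_cases hv : v = b
      · subst hv
        rw [Function.update_self]
        have : mass ∘ₗ Finsupp.linearCombination ℝ pos = mass :=
          Finsupp.lhom_ext' fun v => LinearMap.ext_ring (by simp [hmass, mass_single])
        rw [← LinearMap.comp_apply, this, mass_barycenter hσ0]
      · rw [Function.update_of_ne hv, hmass]

lemma mass_linearCombination {pos : U → U →₀ ℝ} (hmass : ∀ v, mass (pos v) = 1) (x : U →₀ ℝ) :
    mass (Finsupp.linearCombination ℝ pos x) = mass x := by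
  have : mass ∘ₗ Finsupp.linearCombination ℝ pos = mass :=
    Finsupp.lhom_ext' fun v => LinearMap.ext_ring (by simp [hmass, mass_single])
  rw [← LinearMap.comp_apply, this]

end StellarGeometry

lemma mass_mapDomain {U V : Type*} (f : V → U) (x : V →₀ ℝ) :
    mass (Finsupp.mapDomain f x) = mass x := by
  have : mass ∘ₗ Finsupp.lmapDomain ℝ ℝ f = mass :=
    Finsupp.lhom_ext' fun v => LinearMap.ext_ring (by simp [mass_single])
  rw [← this]; rfl

/-! ### Coning off the boundary homeomorphism. -/

section ConeMap

variable {V : Type*} {K : PreAbstractSimplicialComplex V} {n : ℕ}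

open Classical in
/-- The extension of a map on the realization of `K` to the cone of all non-negative multiples. -/
noncomputable def homogenize (h : Realization K → Fin n → ℝ) (z : V →₀ ℝ) : Fin n → ℝ :=
  mass z • if hz : IsRealizationPoint K ((mass z)⁻¹ • z) then h ⟨_, hz⟩ else 0

/-- The cone on the realization of `K`, in the coordinates given by the apex and the base. -/
def conePoints (K : PreAbstractSimplicialComplex V) : Set (ℝ × (V →₀ ℝ)) :=
  {x | 0 ≤ x.1 ∧ (∀ v, 0 ≤ x.2 v) ∧ (x.2 = 0 ∨ x.2.support ∈ K.faces) ∧ x.1 + mass x.2 = 1}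

/-- The extension of a map to the boundary of the cube to the cone, sending the apex to the
center. -/
noncomputable def coneMap (h : Realization K → Fin n → ℝ) (x : ℝ × (V →₀ ℝ)) : Fin n → ℝ :=
  (x.1 • fun _ => 1 / 2) + homogenize h x.2

lemma homogenize_zero (h : Realization K → Fin n → ℝ) : homogenize h 0 = 0 := by
  simp [homogenize]

lemma isRealizationPoint_normalize {z : V →₀ ℝ} (hz0 : ∀ v, 0 ≤ z v) (hz : z.support ∈ K.faces) :
    0 < mass z ∧ IsRealizationPoint K ((mass z)⁻¹ • z) := by
  have h0 : z ≠ 0 := Finsupp.support_nonempty_iff.1 (K.isRelLowerSet_faces hz).1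
  have hm := mass_pos hz0 h0
  refine ⟨hm, isRealizationPoint_iff.2 ⟨?_, fun v => ?_, ?_⟩⟩
  · rwa [Finsupp.support_smul_eq (inv_ne_zero hm.ne')]
  · exact mul_nonneg (inv_nonneg.2 hm.le) (hz0 v)
  · rw [map_smul, smul_eq_mul, inv_mul_cancel₀ hm.ne']

lemma homogenize_smul (h : Realization K → Fin n → ℝ) (u : Realization K) {s : ℝ} (hs : 0 < s) :
    homogenize h (s • u.1) = s • h u := by
  have hm : mass (s • u.1) = s := by rw [map_smul, Realization.mass_eq u, smul_eq_mul, mul_one]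
  have hu : (mass (s • u.1))⁻¹ • s • u.1 = u.1 := by
    rw [hm, smul_smul, inv_mul_cancel₀ hs.ne', one_smul]
  have hr : IsRealizationPoint K ((mass (s • u.1))⁻¹ • s • u.1) := by rw [hu]; exact u.2
  rw [homogenize, dif_pos hr, show h ⟨_, hr⟩ = h u from congrArg h (Subtype.ext hu), hm]

lemma exists_smul_eq {z : V →₀ ℝ} (hz0 : ∀ v, 0 ≤ z v) (hz : z.support ∈ K.faces) :
    ∃ u : Realization K, 0 < mass z ∧ z = mass z • u.1 := by
  obtain ⟨hm, hr⟩ := isRealizationPoint_normalize hz0 hz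
  exact ⟨⟨_, hr⟩, hm, by simp only; rw [smul_smul, mul_inv_cancel₀ hm.ne', one_smul]⟩

/-- In the sup norm the cube is the ball of radius $1/2$ about its center $c$, and its boundary is
the sphere. The point $(1-s,su)$ goes to $c+s(h(u)-c)$, at distance $s/2$ from $c$; so the distance
recovers $s$ and the direction recovers $u$. -/
lemma bijOn_coneMap {h : Realization K → Fin n → ℝ} (hinj : Function.Injective h)
    (hrange : Set.range h = {y | (∀ i, y i ∈ Set.Icc (0 : ℝ) 1) ∧ ∃ i, y i = 0 ∨ y i = 1}) :
    Set.BijOn (coneMap h) (conePoints K) {y | ∀ i, y i ∈ Set.Icc (0 : ℝ) 1} := by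
  set c : Fin n → ℝ := fun _ => 1 / 2 with hc
  have hcube : ∀ y : Fin n → ℝ, (∀ i, y i ∈ Set.Icc (0 : ℝ) 1) → ‖y - c‖ ≤ 1 / 2 := by
    intro y hy
    refine (pi_norm_le_iff_of_nonneg (by norm_num)).2 fun i => ?_
    rw [Real.norm_eq_abs, abs_le]
    have := hy i
    simp only [Set.mem_Icc] at this
    constructor <;> simp only [hc, Pi.sub_apply] <;> linarith
  have hh : ∀ u, (∀ i, h u i ∈ Set.Icc (0 : ℝ) 1) ∧ ∃ i, h u i = 0 ∨ h u i = 1 := fun u => by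
    have : h u ∈ Set.range h := ⟨u, rfl⟩
    rwa [hrange] at this
  have hnorm : ∀ u, ‖h u - c‖ = 1 / 2 := by
    intro u
    refine le_antisymm (hcube _ (hh u).1) ?_
    obtain ⟨i, hi⟩ := (hh u).2
    refine le_trans ?_ (norm_le_pi_norm (h u - c) i)
    rw [Real.norm_eq_abs, Pi.sub_apply, hc]
    rcases hi with hi | hi <;> rw [hi] <;> norm_num [abs_of_pos, abs_of_neg]
  have hsub : ∀ t (u : Realization K) s, 0 < s → t + s = 1 →
      coneMap h (t, s • u.1) = c + s • (h u - c) := by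
    intro t u s hs hts
    rw [coneMap, homogenize_smul h u hs]
    have : t = 1 - s := by linarith
    subst this
    simp only [smul_sub, sub_smul, one_smul]
    abel
  have hzero : ∀ t, t + mass (0 : V →₀ ℝ) = 1 → coneMap h (t, 0) = c := by
    intro t ht
    rw [map_zero, add_zero] at ht
    simp [coneMap, homogenize_zero, ht, hc]
  have hn : ∀ x ∈ conePoints K, ‖coneMap h x - c‖ = mass x.2 / 2 := by
    rintro ⟨t, z⟩ ⟨-, hz0, hz, ht⟩
    rcases hz with hz | hz
    · obtain rfl : z = 0 := hz
      rw [hzero t ht]; simp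
    · obtain ⟨u, hm, hu⟩ := exists_smul_eq (z := z) hz0 hz
      conv_lhs => rw [hu]
      change _ = mass z / 2
      rw [hsub t u _ hm ht, add_sub_cancel_left, norm_smul, hnorm, Real.norm_of_nonneg hm.le]
      ring
  refine ⟨?_, ?_, ?_⟩
  · rintro ⟨t, z⟩ ⟨ht0, hz0, hz, ht⟩ i
    rcases hz with hz | hz
    · obtain rfl : z = 0 := hz
      rw [hzero t ht]; norm_num [hc]
    · obtain ⟨u, hm, hu⟩ := exists_smul_eq (z := z) hz0 hz
      have := (hh u).1 i
      rw [hu, hsub t u _ hm ht]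
      simp only [Pi.add_apply, Pi.smul_apply, Pi.sub_apply, smul_eq_mul, hc, Set.mem_Icc] at this ⊢
      constructor <;> nlinarith
  · rintro ⟨t, z⟩ hx ⟨t', z'⟩ hx' he
    have h1 := hn _ hx
    rw [he, hn _ hx'] at h1
    obtain ⟨-, hz0, hz, ht⟩ := hx
    obtain ⟨-, hz0', hz', ht'⟩ := hx'
    simp only at h1 hz0 hz ht hz0' hz' ht'
    have hmm : mass z = mass z' := by linarith
    have htt : t = t' := by linarith
    rcases hz with hz | hz
    · have : z' = 0 := by
        by_contra h0
        have := mass_pos hz0' h0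
        rw [← hmm, hz, map_zero] at this
        exact lt_irrefl _ this
      rw [htt, hz, this]
    · obtain ⟨u, hm, hu⟩ := exists_smul_eq hz0 hz
      have hz'' : z'.support ∈ K.faces := by
        refine hz'.resolve_left ?_
        rintro rfl
        rw [hmm, map_zero] at hm
        exact lt_irrefl _ hm
      obtain ⟨u', hm', hu'⟩ := exists_smul_eq hz0' hz''
      rw [hu, hu', hsub t u _ hm ht, hsub t' u' _ hm' ht', hmm] at he
      have := smul_right_injective _ hm'.ne' (add_left_cancel he)
      have huu : u = u' := hinj (sub_left_injective this)
      rw [htt, hu, hu', hmm, huu]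
  · intro y hy
    rcases eq_or_ne y c with rfl | hyc
    · exact ⟨(1, 0), ⟨zero_le_one, fun _ => le_rfl, .inl rfl, by simp⟩, hzero 1 (by simp)⟩
    · have hN : 0 < ‖y - c‖ := norm_pos_iff.2 (sub_ne_zero.2 hyc)
      set s := 2 * ‖y - c‖ with hs
      have hs0 : 0 < s := by positivity
      have hs1 : s ≤ 1 := by linarith [hcube y hy]
      have hi : ∀ i, |s⁻¹ * (y i - c i)| ≤ 1 / 2 := by
        intro i
        have := norm_le_pi_norm (y - c) i
        rw [abs_mul, abs_of_pos (inv_pos.2 hs0), inv_mul_le_iff₀ hs0]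
        rw [Real.norm_eq_abs, Pi.sub_apply] at this
        linarith
      obtain ⟨j, hj⟩ : ∃ j, |s⁻¹ * (y j - c j)| = 1 / 2 := by
        have : Nonempty (Fin n) := by
          by_contra h0
          rw [not_nonempty_iff] at h0
          exact hyc (Subsingleton.elim _ _)
        obtain ⟨j, hj⟩ := Finite.exists_max fun i => ‖(y - c) i‖
        refine ⟨j, ?_⟩
        have : ‖(y - c) j‖ = ‖y - c‖ := le_antisymm (norm_le_pi_norm _ j)
          ((pi_norm_le_iff_of_nonneg (norm_nonneg _)).2 hj)
        rw [Real.norm_eq_abs, Pi.sub_apply] at this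
        rw [abs_mul, abs_of_pos (inv_pos.2 hs0), this, hs]
        field_simp
      obtain ⟨u, hu⟩ : c + s⁻¹ • (y - c) ∈ Set.range h := by
        rw [hrange]
        refine ⟨fun i => ?_, j, ?_⟩
        · have := abs_le.1 (hi i)
          simp only [Pi.add_apply, Pi.smul_apply, Pi.sub_apply, smul_eq_mul, Set.mem_Icc, hc] at this ⊢
          constructor <;> linarith
        · simp only [Pi.add_apply, Pi.smul_apply, Pi.sub_apply, smul_eq_mul]
          rcases (abs_eq (by norm_num)).1 hj with h1 | h1
          · right; rw [h1, hc]; norm_num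
          · left; rw [h1, hc]; norm_num
      have hms : mass (s • u.1) = s := by
        rw [map_smul, Realization.mass_eq u, smul_eq_mul, mul_one]
      refine ⟨(1 - s, s • u.1), ⟨by simpa using hs1, fun v => ?_, .inr ?_, ?_⟩, ?_⟩
      · exact mul_nonneg hs0.le (u.2.2.1 v)
      · rw [Finsupp.support_smul_eq hs0.ne']
        exact u.2.1
      · simp only [hms]; ring
      · rw [hsub _ u s hs0 (by ring), hu, add_sub_cancel_left, smul_smul, mul_inv_cancel₀ hs0.ne',
          one_smul, add_sub_cancel]

/-- The extension to the cone of a piecewise linear map, pulled back under a linear map, is linear on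
the cells of an arrangement. -/
lemma adhLinear_coneMap [Finite V] {H : Finset ((V →₀ ℝ) →ₗ[ℝ] ℝ)} {h : Realization K → Fin n → ℝ}
    (hH : AdhLinear H h) {M : Type*} {K' : PreAbstractSimplicialComplex M}
    (t : (M →₀ ℝ) →ₗ[ℝ] ℝ) (B : (M →₀ ℝ) →ₗ[ℝ] (V →₀ ℝ))
    (hB : ∀ p : Realization K', (t p.1, B p.1) ∈ conePoints K) :
    ∃ H', AdhLinear (K := K') H' fun p => coneMap h (t p.1, B p.1) := by
  classical
  refine ⟨(H ∪ coords V).image fun f => f ∘ₗ B, fun p => ?_⟩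
  have hadh : ∀ x : Realization K', Adh ((H ∪ coords V).image fun f => f ∘ₗ B) x.1 p.1 →
      Adh (H ∪ coords V) (B x.1) (B p.1) := fun x hx f hf => hx _ (mem_image_of_mem _ hf)
  obtain ⟨-, hz0, hz, -⟩ := hB p
  simp only at hz0 hz
  -- If the base part of $p$ is zero, it is zero on the whole closed cell. Otherwise the base parts,
  -- rescaled to mass $1$, lie in one closed cell of $H$, where $h$ is linear and so agrees with its
  -- homogeneous extension.
  rcases hz with hz | hz
  · refine ⟨t.smulRight fun _ => 1 / 2, fun x hx => ?_⟩
    have := ((hadh x hx).coord subset_union_right hz0).2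
    rw [hz, Finsupp.support_zero, subset_empty, Finsupp.support_eq_empty] at this
    simp [coneMap, this, homogenize_zero]
  · obtain ⟨u, hm, hu⟩ := exists_smul_eq hz0 hz
    obtain ⟨A, hA⟩ := hH u
    refine ⟨t.smulRight (fun _ => 1 / 2) + A ∘ₗ B, fun x hx => ?_⟩
    obtain ⟨-, hx0, hxz, -⟩ := hB x
    simp only at hx0 hxz
    rcases hxz with hxz | hxz
    · simp [coneMap, hxz, homogenize_zero]
    · obtain ⟨w, hmw, hw⟩ := exists_smul_eq hx0 hxz
      have hwu : Adh H w.1 u.1 := by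
        have h1 : Adh H (mass (B p.1) • u.1) u.1 := (Adh.refl u.1).smul hm.le
        rw [← hu] at h1
        have h2 := (((hadh x hx).mono subset_union_left).trans h1).smul (inv_nonneg.2 hmw.le)
        rwa [(inv_smul_eq_iff₀ hmw.ne').2 hw] at h2
      simp only [coneMap, LinearMap.add_apply, LinearMap.smulRight_apply, LinearMap.comp_apply]
      rw [hw, homogenize_smul h w hmw, map_smul, hA w hwu]

end ConeMap

/-! ### The cone on the triangulation: base vertices in `V`, apex `Sum.inr 0`, the rest of `ℕ` for
new vertices. -/

section Base

variable {V : Type*}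

/-- The restriction of a point to the base of the cone. -/
noncomputable def restrictBase : (V ⊕ ℕ →₀ ℝ) →ₗ[ℝ] (V →₀ ℝ) :=
  Finsupp.lcomapDomain Sum.inl Sum.inl_injective

lemma restrictBase_apply (x : V ⊕ ℕ →₀ ℝ) (v : V) : restrictBase x v = x (Sum.inl v) := rfl

variable [Finite V]

open Classical in
/-- The complex `K`, with the empty simplex added and the vertices embedded in `V ⊕ ℕ`. -/
noncomputable def baseComplex (K : PreAbstractSimplicialComplex V) : Finset (Finset (V ⊕ ℕ)) :=
  have := Fintype.ofFinite V
  ((univ : Finset (Finset V)).filter fun s => s = ∅ ∨ s ∈ K.faces).image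
    fun s => s.map Function.Embedding.inl

lemma mem_baseComplex {K : PreAbstractSimplicialComplex V} {s : Finset (V ⊕ ℕ)} :
    s ∈ baseComplex K ↔ ∃ t, (t = ∅ ∨ t ∈ K.faces) ∧ t.map Function.Embedding.inl = s := by
  simp [baseComplex]

lemma isComplex_baseComplex (K : PreAbstractSimplicialComplex V) : IsComplex (baseComplex K) := by
  refine ⟨mem_baseComplex.2 ⟨∅, .inl rfl, by simp⟩, fun s hs r hr => ?_⟩
  obtain ⟨t, ht, rfl⟩ := mem_baseComplex.1 hs
  obtain ⟨u, hu, rfl⟩ := subset_map_iff.1 hr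
  exact mem_baseComplex.2 ⟨u, (isTarget_insert_faces K).down_closed t ht u hu, rfl⟩

lemma inl_mem_vset_baseComplex {K : PreAbstractSimplicialComplex V} {v : V} (hv : {v} ∈ K.faces)
    [DecidableEq (V ⊕ ℕ)] : (Sum.inl v : V ⊕ ℕ) ∈ vset (baseComplex K) :=
  mem_vset.2 ⟨_, mem_baseComplex.2 ⟨{v}, .inr hv, rfl⟩, by simp⟩

lemma exists_of_mem_vset_baseComplex {K : PreAbstractSimplicialComplex V} [DecidableEq (V ⊕ ℕ)]
    {x : V ⊕ ℕ} (hx : x ∈ vset (baseComplex K)) : ∃ v, Sum.inl v = x := by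
  obtain ⟨s, hs, hxs⟩ := mem_vset.1 hx
  obtain ⟨t, -, rfl⟩ := mem_baseComplex.1 hs
  obtain ⟨v, -, rfl⟩ := mem_map.1 hxs
  exact ⟨v, rfl⟩

/-- The cone on `baseComplex K` in the coordinates given by the apex and the base. -/
lemma bijOn_cone_coordinates (K : PreAbstractSimplicialComplex V) [DecidableEq (V ⊕ ℕ)] :
    Set.BijOn (fun x : V ⊕ ℕ →₀ ℝ => (x (Sum.inr 0), restrictBase x))
      {x | x ∈ fcone (cone (Sum.inr 0) (baseComplex K)) ∧ mass x = 1} (conePoints K) := by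
  have hsupp : ∀ x ∈ fcone (cone (Sum.inr 0 : V ⊕ ℕ) (baseComplex K)),
      ∃ t, (t = ∅ ∨ t ∈ K.faces) ∧
        x.support ⊆ insert (Sum.inr 0) (t.map Function.Embedding.inl) := by
    intro x hx
    rcases mem_cone.1 hx.1 with h | ⟨r, hr, h⟩
    · obtain ⟨t, ht, h⟩ := mem_baseComplex.1 h
      exact ⟨t, ht, by rw [← h]; exact subset_insert _ _⟩
    · obtain ⟨t, ht, h'⟩ := mem_baseComplex.1 hr
      exact ⟨t, ht, by rw [← h, ← h']⟩
  have hdecomp : ∀ x ∈ fcone (cone (Sum.inr 0 : V ⊕ ℕ) (baseComplex K)),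
      x = Finsupp.single (Sum.inr 0) (x (Sum.inr 0)) +
        Finsupp.mapDomain Sum.inl (restrictBase x) := by
    intro x hx
    obtain ⟨t, -, ht⟩ := hsupp x hx
    ext u
    rw [Finsupp.add_apply, Finsupp.single_apply]
    rcases u with v | k
    · rw [Finsupp.mapDomain_apply Sum.inl_injective, restrictBase_apply]
      simp
    · rw [Finsupp.mapDomain_of_notMem_range _ _ (by simp), add_zero]
      split_ifs with h
      · rw [h]
      · by_contra h0
        have := ht (Finsupp.mem_support_iff.2 h0)
        simp only [mem_insert, mem_map, Function.Embedding.inl_apply, reduceCtorEq, and_false,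
          exists_false, or_false] at this
        exact h this.symm
  refine ⟨?_, ?_, ?_⟩
  · rintro x ⟨hx, h1⟩
    obtain ⟨t, ht, hxt⟩ := hsupp x hx
    refine ⟨hx.2 _, fun v => hx.2 _, ?_, ?_⟩
    · have hsub : (restrictBase x).support ⊆ t := by
        intro v hv
        rw [Finsupp.mem_support_iff, restrictBase_apply] at hv
        have := hxt (Finsupp.mem_support_iff.2 hv)
        simpa using this
      rcases (isTarget_insert_faces K).down_closed t ht _ hsub with h | h
      · exact .inl (Finsupp.support_eq_empty.1 h)
      · exact .inr h
    · have := congrArg mass (hdecomp x hx)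
      rw [map_add, mass_single, mass_mapDomain, h1] at this
      exact this.symm
  · rintro x ⟨hx, -⟩ y ⟨hy, -⟩ hxy
    obtain ⟨h1, h2⟩ := Prod.mk.inj hxy
    rw [hdecomp x hx, hdecomp y hy, h1, h2]
  · rintro ⟨t, z⟩ ⟨ht, hz0, hz, h1⟩
    simp only at ht hz0 hz h1
    have hval : ∀ u, (Finsupp.single (Sum.inr 0) t + Finsupp.mapDomain Sum.inl z : V ⊕ ℕ →₀ ℝ) u =
        Sum.elim z (fun k => if k = 0 then t else 0) u := by
      rintro (v | k)
      · rw [Finsupp.add_apply, Finsupp.mapDomain_apply Sum.inl_injective]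
        simp
      · rw [Finsupp.add_apply, Finsupp.mapDomain_of_notMem_range _ _ (by simp),
          Finsupp.single_apply]
        simp [eq_comm]
    refine ⟨Finsupp.single (Sum.inr 0) t + Finsupp.mapDomain Sum.inl z, ⟨⟨?_, ?_⟩, ?_⟩, ?_⟩
    · refine (isComplex_cone (isComplex_baseComplex K)).down_closed
        (insert (Sum.inr 0) (z.support.map Function.Embedding.inl)) (mem_cone.2 (.inr ⟨_,
          mem_baseComplex.2 ⟨z.support, hz.imp_left fun h => by rw [h, Finsupp.support_zero],
            rfl⟩, rfl⟩)) _ fun u hu => ?_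
      rw [Finsupp.mem_support_iff, hval] at hu
      rcases u with v | k
      · simpa using hu
      · simp only [Sum.elim_inr, ne_eq, ite_eq_right_iff, Classical.not_imp] at hu
        simp [hu.1]
    · intro u
      rw [hval]
      rcases u with v | k
      · exact hz0 v
      · simp only [Sum.elim_inr]
        split_ifs
        exacts [ht, le_rfl]
    · rw [map_add, mass_single, mass_mapDomain, h1]
    · refine Prod.ext ?_ ?_
      · simp only [hval]; simp
      · ext v
        simp only [restrictBase_apply, hval, Sum.elim_inl]

end Base

/-! ### Passage to the vertex set `Fin m`, and the triangulation of the cube. -/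

section Reindex

variable {U : Type*} [DecidableEq U]

/-- A complex, as an abstract simplicial complex on its set of vertices, indexed by `e`. -/
def reindex {K : Finset (Finset U)} (hK : IsComplex K) {m : ℕ} (e : Fin m ≃ vset K) :
    AbstractSimplicialComplex (Fin m) where
  faces := {s | s.Nonempty ∧ s.map (e.toEmbedding.trans (Function.Embedding.subtype _)) ∈ K}
  isRelLowerSet_faces := fun s hs => ⟨hs.1, fun t hts ht =>
    ⟨ht, hK.down_closed _ hs.2 _ (map_subset_map.2 hts)⟩⟩
  singleton_mem := fun v => ⟨singleton_nonempty v, by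
    simpa using hK.singleton_mem (e v).2⟩

lemma bijOn_reindex {K : Finset (Finset U)} (hK : IsComplex K) {m : ℕ} (e : Fin m ≃ vset K) :
    Set.BijOn (Finsupp.mapDomain fun i => (e i : U))
      {p | IsRealizationPoint (reindex hK e).toPreAbstractSimplicialComplex p}
      {x | x ∈ fcone K ∧ mass x = 1} := by
  have hinj : Function.Injective fun i => (e i : U) := Subtype.val_injective.comp e.injective
  have hsupp : ∀ p : Fin m →₀ ℝ, (Finsupp.mapDomain (fun i => (e i : U)) p).support =
      p.support.map (e.toEmbedding.trans (Function.Embedding.subtype _)) := fun p => by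
    rw [Finsupp.mapDomain_support_of_injective hinj, map_eq_image]
    rfl
  refine ⟨fun p hp => ⟨⟨?_, fun u => ?_⟩, ?_⟩, (Finsupp.mapDomain_injective hinj).injOn,
    fun x hx => ?_⟩
  · rw [hsupp]
    exact hp.1.2
  · by_cases hu : u ∈ Set.range fun i => (e i : U)
    · obtain ⟨i, rfl⟩ := hu
      rw [Finsupp.mapDomain_apply hinj]
      exact hp.2.1 i
    · rw [Finsupp.mapDomain_of_notMem_range _ _ hu]
  · rw [mass_mapDomain]
    exact (isRealizationPoint_iff.1 hp).2.2
  · obtain ⟨⟨hxK, hx0⟩, hx1⟩ := hx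
    have hmap : Finsupp.mapDomain (fun i => (e i : U))
        (Finsupp.comapDomain (fun i => (e i : U)) x hinj.injOn) = x := by
      refine Finsupp.mapDomain_comapDomain _ hinj _ fun u hu => ?_
      exact ⟨e.symm ⟨u, subset_vset hxK hu⟩, by simp⟩
    refine ⟨_, isRealizationPoint_iff.2 ⟨⟨?_, ?_⟩, fun i => hx0 _, ?_⟩, hmap⟩
    · rw [nonempty_iff_ne_empty, ne_eq, Finsupp.support_eq_empty]
      intro h
      rw [h, Finsupp.mapDomain_zero] at hmap
      rw [← hmap, map_zero] at hx1
      exact zero_ne_one hx1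
    · rw [← hsupp, hmap]
      exact hxK
    · rw [← mass_mapDomain (fun i => (e i : U)), hmap, hx1]

end Reindex

/-- A stellar subdivision, relative to the base, of the cone on a triangulation of the boundary of the
cube is a triangulation of the cube. -/
theorem exists_plTriangulation {n k : ℕ} {V : Type*} [DecidableEq (V ⊕ ℕ)]
    (T : PLTriangulation (Cube.boundary (Fin n)) V) [Finite V] {Z : Finset (V ⊕ ℕ)}
    {K : Finset (Finset (V ⊕ ℕ))}
    (hC : Rel (baseComplex T.toComplex) k (cone (Sum.inr 0) (baseComplex T.toComplex)))
    (hK : Stell (vset (baseComplex T.toComplex)) Z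
      (cone (Sum.inr 0) (baseComplex T.toComplex)) K) :
    ∃ (m : ℕ) (e : Fin m ≃ vset K) (T' : PLTriangulation (Set.univ : Set (Fin n → unitInterval))
      (Fin m)),
      (∀ s, s ∈ T'.toComplex.faces ↔
        s.Nonempty ∧ s.map (e.toEmbedding.trans (Function.Embedding.subtype _)) ∈ K) ∧
      ∀ (q : Realization T'.toComplex) (u : Realization T.toComplex),
        Finsupp.mapDomain (fun i => (e i : V ⊕ ℕ)) q.1 = Finsupp.mapDomain Sum.inl u.1 →
        (T'.homeo q).1 = (T.homeo u).1 := by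
  have hKc := (hC.stell hK).isComplex
  let h : Realization T.toComplex → Fin n → ℝ := fun p i => ((T.homeo p).1 i : ℝ)
  have hinj : Function.Injective h := fun p q hpq => T.homeo.injective (Subtype.ext (funext fun i =>
    Subtype.ext (congrFun hpq i)))
  have hrange : Set.range h =
      {y | (∀ i, y i ∈ Set.Icc (0 : ℝ) 1) ∧ ∃ i, y i = 0 ∨ y i = 1} := by
    ext y
    constructor
    · rintro ⟨p, rfl⟩
      refine ⟨fun i => ((T.homeo p).1 i).2, ?_⟩
      obtain ⟨i, hi⟩ := (T.homeo p).2
      exact ⟨i, hi.imp (congrArg Subtype.val) (congrArg Subtype.val)⟩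
    · rintro ⟨hy, i, hi⟩
      refine ⟨T.homeo.symm ⟨fun i => ⟨y i, hy i⟩, i, hi.imp Subtype.ext Subtype.ext⟩, ?_⟩
      funext j
      simp [h]
  obtain ⟨H, hH⟩ := exists_adhLinear T.isPiecewiseLinear
  obtain ⟨pos, hpos, hposL, hmass⟩ := hK.exists_position hC
  let e : Fin (vset K).card ≃ vset K := (vset K).equivFin.symm
  let ψ : (Fin (vset K).card →₀ ℝ) →ₗ[ℝ] (V ⊕ ℕ →₀ ℝ) :=
    Finsupp.linearCombination ℝ pos ∘ₗ Finsupp.lmapDomain ℝ ℝ fun i => (e i : V ⊕ ℕ)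
  let t := Finsupp.lapply (Sum.inr 0) ∘ₗ ψ
  let B := restrictBase ∘ₗ ψ
  have hpos1 : Set.BijOn (Finsupp.linearCombination ℝ pos) {x | x ∈ fcone K ∧ mass x = 1}
      {x | x ∈ fcone (cone (Sum.inr 0) (baseComplex T.toComplex)) ∧ mass x = 1} := by
    refine ⟨fun x hx => ⟨hpos.mapsTo hx.1, by rw [mass_linearCombination hmass, hx.2]⟩,
      hpos.injOn.mono fun x hx => hx.1, fun y hy => ?_⟩
    obtain ⟨x, hx, rfl⟩ := hpos.surjOn hy.1
    exact ⟨x, ⟨hx, by rw [← mass_linearCombination hmass]; exact hy.2⟩, rfl⟩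
  -- The barycentric coordinates of the subdivision, expressed in the cone, are a linear bijection
  -- onto the points of the cone.
  have hcoord : Set.BijOn (fun p => (t p, B p))
      {p | IsRealizationPoint (reindex hKc e).toPreAbstractSimplicialComplex p}
      (conePoints T.toComplex) :=
    (bijOn_cone_coordinates T.toComplex).comp (hpos1.comp (bijOn_reindex hKc e))
  have hbij := (bijOn_coneMap hinj hrange).comp hcoord
  obtain ⟨H', hH'⟩ := adhLinear_coneMap hH
    (K' := (reindex hKc e).toPreAbstractSimplicialComplex) t B fun p => hcoord.mapsTo p.2
  let Φ : Realization (reindex hKc e).toPreAbstractSimplicialComplex →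
      (Set.univ : Set (Fin n → unitInterval)) := fun p =>
    ⟨fun i => ⟨coneMap h (t p.1, B p.1) i, hbij.mapsTo p.2 i⟩, trivial⟩
  have hΦc : Continuous Φ := by
    refine Continuous.subtype_mk (continuous_pi fun i => Continuous.subtype_mk ?_ _) _
    exact (continuous_apply i).comp hH'.continuous
  have hΦb : Function.Bijective Φ := by
    constructor
    · intro p q hpq
      refine Subtype.ext (hbij.injOn p.2 q.2 (funext fun i => ?_))
      exact congrArg Subtype.val (congrFun (congrArg Subtype.val hpq) i)
    · rintro ⟨y, -⟩
      obtain ⟨p, hp, hpy⟩ := hbij.surjOn (show (fun i => (y i : ℝ)) ∈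
        {y : Fin n → ℝ | ∀ i, y i ∈ Set.Icc (0 : ℝ) 1} from fun i => (y i).2)
      refine ⟨⟨p, hp⟩, Subtype.ext (funext fun i => Subtype.ext ?_)⟩
      exact congrFun hpy i
  have := compactSpace_realization (reindex hKc e).toPreAbstractSimplicialComplex
  refine ⟨_, e, ⟨inferInstance, reindex hKc e,
    Continuous.homeoOfEquivCompactToT2 (f := Equiv.ofBijective Φ hΦb) hΦc,
    hH'.isPiecewiseLinear⟩, fun s => Iff.rfl, fun q u hqu => ?_⟩
  funext i
  refine Subtype.ext ?_
  change coneMap h (t q.1, B q.1) i = h u i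
  -- Base vertices are not moved by the placement, so on the base the cone map is the given
  -- homeomorphism.
  have hψ : ψ q.1 = Finsupp.mapDomain Sum.inl u.1 := by
    change Finsupp.linearCombination ℝ pos (Finsupp.mapDomain (fun i => (e i : V ⊕ ℕ)) q.1) = _
    rw [hqu]
    have : Finsupp.linearCombination ℝ pos ∘ₗ Finsupp.lmapDomain ℝ ℝ (Sum.inl : V → V ⊕ ℕ) =
        Finsupp.lmapDomain ℝ ℝ Sum.inl := by
      refine Finsupp.lhom_ext' fun v => LinearMap.ext_ring ?_
      simp [hposL _ (inl_mem_vset_baseComplex (T.complex.singleton_mem v))]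
    exact LinearMap.congr_fun this u.1
  have ht : t q.1 = 0 := by
    change ψ q.1 (Sum.inr 0) = 0
    rw [hψ, Finsupp.mapDomain_of_notMem_range _ _ (by simp)]
  have hB : B q.1 = (1 : ℝ) • u.1 := by
    change restrictBase (ψ q.1) = _
    rw [hψ, one_smul]
    ext v
    rw [restrictBase_apply, Finsupp.mapDomain_apply Sum.inl_injective]
  rw [ht, hB, coneMap, homogenize_smul h u one_pos]
  simp

end StellarFill

/-! ### Proof of the theorem. -/

open StellarFill Finset in
theorem theorem2 (n : ℕ) {W : Type*} (X : PreAbstractSimplicialComplex W)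
    (hX : IsWeaklyCohenMacaulay X n)
    {V : Type*} (T : PLTriangulation (Cube.boundary (Fin n)) V)
    (f : Cube.boundary (Fin n) → Realization X)
    (φ : SimplicialMap T.toComplex X) (hf : T.IsSimplicialVia f φ) :
    ∃ (m : ℕ) (T' : PLTriangulation (Set.univ : Set (Fin n → unitInterval)) (Fin m))
      (g : (Fin n → unitInterval) → Realization X)
      (γ : SimplicialMap T'.toComplex X),
      T'.Extends T ∧
      T'.IsSimplicialVia (fun x => g x.1) γ ∧
      (∀ x : Cube.boundary (Fin n), g x.1 = f x) ∧
      (∀ v : Fin m, (T'.vertexPoint v).1 ∉ Cube.boundary (Fin n) → γ.MapsLinkToLink v) ∧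
      (φ.SimplexwiseInjective → γ.SimplexwiseInjective) := by
  classical
  have := T.finite
  have hcard : ∀ s ∈ T.toComplex.faces, s.card ≤ n := by
    obtain ⟨H, hH⟩ := exists_adhLinear T.isPiecewiseLinear
    intro s hs
    refine card_le_of_injective hH (fun p q hpq => T.homeo.injective (Subtype.ext (funext fun i =>
      Subtype.ext (congrFun hpq i)))) (fun p => ?_) hs
    obtain ⟨i, hi⟩ := (T.homeo p).2
    exact ⟨i, hi.imp (congrArg Subtype.val) (congrArg Subtype.val)⟩
  have hW : Nonempty W := by
    obtain ⟨F, -⟩ := hX.1 0 (by omega) ⟨fun x => absurd x.2.choose.2 (by simp), by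
      refine continuous_of_const fun x => absurd x.2.choose.2 (by simp)⟩
    exact ⟨(X.isRelLowerSet_faces (F 0).2.1).1.choose⟩
  set L := baseComplex T.toComplex with hL
  have haL : (Sum.inr 0 : V ⊕ ℕ) ∉ vset L := fun h => by
    obtain ⟨v, hv⟩ := exists_of_mem_vset_baseComplex h
    cases hv
  have hLc : ∀ s ∈ L, s.card ≤ n := fun s hs => by
    obtain ⟨t, ht, rfl⟩ := mem_baseComplex.1 hs
    rw [card_map]
    rcases ht with rfl | ht
    exacts [by simp, hcard t ht]
  have hgood : GoodFill (V ⊕ ℕ) (insert ∅ X.faces) n := goodFill_of_isWeaklyCohenMacaulay hX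
  obtain ⟨K, hK, g, hgf, hgX, hgd⟩ := hgood L (isComplex_baseComplex _) hLc
    (Sum.elim φ.toFun fun _ => Classical.arbitrary W) (fun s hs => by
      obtain ⟨t, ht, rfl⟩ := mem_baseComplex.1 hs
      rw [map_eq_image, image_image]
      rcases ht with rfl | ht
      · exact .inl (by simp)
      · exact .inr (by convert! φ.image_mem t ht)) (vset L) subset_rfl (Sum.inr 0) haL
  have hC := rel_cone (isComplex_baseComplex _) hLc haL
  have hrel := hC.stell hK
  obtain ⟨m, e, T', hT', hhomeo⟩ := exists_plTriangulation T hC hK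
  have hgv : ∀ v : V, g (Sum.inl v) = φ.toFun v := fun v =>
    hgf _ (inl_mem_vset_baseComplex (T.complex.singleton_mem v))
  have hinlK : ∀ v : V, (Sum.inl v : V ⊕ ℕ) ∈ vset K := fun v =>
    hrel.vset_subset (inl_mem_vset_baseComplex (T.complex.singleton_mem v))
  let ι : V → Fin m := fun v => e.symm ⟨Sum.inl v, hinlK v⟩
  have heι : ∀ v, (e (ι v) : V ⊕ ℕ) = Sum.inl v := fun v => by simp [ι]
  have hιinj : Function.Injective ι := fun v w h => by
    have := heι v
    rw [h, heι w] at this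
    exact (Sum.inl_injective this).symm
  have hemb : ∀ s : Finset (Fin m),
      s.map (e.toEmbedding.trans (Function.Embedding.subtype _)) =
        s.image fun i => (e i : V ⊕ ℕ) := fun s => by rw [map_eq_image]; rfl
  let ι' : SimplicialMap T.toComplex T'.toComplex := ⟨ι, fun s hs => by
    suffices h : s.image ι ∈ T'.toComplex.faces by convert! h
    rw [hT', hemb]
    refine ⟨(T.toComplex.isRelLowerSet_faces hs).1.image _, hrel.subset (mem_baseComplex.2
      ⟨s, .inr hs, ?_⟩)⟩
    ext u
    simp [heι]⟩
  let γ : SimplicialMap T'.toComplex X := ⟨fun i => g (e i), fun s hs => by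
    obtain ⟨hs0, hs⟩ := (hT' s).1 hs
    have := hgX _ hs
    rw [hemb, image_image] at this
    rcases this with h | h
    · rw [image_eq_empty] at h
      exact absurd h hs0.ne_empty
    · convert! h⟩
  have hext : ∀ p, (T'.homeo (ι'.realize p)).1 = (T.homeo p).1 := fun p => by
    refine hhomeo _ _ ?_
    change Finsupp.mapDomain _ (Finsupp.mapDomain ι p.1) = _
    rw [← Finsupp.mapDomain_comp]
    congr 1
    funext v
    exact heι v
  -- The property used for both (i) and (ii): an edge with equal end values is a doubled simplex,
  -- hence lies in $L$.
  have hedge : ∀ s ∈ T'.toComplex.faces, ∀ v ∈ s, ∀ w ∈ s, v ≠ w → g (e v) = g (e w) →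
      ∃ t ∈ T.toComplex.faces, ∃ x ∈ t, ∃ y ∈ t, ι x = v ∧ ι y = w := by
    intro s hs v hv w hw hvw hg
    have hmem : ({(e v : V ⊕ ℕ), (e w : V ⊕ ℕ)} : Finset (V ⊕ ℕ)) ∈ K := by
      refine hrel.isComplex.down_closed _ ((hT' s).1 hs).2 _ ?_
      rw [hemb]
      exact insert_subset (mem_image_of_mem _ hv) (singleton_subset_iff.2 (mem_image_of_mem _ hw))
    have hne : (e v : V ⊕ ℕ) ≠ e w := fun h => hvw (e.injective (Subtype.ext h))
    have hL' := hgd _ hmem (by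
      intro x hx
      rcases mem_insert.1 hx with rfl | hx
      · exact ⟨e w, by simp, hne.symm, hg.symm⟩
      · obtain rfl := mem_singleton.1 hx
        exact ⟨e v, by simp, hne, hg⟩)
    obtain ⟨t, ht, hte⟩ := mem_baseComplex.1 hL'
    have h1 : (e v : V ⊕ ℕ) ∈ t.map Function.Embedding.inl := by rw [hte]; simp
    have h2 : (e w : V ⊕ ℕ) ∈ t.map Function.Embedding.inl := by rw [hte]; simp
    obtain ⟨x, hx, hxv⟩ := mem_map.1 h1
    obtain ⟨y, hy, hyw⟩ := mem_map.1 h2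
    refine ⟨t, ht.resolve_left (by rintro rfl; simp at hx), x, hx, y, hy, ?_, ?_⟩
    · exact e.injective (Subtype.ext ((heι x).trans hxv))
    · exact e.injective (Subtype.ext ((heι y).trans hyw))
  refine ⟨m, T', fun x => γ.realize (T'.homeo.symm ⟨x, trivial⟩), γ, ⟨ι', hιinj, hext⟩,
    fun p => ?_, fun x => ?_, fun v hv t ht => ?_, fun hφ s hs v hv w hw hvw => ?_⟩
  · change γ.realize (T'.homeo.symm (T'.homeo p)) = _
    rw [Homeomorph.symm_apply_apply]
  · obtain ⟨p, rfl⟩ := T.homeo.surjective x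
    have h1 : T'.homeo.symm ⟨(T.homeo p).1, trivial⟩ = ι'.realize p := by
      rw [Homeomorph.symm_apply_eq]
      exact Subtype.ext (hext p).symm
    change γ.realize (T'.homeo.symm ⟨(T.homeo p).1, trivial⟩) = _
    rw [h1, hf p]
    refine Subtype.ext ?_
    change Finsupp.mapDomain _ (Finsupp.mapDomain ι p.1) = Finsupp.mapDomain φ.toFun p.1
    rw [← Finsupp.mapDomain_comp]
    congr 1
    funext v
    change g (e (ι v)) = _
    rw [heι, hgv]
  · obtain ⟨ht0, htd, htK⟩ := ht
    refine ⟨ht0.image _, ?_, ?_⟩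
    · rw [disjoint_singleton_left] at htd ⊢
      intro h
      obtain ⟨w, hw, hwv⟩ := mem_image.1 h
      have hvw : v ≠ w := by rintro rfl; exact htd hw
      -- A vertex $w$ of the link with the image of $v$ would make $v$ a vertex of $L$, placed on
      -- the boundary.
      obtain ⟨-, -, x, -, -, -, hx, -⟩ := hedge _ htK v (by simp) w (by simp [hw]) hvw hwv.symm
      refine hv ?_
      have : T'.vertexPoint v = T'.homeo (ι'.realize (Realization.vertex T.toComplex x
          (T.complex.singleton_mem x))) := by
        rw [PLTriangulation.vertexPoint]
        congr 1
        refine Subtype.ext ?_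
        change Finsupp.single v 1 = Finsupp.mapDomain ι (Finsupp.single x 1)
        rw [Finsupp.mapDomain_single, hx]
      rw [this, hext]
      exact (T.homeo _).2
    · convert! γ.image_mem _ htK using 1
      simp [image_insert]
  · by_contra hne
    obtain ⟨t, ht, x, hx, y, hy, rfl, rfl⟩ := hedge s hs v hv w hw hne hvw
    refine hne (congrArg ι (hφ t ht hx hy ?_))
    change g (e (ι x)) = g (e (ι y)) at hvw
    rwa [heι, heι, hgv, hgv] at hvw
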